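/- **Proposition 3.4.** *Setting.* Let $(X,Y)$ take values in $\mathcal X\times\mathbb R$, let $\mu$ be the law of $X$, and write $\|f\|_{L_p}=(\mathbb E|f(X)|^p)^{1/p}$, $\|f-Y\|_{L_p}=(\mathbb E|f(X)-Y|^p)^{1/p}$. Let $Y\in L_2$ and let $\mathcal F\subset L_2(\mu)$ be a locally compact class of measurable real functions on $\mathcal X$ which is pointwise measurable (it has a countable subset such that each $f\in\mathcal F$ is the pointwise limit of a sequence from that subset). Let $f^*\in\mathcal F$ minimize $\mathbb E(f(X)-Y)^2$ over $f\in\mathcal F$, and let $\sigma>0$. Assume one of the following. (A) $L\ge 1$, $\mathcal F$ is convex, $\|f-h\|_{L_4}\le L\|f-h\|_{L_2}$ and $\|f-Y\|_{L_4}\le L\|f-Y\|_{L_2}$ for all $f,h\in\mathcal F$, and $\|f^*-Y\|_{L_2}\le\sigma$. (Put $q=4$.) (B) $q>2$, $L>1$, $\|f\|_{L_q}\le L\|f\|_{L_2}$ for all $f\in\mathrm{span}(\mathcal F)$, and $Y=f_0(X)+W$ with $f_0\in\mathcal F$ and $W$ independent of $X$, $\mathbb EW=0$, $\|W\|_{L_2}\le\sigma$.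 *Complexity parameters.* For $h\in\mathcal F$ and $\rho>0$ let $\mathcal F_{h,\rho}=\{\lambda(f-h): f\in\mathcal F,\ 0\le\lambda\le1,\ \|\lambda(f-h)\|_{L_2}\le\rho\}$, and let $\mathcal M(\mathcal F_{h,\rho},\varepsilon)$ be the largest cardinality of a subset whose distinct points are at $L_2$-distance at least $\varepsilon$. Let $(X_i,Y_i)$ be independent copies of $(X,Y)$ and $\varepsilon_i$ independent uniform random signs, independent of the copies. Put, with infima over $\rho>0$ and $\inf\emptyset=\infty$, $$\lambda_{\mathcal Q}(\kappa,\eta,h)=\inf\{\rho:\log\mathcal M(\mathcal F_{h,\rho},\eta\rho)\le\kappa^2N\},\qquad \lambda_{\mathcal M}(\kappa,\eta,h)=\inf\{\rho:\log\mathcal M(\mathcal F_{h,\rho},\eta\rho)\le\kappa^2N\rho^2\},$$ $$r_E(\kappa,h)=\inf\Big\{\rho:\mathbb E\sup_{u\in\mathcal F_{h,\rho}}\Big|\tfrac1{\sqrt N}\sum_{i=1}^N\varepsilon_iu(X_i)\Big|\le\kappa\sqrt N\rho\Big\},$$ $$\bar r_{\mathcal M}(\kappa,h)=\inf\Big\{\rho:\mathbb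 E\sup_{u\in\mathcal F_{h,\rho}}\Big|\tfrac1{\sqrt N}\sum_{i=1}^N\varepsilon_iu(X_i)(h(X_i)-Y_i)\Big|\le\kappa\sqrt N\rho^2\Big\},$$ and $r^*(f^*)=\max\{\lambda_{\mathcal Q}(c_1,c_2,f^*),\lambda_{\mathcal M}(c_1/\sigma,c_2,f^*),r_E(c_1,f^*),\bar r_{\mathcal M}(c_1,f^*)\}$. *Preliminary round.* Fix $r>0$, constants $\alpha,\beta,\theta>0$ and an integer $\ell\ge1$. Let $(X_i,Y_i)_{i=1}^{2N}$ be independent copies of $(X,Y)$. For $f,h\in\mathcal F$ let $\Phi(f,h)$ be the smallest median of the means of $|f(X_i)-h(X_i)|$ over $\lfloor N/\ell\rfloor$ consecutive blocks of length $\ell$ in $\{1,\dots,N\}$; put $\mathcal{DO}(f,h)=1$ if $\Phi(f,h)\ge\beta r$ and $\mathcal{DO}(f,h)=0$ otherwise (also if $N<\ell$). Let $n=\lfloor\theta N\min\{1,(r/\sigma)^2\}\rfloor$, and let $I_1,\dots,I_n$ be consecutive disjoint blocks of length $\lfloor N/n\rfloor$ in $\{N+1,\dots,2N\}$, starting at $N+1$.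 The function $f$ *defeats* $h$ if $\mathcal{DO}(f,h)=1$ and $$\frac1{|I_j|}\sum_{i\in I_j}\big((f(X_i)-Y_i)^2-(h(X_i)-Y_i)^2\big)<0$$ for more than $n/2$ of the indices $j$. A function in $\mathcal F$ *qualifies* if no $h\in\mathcal F$ defeats it; $H$ is the set of qualifiers. *Claim.* There are constants $c_0,c_1,c_2,\theta,\alpha,\beta>0$ with $c_2<1$, $\theta<1/4$, $\alpha<1<\beta$, and an integer $\ell\ge1$, depending only on $L$ in case (A) and only on $q$ and $L$ in case (B), such that for all $N$, $(X,Y)$, $\mathcal F$, $f^*$, $\sigma$ as above and every $r>0$ with $r\ge2r^*(f^*)$ the following hold simultaneously with probability at least $$1-2\exp\big(-c_0N\min\{1,r^2/\sigma^2\}\big)$$ (that is, on a measurable set of samples of at least this probability): 1. for every $h\in\mathcal F$ with $\mathcal{DO}(f^*,h)=1$, $f^*$ defeats $h$; 2. $f^*\in H$; 3. every $h\in H$ satisfies $\mathcal{DO}(f^*,h)=0$ and $\|h-f^*\|_{L_2}\le(\beta/\alpha)r$. -/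

import Mathlib

open MeasureTheory ProbabilityTheory
open scoped ENNReal

universe u

noncomputable section

namespace MoMTournament

variable {𝓧 : Type u}

/-! Throughout, `P` is the joint law of `(X, Y)` on `𝓧 × ℝ`, the law of `X` is
`P.map Prod.fst`, and a class of functions is a set `F` of functions `𝓧 → ℝ`. -/

/-- The star-shaped hull of `A` around `0`: all `t • a` with `a ∈ A` and `0 ≤ t ≤ 1`. -/
def starZero (A : Set (𝓧 → ℝ)) : Set (𝓧 → ℝ) :=
  {u | ∃ a ∈ A, ∃ t : ℝ, 0 ≤ t ∧ t ≤ 1 ∧ u = t • a}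

/-- The localization `F_{h,r} = star(F - h, 0) ∩ rD`, where `D` is the unit ball of `L₂(μ)`. -/
def localization [MeasurableSpace 𝓧] (μ : Measure 𝓧) (F : Set (𝓧 → ℝ)) (h : 𝓧 → ℝ) (r : ℝ) :
    Set (𝓧 → ℝ) :=
  {u | u ∈ starZero ((fun f => f - h) '' F) ∧ eLpNorm u 2 μ ≤ ENNReal.ofReal r}

/-- The packing number `M(H, εD)`: the largest cardinality (possibly `⊤`) of a subset of `H`
whose distinct points are at `L₂(μ)` distance at least `ε`. -/
def packingNumber [MeasurableSpace 𝓧] (μ : Measure 𝓧) (H : Set (𝓧 → ℝ)) (ε : ℝ) : ℕ∞ :=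
  ⨆ (T : Finset (𝓧 → ℝ)) (_ : (T : Set (𝓧 → ℝ)) ⊆ H)
    (_ : ∀ f ∈ T, ∀ g ∈ T, f ≠ g → ENNReal.ofReal ε ≤ eLpNorm (f - g) 2 μ), (T.card : ℕ∞)

/-- `log M(F_{h,r}, η r D)`, with value `⊤` when the packing number is infinite. -/
def logPacking [MeasurableSpace 𝓧] (μ : Measure 𝓧) (F : Set (𝓧 → ℝ)) (h : 𝓧 → ℝ) (η r : ℝ) :
    EReal :=
  ENNReal.log ((packingNumber μ (localization μ F h r) (η * r) : ℕ∞) : ℝ≥0∞)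

/-- `λ_Q(κ, η, h)`; the infimum of the empty set is `⊤`. -/
def lambdaQ [MeasurableSpace 𝓧] (μ : Measure 𝓧) (N : ℕ) (F : Set (𝓧 → ℝ)) (h : 𝓧 → ℝ)
    (κ η : ℝ) : ℝ≥0∞ :=
  ⨅ (r : ℝ) (_ : 0 < r) (_ : logPacking μ F h η r ≤ ((κ ^ 2 * N : ℝ) : EReal)), ENNReal.ofReal r

/-- `λ_M(κ, η, h)`; the infimum of the empty set is `⊤`. -/
def lambdaM [MeasurableSpace 𝓧] (μ : Measure 𝓧) (N : ℕ) (F : Set (𝓧 → ℝ)) (h : 𝓧 → ℝ)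
    (κ η : ℝ) : ℝ≥0∞ :=
  ⨅ (r : ℝ) (_ : 0 < r) (_ : logPacking μ F h η r ≤ ((κ ^ 2 * N * r ^ 2 : ℝ) : EReal)),
    ENNReal.ofReal r

/-- `E sup_{u ∈ A} |N^{-1/2} ∑ᵢ εᵢ ξ(Xᵢ, Yᵢ) u(Xᵢ)|`, where `(Xᵢ, Yᵢ)` are independent with law `P`
and `εᵢ` are independent uniform signs, independent of the sample. The expectation over the signs
is written as the average over all `2 ^ N` sign vectors. -/
def rademacherSup [MeasurableSpace 𝓧] (P : Measure (𝓧 × ℝ)) (N : ℕ) (A : Set (𝓧 → ℝ))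
    (ξ : 𝓧 × ℝ → ℝ) : ℝ≥0∞ :=
  (2 ^ N)⁻¹ * ∑ ε ∈ Fintype.piFinset (fun _ : Fin N => ({-1, 1} : Finset ℝ)),
    ∫⁻ D, ⨆ v ∈ A, ENNReal.ofReal |(√(N : ℝ))⁻¹ * ∑ i, ε i * (ξ (D i) * v (D i).1)|
      ∂(Measure.pi fun _ : Fin N => P)

/-- `r_E(κ, h)`; the infimum of the empty set is `⊤`. -/
def rE [MeasurableSpace 𝓧] (P : Measure (𝓧 × ℝ)) (N : ℕ) (F : Set (𝓧 → ℝ)) (h : 𝓧 → ℝ)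
    (κ : ℝ) : ℝ≥0∞ :=
  ⨅ (r : ℝ) (_ : 0 < r)
    (_ : rademacherSup P N (localization (P.map Prod.fst) F h r) (fun _ => 1)
      ≤ ENNReal.ofReal (κ * √(N : ℝ) * r)), ENNReal.ofReal r

/-- The multiplier fixed point `r̄_M(κ, h)`; the infimum of the empty set is `⊤`. -/
def rM [MeasurableSpace 𝓧] (P : Measure (𝓧 × ℝ)) (N : ℕ) (F : Set (𝓧 → ℝ)) (h : 𝓧 → ℝ)
    (κ : ℝ) : ℝ≥0∞ :=
  ⨅ (r : ℝ) (_ : 0 < r)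
    (_ : rademacherSup P N (localization (P.map Prod.fst) F h r) (fun z => h z.1 - z.2)
      ≤ ENNReal.ofReal (κ * √(N : ℝ) * r ^ 2)), ENNReal.ofReal r

/-- `r*(h) = max {λ_Q(c₁, c₂, h), λ_M(c₁/σ, c₂, h), r_E(c₁, h), r̄_M(c₁, h)}`. -/
def rStar [MeasurableSpace 𝓧] (P : Measure (𝓧 × ℝ)) (N : ℕ) (F : Set (𝓧 → ℝ)) (h : 𝓧 → ℝ)
    (σ c₁ c₂ : ℝ) : ℝ≥0∞ :=
  max (max (lambdaQ (P.map Prod.fst) N F h c₁ c₂) (lambdaM (P.map Prod.fst) N F h (c₁ / σ) c₂))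
    (max (rE P N F h c₁) (rM P N F h c₁))

/-- The class is locally compact as a subset of `L₂(μ)`. -/
def IsLocallyCompactClass [MeasurableSpace 𝓧] (μ : Measure 𝓧) (F : Set (𝓧 → ℝ)) : Prop :=
  LocallyCompactSpace {g : Lp ℝ 2 μ | ∃ f ∈ F, (g : 𝓧 → ℝ) =ᵐ[μ] f}

/-- The usual measurability condition for suprema over `F`: some countable subset `G` of `F` is
such that every member of `F` is the pointwise limit of a sequence from `G`. -/
def IsPointwiseMeasurableClass (F : Set (𝓧 → ℝ)) : Prop :=
  ∃ G ⊆ F, G.Countable ∧ ∀ f ∈ F, ∃ g : ℕ → 𝓧 → ℝ, (∀ k, g k ∈ G) ∧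
    ∀ x, Filter.Tendsto (fun k => g k x) Filter.atTop (nhds (f x))

/-- `fs` minimizes the risk `E (f(X) - Y)²` over `F`. -/
def IsRiskMinimizer [MeasurableSpace 𝓧] (P : Measure (𝓧 × ℝ)) (F : Set (𝓧 → ℝ))
    (fs : 𝓧 → ℝ) : Prop :=
  fs ∈ F ∧ ∀ f ∈ F, ∫ z, (fs z.1 - z.2) ^ 2 ∂P ≤ ∫ z, (f z.1 - z.2) ^ 2 ∂P

/-- The standing assumptions: `F ⊆ L₂(μ)` is a locally compact class of measurable functions
(with the measurability condition above), `Y ∈ L₂`, and `fs` is a risk minimizer in `F`. -/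
structure LearningProblem [MeasurableSpace 𝓧] (P : Measure (𝓧 × ℝ)) (F : Set (𝓧 → ℝ))
    (fs : 𝓧 → ℝ) : Prop where
  measurable : ∀ f ∈ F, Measurable f
  pointwiseMeasurable : IsPointwiseMeasurableClass F
  memLp : ∀ f ∈ F, MemLp f 2 (P.map Prod.fst)
  memLp_target : MemLp (fun z : 𝓧 × ℝ => z.2) 2 P
  locallyCompact : IsLocallyCompactClass (P.map Prod.fst) F
  minimizer : IsRiskMinimizer P F fs

/-- Convex class, `L₄`-`L₂` norm equivalence for differences `f - h` and for `f(X) - Y`,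
and `‖fs(X) - Y‖_{L₂} ≤ σ`. -/
structure ConvexSetting [MeasurableSpace 𝓧] (L σ : ℝ) (P : Measure (𝓧 × ℝ)) (F : Set (𝓧 → ℝ))
    (fs : 𝓧 → ℝ) : Prop extends LearningProblem P F fs where
  convex : Convex ℝ F
  norm_sub : ∀ f ∈ F, ∀ h ∈ F, eLpNorm (f - h) 4 (P.map Prod.fst)
    ≤ ENNReal.ofReal L * eLpNorm (f - h) 2 (P.map Prod.fst)
  norm_noise : ∀ f ∈ F, eLpNorm (fun z : 𝓧 × ℝ => f z.1 - z.2) 4 P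
    ≤ ENNReal.ofReal L * eLpNorm (fun z : 𝓧 × ℝ => f z.1 - z.2) 2 P
  noise_le : eLpNorm (fun z : 𝓧 × ℝ => fs z.1 - z.2) 2 P ≤ ENNReal.ofReal σ

/-- `L_q`-`L₂` norm equivalence on the linear span of `F`, and `Y = f₀(X) + W` with `f₀ ∈ F`, where
the noise `W = Y - f₀(X)` is independent of `X`, has mean zero and `‖W‖_{L₂} ≤ σ`. -/
structure IndependentNoiseSetting [MeasurableSpace 𝓧] (q L σ : ℝ) (P : Measure (𝓧 × ℝ))
    (F : Set (𝓧 → ℝ)) (fs : 𝓧 → ℝ) : Prop extends LearningProblem P F fs where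
  norm_span : ∀ f ∈ Submodule.span ℝ F, eLpNorm f (ENNReal.ofReal q) (P.map Prod.fst)
    ≤ ENNReal.ofReal L * eLpNorm f 2 (P.map Prod.fst)
  noise : ∃ f₀ ∈ F, IndepFun (fun z : 𝓧 × ℝ => z.2 - f₀ z.1) Prod.fst P ∧
    ∫ z, (z.2 - f₀ z.1) ∂P = 0 ∧
    eLpNorm (fun z : 𝓧 × ℝ => z.2 - f₀ z.1) 2 P ≤ ENNReal.ofReal σ

/-- The mean of `v` over the `j`-th (`j = 0, 1, …`) consecutive block of `m` coordinates. -/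
def blockMean {N : ℕ} (m : ℕ) (v : Fin N → ℝ) (j : ℕ) : ℝ :=
  (m : ℝ)⁻¹ *
    ∑ i ∈ Finset.univ.filter (fun i : Fin N => j * m ≤ i.val ∧ i.val < (j + 1) * m), v i

/-- The smallest median of `z₁, …, z_k`: the least `t` such that at least half of the values are
at most `t` and at least half of the values are at least `t`. -/
def smallestMedian {k : ℕ} (z : Fin k → ℝ) : ℝ :=
  sInf {t : ℝ | k ≤ 2 * (Finset.univ.filter fun j => z j ≤ t).card ∧
    k ≤ 2 * (Finset.univ.filter fun j => t ≤ z j).card}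

/-- `Med_ℓ(v)`: the median of the means of `v` over `⌊N / ℓ⌋` consecutive blocks of length `ℓ`
(when `ℓ` divides `N` these partition all the coordinates). -/
def medianOfMeans {N : ℕ} (ℓ : ℕ) (v : Fin N → ℝ) : ℝ :=
  smallestMedian fun j : Fin (N / ℓ) => blockMean ℓ v j

/-- `Φ(f, h) = Med_ℓ (|f(Xᵢ) - h(Xᵢ)|)ᵢ`, computed on the first sample. -/
def distFunctional {N : ℕ} (ℓ : ℕ) (D : Fin N → 𝓧 × ℝ) (f h : 𝓧 → ℝ) : ℝ :=
  medianOfMeans ℓ fun i => |f (D i).1 - h (D i).1|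

/-- The distance oracle says `DO(f, h) = 1`: the match between `f` and `h` takes place. -/
def MatchAllowed {N : ℕ} (ℓ : ℕ) (β r : ℝ) (D : Fin N → 𝓧 × ℝ) (f h : 𝓧 → ℝ) : Prop :=
  β * r ≤ distFunctional ℓ D f h

/-- The number of blocks, the integer part of `θ N min {1, (r/σ)²}`. -/
def numBlocks (θ σ r : ℝ) (N : ℕ) : ℕ :=
  ⌊θ * N * min 1 ((r / σ) ^ 2)⌋₊

/-- `B_{f,h}(j)`: the mean of `(f(Xᵢ) - Yᵢ)² - (h(Xᵢ) - Yᵢ)²` over the `j`-th block of length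
`m = ⌊N / n⌋` of the second sample. -/
def blockLossDiff {N : ℕ} (n : ℕ) (D : Fin N → 𝓧 × ℝ) (f h : 𝓧 → ℝ) (j : ℕ) : ℝ :=
  blockMean (N / n) (fun i => (f (D i).1 - (D i).2) ^ 2 - (h (D i).1 - (D i).2) ^ 2) j

/-- `f` defeats `h`: their match takes place, and `f` has the smaller empirical loss on more than
half of the `n` blocks of the second sample. -/
def Defeats {N : ℕ} (ℓ n : ℕ) (β r : ℝ) (D₁ D₂ : Fin N → 𝓧 × ℝ) (f h : 𝓧 → ℝ) : Prop :=
  MatchAllowed ℓ β r D₁ f h ∧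
    n < 2 * (Finset.univ.filter fun j : Fin n => blockLossDiff n D₂ f h j < 0).card

/-- The set `H` of qualifiers: members of `F` that lose no match against a member of `F`. -/
def qualifiers {N : ℕ} (ℓ n : ℕ) (β r : ℝ) (F : Set (𝓧 → ℝ)) (D₁ D₂ : Fin N → 𝓧 × ℝ) :
    Set (𝓧 → ℝ) :=
  {f | f ∈ F ∧ ∀ h ∈ F, ¬ Defeats ℓ n β r D₁ D₂ h f}

/-- The event, in the samples `(Xᵢ, Yᵢ)_{i ≤ N}` and `(Xᵢ, Yᵢ)_{N < i ≤ 2N}`, on which `fs` defeats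
every `h ∈ F` that it meets, `fs` qualifies, and every qualifier `h` has `DO(fs, h) = 0` and is
within `(β/α) r` of `fs`. -/
def preliminaryRoundEvent [MeasurableSpace 𝓧] (P : Measure (𝓧 × ℝ)) (F : Set (𝓧 → ℝ))
    (fs : 𝓧 → ℝ) (N ℓ n : ℕ) (α β r : ℝ) : Set ((Fin N → 𝓧 × ℝ) × (Fin N → 𝓧 × ℝ)) :=
  {D | (∀ h ∈ F, MatchAllowed ℓ β r D.1 fs h → Defeats ℓ n β r D.1 D.2 fs h) ∧
    fs ∈ qualifiers ℓ n β r F D.1 D.2 ∧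
    ∀ h ∈ qualifiers ℓ n β r F D.1 D.2, ¬ MatchAllowed ℓ β r D.1 fs h ∧
      eLpNorm (h - fs) 2 (P.map Prod.fst) ≤ ENNReal.ofReal (β / α * r)}

/-- `E` has (inner) probability at least `p`: it contains a measurable set of probability at
least `p`. -/
def HoldsWithProb {Ω : Type u} [MeasurableSpace Ω] (Q : Measure Ω) (p : ℝ) (E : Set Ω) : Prop :=
  ∃ A ⊆ E, MeasurableSet A ∧ ENNReal.ofReal p ≤ Q A

/-- The law of the two independent samples of `N` independent pairs each. -/
def sampleLaw [MeasurableSpace 𝓧] (P : Measure (𝓧 × ℝ)) (N : ℕ) :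
    Measure ((Fin N → 𝓧 × ℝ) × (Fin N → 𝓧 × ℝ)) :=
  (Measure.pi fun _ : Fin N => P).prod (Measure.pi fun _ : Fin N => P)

end MoMTournament

end

/-! Write ξ = f* - Y and, for h in the class, let u be h - f* scaled down to L₂ norm at most r, so
that u lies in the localization of the class around f*. Everything follows from three uniform
estimates. Outside an event of exponentially small probability, for all u at once, the block means
of |u| (on the ℓ-blocks of the first sample and on the n blocks of the second) and the block means
of ξu (second sample) are close to their expectations on all but a tenth of the blocks. The
remaining argument is deterministic.

Norm equivalence gives a constant a, `l1Ratio`, with a‖w‖₂ ≤ E|w| ≤ ‖w‖₂ for differences w of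
members of the class. The median of block means of |h - f*| is then below 2r when ‖h - f*‖ < r and
at least 2r when ‖h - f*‖ > 4r/a. This is the distance oracle with β = 2 and α = a/2. In a match
with f*, the loss of h exceeds that of f* on a block by the mean of (h - f*)² + 2ξ(h - f*). The
quadratic part is at least the square of the block mean of |h - f*|. The linear part has nonnegative
expectation, by convexity in case (A) and by independence in case (B), so it is at worst a small
negative deviation. Hence f* wins on at least four fifths of the blocks
(`TournamentSetup.card_blockLossDiff_gt_le`), and all three claims follow
(`TournamentSetup.mem_preliminaryRoundEvent`).

For the uniform estimates (`measure_exists_deviatingBlocks_le`), the largest number of bad blocks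
changes by at most one when one block is replaced, so McDiarmid's inequality concentrates it around
its mean. By Markov the mean is bounded through the expected supremum of the sum of absolute centred
block sums. Symmetrization over blocks, contraction for the absolute value, and a second
symmetrization over single observations reduce that to a variance term, small because blocks are
long, plus a Rademacher average. The latter is controlled because r exceeds the fixed points r_E and
r̄_M.

Probability is computed for a countable subclass only. A member of the class is a pointwise limit
from it; the L₁-L₂ comparison turns this into convergence of norms, and block counts pass to the
limit at the cost of slightly worse levels. -/

namespace MoMTournament

/-! ### Averages over sign vectors and the contraction principle -/

section Signs

variable {J K : Type*}

/-- The average of `g` over all sign vectors indexed by `J`. -/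
noncomputable def signAvg [Fintype J] [DecidableEq J] (g : (J → ℤˣ) → ℝ) : ℝ :=
  (2 ^ Fintype.card J)⁻¹ * ∑ ε, g ε

/-- The real sign attached to a unit of `ℤ`. -/
def sgn (e : ℤˣ) : ℝ := ((e : ℤ) : ℝ)

@[simp] lemma sgn_one : sgn 1 = 1 := by simp [sgn]

@[simp] lemma sgn_neg (e : ℤˣ) : sgn (-e) = -sgn e := by simp [sgn]

@[simp] lemma sgn_mul (e e' : ℤˣ) : sgn (e * e') = sgn e * sgn e' := by simp [sgn]

lemma sgn_eq (e : ℤˣ) : sgn e = 1 ∨ sgn e = -1 := by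
  rcases Int.units_eq_one_or e with rfl | rfl <;> simp

lemma bddAbove_range_of_fintype [Finite K] (f : K → ℝ) : BddAbove (Set.range f) :=
  (Set.finite_range f).bddAbove

lemma le_iSup_fintype [Finite K] (f : K → ℝ) (k : K) : f k ≤ ⨆ k, f k :=
  le_ciSup (bddAbove_range_of_fintype f) k

lemma iSup_mono_fintype [Finite K] [Nonempty K] {f g : K → ℝ} (h : ∀ k, f k ≤ g k) :
    ⨆ k, f k ≤ ⨆ k, g k :=
  ciSup_le fun k => (h k).trans (le_iSup_fintype g k)

lemma iSup_add_le_fintype [Finite K] [Nonempty K] (f g : K → ℝ) :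
    ⨆ k, (f k + g k) ≤ (⨆ k, f k) + ⨆ k, g k :=
  ciSup_le fun k => add_le_add (le_iSup_fintype f k) (le_iSup_fintype g k)

lemma abs_iSup_le_sum [Fintype K] [Nonempty K] (f : K → ℝ) : |⨆ k, f k| ≤ ∑ k, |f k| := by
  obtain ⟨k, hk⟩ := exists_eq_ciSup_of_finite (f := f)
  rw [← hk]
  exact Finset.single_le_sum (f := fun k => |f k|) (fun _ _ => abs_nonneg _) (Finset.mem_univ k)

/-- The two-point case of contraction. If k and l attain the two suprema on the left, then |t k| -
|t l| ≤ |t k - t l|, and the sign of t k - t l decides which of k and l is used in which supremum on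
the right. -/
lemma iSup_abs_sub_le [Finite K] [Nonempty K] (A t : K → ℝ) :
    (⨆ k, (A k + |t k|)) + ⨆ k, (A k - |t k|) ≤ (⨆ k, (A k + t k)) + ⨆ k, (A k - t k) := by
  obtain ⟨k, hk⟩ := exists_eq_ciSup_of_finite (f := fun k => A k + |t k|)
  obtain ⟨l, hl⟩ := exists_eq_ciSup_of_finite (f := fun k => A k - |t k|)
  rw [← hk, ← hl]
  have h1 := le_iSup_fintype (fun k => A k + t k) k
  have h2 := le_iSup_fintype (fun k => A k - t k) l
  have h3 := le_iSup_fintype (fun k => A k + t k) l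
  have h4 := le_iSup_fintype (fun k => A k - t k) k
  have h5 := abs_sub_abs_le_abs_sub (t k) (t l)
  rcases abs_cases (t k - t l) with ⟨h, -⟩ | ⟨h, -⟩ <;> linarith

variable [Fintype J] [DecidableEq J]

lemma signAvg_mono {f g : (J → ℤˣ) → ℝ} (h : ∀ ε, f ε ≤ g ε) : signAvg f ≤ signAvg g :=
  mul_le_mul_of_nonneg_left (Finset.sum_le_sum fun ε _ => h ε) (by positivity)

lemma signAvg_const (c : ℝ) : signAvg (fun _ : J → ℤˣ => c) = c := by
  simp [signAvg]

lemma signAvg_add (f g : (J → ℤˣ) → ℝ) :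
    signAvg (fun ε => f ε + g ε) = signAvg f + signAvg g := by
  simp [signAvg, Finset.sum_add_distrib, mul_add]

lemma signAvg_const_mul (c : ℝ) (f : (J → ℤˣ) → ℝ) :
    signAvg (fun ε => c * f ε) = c * signAvg f := by
  simp only [signAvg, ← Finset.mul_sum]; ring

lemma signAvg_mul_left (τ : J → ℤˣ) (f : (J → ℤˣ) → ℝ) :
    signAvg (fun ε => f (τ * ε)) = signAvg f := by
  unfold signAvg
  congr 1
  exact Fintype.sum_equiv (Equiv.mulLeft τ) _ _ fun _ => rfl

lemma signAvg_neg (f : (J → ℤˣ) → ℝ) : signAvg (fun ε => f (-ε)) = signAvg f := by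
  unfold signAvg
  congr 1
  exact Fintype.sum_equiv (Equiv.neg _) _ _ fun _ => rfl

lemma signAvg_integral {Ω : Type*} [MeasurableSpace Ω] {μ : Measure Ω} {f : (J → ℤˣ) → Ω → ℝ}
    (hf : ∀ ε, Integrable (f ε) μ) :
    signAvg (fun ε => ∫ x, f ε x ∂μ) = ∫ x, signAvg (fun ε => f ε x) ∂μ := by
  simp only [signAvg]
  rw [integral_const_mul, integral_finsetSum _ fun ε _ => hf ε]

/-- Restricting a uniform sign vector along an injection gives a uniform sign vector. -/
lemma signAvg_comp_injective {J' : Type*} [Fintype J'] [DecidableEq J'] {e : J → J'}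
    (he : Function.Injective e) (g : (J → ℤˣ) → ℝ) :
    signAvg (fun ε : J' → ℤˣ => g (ε ∘ e)) = signAvg g := by
  -- The double average is computed in two ways. Averaging over η first absorbs ε by invariance;
  -- averaging over ε first absorbs η, extended by 1 off the range of `e`.
  have h1 : signAvg (fun ε : J' → ℤˣ => signAvg fun η => g (η * ε ∘ e)) = signAvg g := by
    have : ∀ ε : J' → ℤˣ, (signAvg fun η => g (η * ε ∘ e)) = signAvg g := fun ε => by
      simp_rw [mul_comm _ (ε ∘ e)]
      exact signAvg_mul_left (ε ∘ e) g
    simp_rw [this, signAvg_const]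
  have h2 : ∀ η : J → ℤˣ, signAvg (fun ε : J' → ℤˣ => g (η * ε ∘ e)) =
      signAvg (fun ε : J' → ℤˣ => g (ε ∘ e)) := fun η => by
    rw [← signAvg_mul_left (Function.extend e η 1) (fun ε : J' → ℤˣ => g (ε ∘ e))]
    congr 1
    ext ε
    refine congrArg g (funext fun j => ?_)
    change η j * ε (e j) = Function.extend e η 1 (e j) * ε (e j)
    rw [he.extend_apply]
  have h3 := signAvg_const (J := J) (signAvg fun ε : J' → ℤˣ => g (ε ∘ e))
  rw [← h1, ← h3, ← funext h2]
  simp only [signAvg, Finset.mul_sum]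
  rw [Finset.sum_comm]
  refine Finset.sum_congr rfl fun _ _ => Finset.sum_congr rfl fun _ _ => by ring

/-- Contraction one coordinate at a time. Each sign vector is paired with its flip at `i`; the two
sums share the part A from the other coordinates and differ in the sign of the `i`-th term, which is
the situation of `iSup_abs_sub_le`. -/
lemma signAvg_iSup_update_abs_le [Finite K] [Nonempty K] (x : K → J → ℝ) (i : J) :
    signAvg (fun ε => ⨆ k, ∑ j, sgn (ε j) * Function.update (x k) i |x k i| j) ≤
      signAvg (fun ε => ⨆ k, ∑ j, sgn (ε j) * x k j) := by
  set τ : J → ℤˣ := Function.update 1 i (-1) with hτ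
  have key : ∀ (y : K → J → ℝ) (ε : J → ℤˣ) (k : K), ∑ j, sgn ((τ * ε) j) * y k j =
      (∑ j ∈ Finset.univ.erase i, sgn (ε j) * y k j) - sgn (ε i) * y k i := fun y ε k => by
    rw [← Finset.add_sum_erase _ _ (Finset.mem_univ i), add_comm, sub_eq_add_neg]
    congr 1
    · refine Finset.sum_congr rfl fun j hj => ?_
      simp [hτ, Function.update_of_ne (Finset.ne_of_mem_erase hj)]
    · simp [hτ]
  have key' : ∀ (y : K → J → ℝ) (ε : J → ℤˣ) (k : K), ∑ j, sgn (ε j) * y k j =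
      (∑ j ∈ Finset.univ.erase i, sgn (ε j) * y k j) + sgn (ε i) * y k i := fun y ε k => by
    rw [← Finset.add_sum_erase _ _ (Finset.mem_univ i), add_comm]
  have pair : ∀ g : (J → ℤˣ) → ℝ, signAvg g + signAvg g = signAvg (fun ε => g ε + g (τ * ε)) :=
    fun g => by rw [signAvg_add, signAvg_mul_left]
  suffices h : signAvg (fun ε => ⨆ k, ∑ j, sgn (ε j) * Function.update (x k) i |x k i| j) +
      signAvg (fun ε => ⨆ k, ∑ j, sgn (ε j) * Function.update (x k) i |x k i| j) ≤
      signAvg (fun ε => ⨆ k, ∑ j, sgn (ε j) * x k j) +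
      signAvg (fun ε => ⨆ k, ∑ j, sgn (ε j) * x k j) by linarith
  rw [pair, pair]
  refine signAvg_mono fun ε => ?_
  simp only [key (fun k => Function.update (x k) i |x k i|), key x]
  simp only [key' (fun k => Function.update (x k) i |x k i|) ε, key' x ε]
  have hA : ∀ k, ∑ j ∈ Finset.univ.erase i, sgn (ε j) * Function.update (x k) i |x k i| j =
      ∑ j ∈ Finset.univ.erase i, sgn (ε j) * x k j := fun k =>
    Finset.sum_congr rfl fun j hj => by rw [Function.update_of_ne (Finset.ne_of_mem_erase hj)]
  simp only [hA, Function.update_self]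
  have := iSup_abs_sub_le (fun k => ∑ j ∈ Finset.univ.erase i, sgn (ε j) * x k j) (fun k => x k i)
  rcases sgn_eq (ε i) with h | h <;>
    simp only [h, one_mul, neg_mul, sub_neg_eq_add, ← sub_eq_add_neg] <;> linarith

/-- The contraction principle for the absolute value. -/
theorem signAvg_iSup_abs_le [Finite K] [Nonempty K] (x : K → J → ℝ) :
    signAvg (fun ε => ⨆ k, ∑ j, sgn (ε j) * |x k j|) ≤
      signAvg (fun ε => ⨆ k, ∑ j, sgn (ε j) * x k j) := by
  suffices h : ∀ S : Finset J,
      signAvg (fun ε => ⨆ k, ∑ j, sgn (ε j) * (if j ∈ S then |x k j| else x k j)) ≤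
      signAvg (fun ε => ⨆ k, ∑ j, sgn (ε j) * x k j) by simpa using h Finset.univ
  intro S
  induction S using Finset.induction_on with
  | empty => simp
  | insert i S hi ih =>
    refine le_trans (le_of_eq ?_)
      ((signAvg_iSup_update_abs_le (fun k j => if j ∈ S then |x k j| else x k j) i).trans ih)
    congr 1
    ext ε
    congr 1
    ext k
    refine Finset.sum_congr rfl fun j _ => ?_
    rcases eq_or_ne j i with rfl | hj
    · simp [hi]
    · simp [hj]

/-- Passing to a larger index set increases the expected supremum of the absolute value. -/
lemma signAvg_iSup_le_of_injective [Finite K] [Nonempty K] {J' : Type*} [Fintype J']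
    [DecidableEq J'] {e : J → J'} (he : Function.Injective e) (x : K → J' → ℝ) :
    signAvg (fun ε => ⨆ k, ∑ j, sgn (ε j) * x k (e j)) ≤
      signAvg (fun ε : J' → ℤˣ => ⨆ k, |∑ j, sgn (ε j) * x k j|) := by
  classical
  rw [← signAvg_comp_injective he]
  -- Flipping the signs off the range of `e` and adding the two sums cancels the extra coordinates
  -- and doubles the wanted ones.
  set τ : J' → ℤˣ := fun j => if j ∈ Set.range e then 1 else -1 with hτ
  suffices h : signAvg (fun ε : J' → ℤˣ => 2 * ⨆ k, ∑ j, sgn ((ε ∘ e) j) * x k (e j)) ≤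
      signAvg (fun ε : J' → ℤˣ => (⨆ k, |∑ j, sgn (ε j) * x k j|) +
        ⨆ k, |∑ j, sgn ((τ * ε) j) * x k j|) by
    rw [signAvg_const_mul, signAvg_add,
      signAvg_mul_left τ (fun ε : J' → ℤˣ => ⨆ k, |∑ j, sgn (ε j) * x k j|)] at h
    linarith
  refine signAvg_mono fun ε => ?_
  obtain ⟨k, hk⟩ := exists_eq_ciSup_of_finite (f := fun k => ∑ j, sgn ((ε ∘ e) j) * x k (e j))
  rw [← hk]
  have hsum : 2 * ∑ j, sgn ((ε ∘ e) j) * x k (e j) =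
      (∑ j, sgn (ε j) * x k j) + ∑ j, sgn ((τ * ε) j) * x k j := by
    rw [← Finset.sum_add_distrib]
    have h0 : ∑ j, sgn ((ε ∘ e) j) * x k (e j) =
        ∑ j ∈ Finset.univ.map ⟨e, he⟩, sgn (ε j) * x k j := by simp
    rw [h0, Finset.mul_sum]
    rw [← Finset.sum_subset (Finset.subset_univ (Finset.univ.map ⟨e, he⟩))]
    · refine Finset.sum_congr rfl fun j hj => ?_
      have : j ∈ Set.range e := by simpa using hj
      have h1 : τ j = 1 := if_pos this
      simp [h1]; ring
    · intro j _ hj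
      have : j ∉ Set.range e := by simpa using hj
      have h1 : τ j = -1 := if_neg this
      simp [h1]
  rw [hsum]
  exact add_le_add ((le_abs_self _).trans (le_iSup_fintype (fun k => |∑ j, sgn (ε j) * x k j|) k))
    ((le_abs_self _).trans (le_iSup_fintype (fun k => |∑ j, sgn ((τ * ε) j) * x k j|) k))

end Signs

/-! ### Symmetrization of empirical processes -/

section Symmetrization

variable {J K 𝓦 Ω : Type*} [MeasurableSpace 𝓦] [MeasurableSpace Ω]

lemma integrable_iSup_fintype [Finite K] [Nonempty K] {μ : Measure Ω} {f : K → Ω → ℝ}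
    (hf : ∀ k, Integrable (f k) μ) : Integrable (fun x => ⨆ k, f k x) μ := by
  cases nonempty_fintype K
  refine (integrable_finsetSum Finset.univ fun k _ => (hf k).abs).mono'
    (AEMeasurable.iSup fun k => (hf k).aemeasurable).aestronglyMeasurable
    (Filter.Eventually.of_forall fun x => ?_)
  simpa using abs_iSup_le_sum fun k => f k x

lemma integral_comp_of_measurePreserving {Ω' : Type*} [MeasurableSpace Ω'] {μ : Measure Ω}
    {μ' : Measure Ω'} {T : Ω → Ω'} (hT : MeasurePreserving T μ μ') {f : Ω' → ℝ}
    (hf : AEStronglyMeasurable f μ') : ∫ x, f (T x) ∂μ = ∫ y, f y ∂μ' := by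
  rw [← hT.map_eq] at hf ⊢
  exact (integral_map hT.aemeasurable hf).symm

variable [Fintype J] {ν : Measure 𝓦} [IsProbabilityMeasure ν]

lemma integrable_pi_eval {g : 𝓦 → ℝ} (hg : Integrable g ν) (j : J) :
    Integrable (fun w : J → 𝓦 => g (w j)) (Measure.pi fun _ => ν) :=
  (measurePreserving_eval (fun _ : J => ν) j).integrable_comp_of_integrable hg

lemma integral_pi_eval {g : 𝓦 → ℝ} (hg : Integrable g ν) (j : J) :
    ∫ w : J → 𝓦, g (w j) ∂(Measure.pi fun _ => ν) = ∫ x, g x ∂ν :=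
  integral_comp_of_measurePreserving (measurePreserving_eval (fun _ : J => ν) j)
    hg.aestronglyMeasurable

lemma integrable_sum_pi {h : K → 𝓦 → ℝ} (hh : ∀ k, Integrable (h k) ν) (a : J → ℝ) (k : K) :
    Integrable (fun w : J → 𝓦 => ∑ j, a j * h k (w j)) (Measure.pi fun _ => ν) :=
  integrable_finsetSum _ fun j _ => (integrable_pi_eval (hh k) j).const_mul _

lemma integrable_iSup_sum_pi [Finite K] [Nonempty K] {h : K → 𝓦 → ℝ}
    (hh : ∀ k, Integrable (h k) ν) (a : J → ℝ) :
    Integrable (fun w : J → 𝓦 => ⨆ k, ∑ j, a j * h k (w j)) (Measure.pi fun _ => ν) :=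
  integrable_iSup_fintype fun k => integrable_sum_pi hh a k

/-- The integral of `sup_k ∑ⱼ aⱼ h_k(wⱼ)` for an independent sample `w` with law `ν`. -/
noncomputable def weightedSup (ν : Measure 𝓦) (h : K → 𝓦 → ℝ) (a : J → ℝ) : ℝ :=
  ∫ w : J → 𝓦, ⨆ k, ∑ j, a j * h k (w j) ∂(Measure.pi fun _ => ν)

/-- The Rademacher average of the family `h` for an independent sample indexed by `J`. -/
noncomputable def rademacherAvg (J : Type*) [Fintype J] [DecidableEq J] (ν : Measure 𝓦)
    (h : K → 𝓦 → ℝ) : ℝ :=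
  signAvg fun ε : J → ℤˣ => weightedSup ν h fun j => sgn (ε j)

/-- The integral of `sup_k ∑ⱼ aⱼ (h_k(wⱼ) - h_k(wⱼ'))` for two independent samples. -/
noncomputable def ghostSup (ν : Measure 𝓦) (h : K → 𝓦 → ℝ) (a : J → ℝ) : ℝ :=
  ∫ z : J → 𝓦 × 𝓦, ⨆ k, ∑ j, a j * (h k (z j).1 - h k (z j).2)
    ∂(Measure.pi fun _ => ν.prod ν)

lemma integrable_sub_prod {g : 𝓦 → ℝ} (hg : Integrable g ν) :
    Integrable (fun z : 𝓦 × 𝓦 => g z.1 - g z.2) (ν.prod ν) :=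
  (hg.comp_fst ν).sub (hg.comp_snd ν)

/-- Exchanging the two copies at the coordinates with negative sign preserves the product law and
negates exactly those differences. -/
lemma ghostSup_mul_sgn [Finite K] [Nonempty K] {h : K → 𝓦 → ℝ} (hh : ∀ k, Integrable (h k) ν)
    (a : J → ℝ) (ε : J → ℤˣ) :
    ghostSup ν h (fun j => a j * sgn (ε j)) = ghostSup ν h a := by
  set T : (J → 𝓦 × 𝓦) → (J → 𝓦 × 𝓦) := fun z j => if ε j = 1 then z j else (z j).swap with hT
  have hTm : MeasurePreserving T (Measure.pi fun _ => ν.prod ν) (Measure.pi fun _ => ν.prod ν) := by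
    refine measurePreserving_pi (fun _ : J => ν.prod ν) (fun _ : J => ν.prod ν)
      (f := fun j x => if ε j = 1 then x else x.swap) fun j => ?_
    by_cases hj : ε j = 1
    · simp only [hj, if_true]
      exact MeasurePreserving.id _
    · simpa [hj] using Measure.measurePreserving_swap
  unfold ghostSup
  rw [← integral_comp_of_measurePreserving hTm
    (integrable_iSup_sum_pi (fun k => integrable_sub_prod (hh k)) a).aestronglyMeasurable]
  congr 1
  ext z
  congr 1
  ext k
  refine Finset.sum_congr rfl fun j _ => ?_
  rcases Int.units_eq_one_or (ε j) with hj | hj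
  · simp [hT, hj]
  · simp only [hT, hj, sgn_neg, sgn_one]
    rw [if_neg (by decide), Prod.fst_swap, Prod.snd_swap]
    ring

/-- Jensen: for a fixed sample, the centred sum is the integral of the difference over the ghost
sample, and the supremum of integrals is at most the integral of the supremum. -/
lemma weightedSup_sub_integral_le [Finite K] [Nonempty K] {h : K → 𝓦 → ℝ}
    (hh : ∀ k, Integrable (h k) ν) (a : J → ℝ) :
    weightedSup ν (fun k w => h k w - ∫ x, h k x ∂ν) a ≤ ghostSup ν h a := by
  unfold weightedSup ghostSup
  have hmp := (measurePreserving_arrowProdEquivProdArrow 𝓦 𝓦 J (fun _ => ν) (fun _ => ν)).symm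
  have hint := integrable_iSup_sum_pi (J := J) (fun k => integrable_sub_prod (hh k)) a
  have hint' : Integrable (fun z : (J → 𝓦) × (J → 𝓦) =>
      ⨆ k, ∑ j, a j * (h k (z.1 j) - h k (z.2 j)))
      ((Measure.pi fun _ => ν).prod (Measure.pi fun _ => ν)) :=
    hmp.integrable_comp_of_integrable hint
  rw [← integral_comp_of_measurePreserving hmp hint.aestronglyMeasurable]
  refine le_trans ?_ (integral_prod _ hint').ge
  refine integral_mono (integrable_iSup_sum_pi (fun k => (hh k).sub (integrable_const _)) a)
    hint'.integral_prod_left fun w => ?_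
  have hk' : ∀ k j, Integrable (fun w' : J → 𝓦 => a j * (h k (w j) - h k (w' j)))
      (Measure.pi fun _ => ν) := fun k j =>
    ((integrable_const _).sub (integrable_pi_eval (hh k) j)).const_mul _
  refine ciSup_le fun k => ?_
  have hk := hk' k
  have : ∑ j, a j * (h k (w j) - ∫ x, h k x ∂ν) =
      ∫ w' : J → 𝓦, ∑ j, a j * (h k (w j) - h k (w' j)) ∂(Measure.pi fun _ => ν) := by
    rw [integral_finsetSum _ fun j _ => hk j]
    refine Finset.sum_congr rfl fun j _ => ?_
    rw [integral_const_mul, integral_sub (integrable_const _) (integrable_pi_eval (hh k) j),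
      integral_pi_eval (hh k) j]
    simp
  rw [this]
  refine integral_mono (integrable_finsetSum _ fun j _ => hk j)
    (integrable_iSup_fintype fun k => integrable_finsetSum _ fun j _ => hk' k j) fun w' => ?_
  exact le_iSup_fintype (fun k => ∑ j, a j * (h k (w j) - h k (w' j))) k

lemma ghostSup_le [Finite K] [Nonempty K] {h : K → 𝓦 → ℝ} (hh : ∀ k, Integrable (h k) ν)
    (a : J → ℝ) : ghostSup ν h a ≤ weightedSup ν h a + weightedSup ν h (fun j => -a j) := by
  have h1 : MeasurePreserving (fun (z : J → 𝓦 × 𝓦) j => (z j).1)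
      (Measure.pi fun _ => ν.prod ν) (Measure.pi fun _ => ν) :=
    measurePreserving_pi (fun _ : J => ν.prod ν) (fun _ : J => ν) (f := fun _ => Prod.fst)
      fun _ => measurePreserving_fst
  have h2 : MeasurePreserving (fun (z : J → 𝓦 × 𝓦) j => (z j).2)
      (Measure.pi fun _ => ν.prod ν) (Measure.pi fun _ => ν) :=
    measurePreserving_pi (fun _ : J => ν.prod ν) (fun _ : J => ν) (f := fun _ => Prod.snd)
      fun _ => measurePreserving_snd
  have i1 := integrable_iSup_sum_pi (J := J) hh a
  have i2 := integrable_iSup_sum_pi (J := J) hh (fun j => -a j)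
  have i1' : Integrable (fun z : J → 𝓦 × 𝓦 => ⨆ k, ∑ j, a j * h k (z j).1)
      (Measure.pi fun _ => ν.prod ν) := h1.integrable_comp_of_integrable i1
  have i2' : Integrable (fun z : J → 𝓦 × 𝓦 => ⨆ k, ∑ j, -a j * h k (z j).2)
      (Measure.pi fun _ => ν.prod ν) := h2.integrable_comp_of_integrable i2
  unfold weightedSup ghostSup
  rw [← integral_comp_of_measurePreserving h1 i1.aestronglyMeasurable,
    ← integral_comp_of_measurePreserving h2 i2.aestronglyMeasurable,
    ← integral_add i1' i2']
  refine integral_mono (integrable_iSup_sum_pi (fun k => integrable_sub_prod (hh k)) a)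
    (i1'.add i2') fun z => ?_
  refine le_trans (le_of_eq ?_) (iSup_add_le_fintype _ _)
  congr 1
  ext k
  rw [← Finset.sum_add_distrib]
  exact Finset.sum_congr rfl fun j _ => by ring

lemma measurePreserving_comp_injective {J' : Type*} [Fintype J'] {e : J → J'}
    (he : Function.Injective e) : MeasurePreserving (fun (w : J' → 𝓦) j => w (e j))
      (Measure.pi fun _ => ν) (Measure.pi fun _ => ν) := by
  refine ⟨by fun_prop, ?_⟩
  have h1 : iIndepFun (fun (i : J') (w : J' → 𝓦) => w i) (Measure.pi fun _ => ν) :=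
    iIndepFun_pi (X := fun _ => id) fun _ => aemeasurable_id
  have h2 := (iIndepFun_iff_map_fun_eq_pi_map (fun j => (measurable_pi_apply (e
    j)).aemeasurable)).1 (h1.precomp he)
  rw [h2]
  congr 1
  ext1 j
  exact (measurePreserving_eval (fun _ : J' => ν) (e j)).map_eq

variable [DecidableEq J]

/-- Symmetrization: a signed centred empirical process is dominated by twice the Rademacher
average. -/
theorem weightedSup_sub_integral_le_rademacherAvg [Finite K] [Nonempty K] {h : K → 𝓦 → ℝ}
    (hh : ∀ k, Integrable (h k) ν) (a : J → ℤˣ) :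
    weightedSup ν (fun k w => h k w - ∫ x, h k x ∂ν) (fun j => sgn (a j)) ≤
      2 * rademacherAvg J ν h := by
  refine (weightedSup_sub_integral_le hh _).trans ?_
  -- Multiplying the signs ε by ε * a gives a, since ε² = 1. So the ghost process has the same value
  -- for all sign vectors and equals its average over them.
  have h1 : ∀ ε : J → ℤˣ, ghostSup ν h (fun j => sgn (a j)) =
      ghostSup ν h fun j => sgn (ε j) := fun ε => by
    rw [← ghostSup_mul_sgn hh (fun j => sgn (ε j)) (ε * a)]
    congr 1
    ext j
    rcases sgn_eq (ε j) with h | h <;> simp [h]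
  rw [← signAvg_const (J := J) (ghostSup ν h fun j => sgn (a j)), funext h1]
  refine (signAvg_mono fun ε => ghostSup_le hh _).trans (le_of_eq ?_)
  rw [signAvg_add, rademacherAvg, two_mul]
  congr 1
  rw [← signAvg_neg]
  simp

lemma rademacherAvg_eq_integral [Finite K] [Nonempty K] {h : K → 𝓦 → ℝ}
    (hh : ∀ k, Integrable (h k) ν) :
    rademacherAvg J ν h = ∫ w : J → 𝓦, signAvg (fun ε => ⨆ k, ∑ j, sgn (ε j) * h k (w j))
      ∂(Measure.pi fun _ => ν) :=
  signAvg_integral fun _ => integrable_iSup_sum_pi hh _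

lemma integrable_signAvg {μ : Measure Ω} {f : (J → ℤˣ) → Ω → ℝ}
    (hf : ∀ ε, Integrable (f ε) μ) : Integrable (fun x => signAvg fun ε => f ε x) μ :=
  (integrable_finsetSum _ fun ε _ => hf ε).const_mul _

/-- Contraction for Rademacher averages. -/
theorem rademacherAvg_abs_le [Finite K] [Nonempty K] {h : K → 𝓦 → ℝ}
    (hh : ∀ k, Integrable (h k) ν) :
    rademacherAvg J ν (fun k w => |h k w|) ≤ rademacherAvg J ν h := by
  rw [rademacherAvg_eq_integral hh, rademacherAvg_eq_integral fun k => (hh k).abs]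
  exact integral_mono (integrable_signAvg fun _ => integrable_iSup_sum_pi (fun k => (hh k).abs) _)
    (integrable_signAvg fun _ => integrable_iSup_sum_pi hh _)
    fun w => signAvg_iSup_abs_le fun k j => h k (w j)

/-- A Rademacher average over a smaller sample is dominated by the two-sided average over a
larger one. -/
lemma rademacherAvg_le_of_injective [Finite K] [Nonempty K] {J' : Type*} [Fintype J']
    [DecidableEq J'] {e : J → J'} (he : Function.Injective e) {h : K → 𝓦 → ℝ}
    (hh : ∀ k, Integrable (h k) ν) :
    rademacherAvg J ν h ≤ signAvg fun ε : J' → ℤˣ =>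
      ∫ w : J' → 𝓦, ⨆ k, |∑ j, sgn (ε j) * h k (w j)| ∂(Measure.pi fun _ => ν) := by
  have hmp := measurePreserving_comp_injective (𝓦 := 𝓦) (ν := ν) he
  have hi := integrable_signAvg fun ε : J → ℤˣ =>
    integrable_iSup_sum_pi (J := J) hh (fun j => sgn (ε j))
  have hi' : ∀ ε : J' → ℤˣ, Integrable (fun w : J' → 𝓦 => ⨆ k, |∑ j, sgn (ε j) * h k (w j)|)
      (Measure.pi fun _ => ν) := fun ε =>
    integrable_iSup_fintype fun k => (integrable_sum_pi hh (fun j => sgn (ε j)) k).abs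
  rw [rademacherAvg_eq_integral hh, signAvg_integral hi',
    ← integral_comp_of_measurePreserving hmp hi.aestronglyMeasurable]
  exact integral_mono (hmp.integrable_comp_of_integrable hi) (integrable_signAvg hi')
    fun w => signAvg_iSup_le_of_injective he fun k j => h k (w j)

end Symmetrization

/-! ### McDiarmid's inequality -/

section BoundedDifferences

variable {𝓦 : Type*} [MeasurableSpace 𝓦] {ν : Measure 𝓦} [IsProbabilityMeasure ν]

lemma measurePreserving_cons (n : ℕ) :
    MeasurePreserving (fun p : 𝓦 × (Fin n → 𝓦) => (Fin.cons p.1 p.2 : Fin (n + 1) → 𝓦))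
      (ν.prod (Measure.pi fun _ => ν)) (Measure.pi fun _ => ν) := by
  have := (measurePreserving_piFinSuccAbove (fun _ : Fin (n + 1) => ν) 0).symm
  convert this using 1
  ext p : 1
  simp [MeasurableEquiv.piFinSuccAbove]
  rfl

/-- Hoeffding's lemma: the values of `g` lie in an interval of length one starting at its infimum,
so the variance proxy is 1/4. -/
lemma integral_exp_sub_le_of_oscillation_le_one {g : 𝓦 → ℝ} (hg : Measurable g)
    (hd : ∀ w w', |g w - g w'| ≤ 1) (t : ℝ) :
    ∫ w, Real.exp (t * (g w - ∫ x, g x ∂ν)) ∂ν ≤ Real.exp (t ^ 2 / 8) := by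
  obtain ⟨w₀⟩ : Nonempty 𝓦 := ν.nonempty_of_neZero
  have hbdd : BddBelow (Set.range g) := ⟨g w₀ - 1, by
    rintro _ ⟨w, rfl⟩
    linarith [(abs_le.1 (hd w₀ w)).2]⟩
  have : Nonempty 𝓦 := ⟨w₀⟩
  have h1 := hasSubgaussianMGF_of_mem_Icc (a := ⨅ w, g w) (b := (⨅ w, g w) + 1) (μ := ν)
    hg.aemeasurable (Filter.Eventually.of_forall fun w => ⟨ciInf_le hbdd w, by
      have : g w - 1 ≤ ⨅ w, g w := le_ciInf fun w' => by linarith [(abs_le.1 (hd w w')).2]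
      linarith⟩)
  refine (h1.mgf_le t).trans (le_of_eq ?_)
  congr 1
  simp
  ring

/-- The exponential moment form of McDiarmid's inequality, with all differences bounded by `1`. -/
theorem integral_exp_sub_le_of_bounded_differences {n : ℕ} {f : (Fin n → 𝓦) → ℝ}
    (hf : Measurable f) {C : ℝ} (hC : ∀ x, |f x| ≤ C)
    (hd : ∀ x i w, |f (Function.update x i w) - f x| ≤ 1) (t : ℝ) :
    ∫ x, Real.exp (t * (f x - ∫ y, f y ∂(Measure.pi fun _ => ν))) ∂(Measure.pi fun _ => ν) ≤
      Real.exp (n * t ^ 2 / 8) := by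
  induction n with
  | zero =>
    have : ∀ x, f x = f default := fun x => congrArg f (Subsingleton.elim _ _)
    simp [this]
  | succ n ih =>
    set F : 𝓦 × (Fin n → 𝓦) → ℝ := fun p => f (Fin.cons p.1 p.2) with hF
    have hT := measurePreserving_cons (ν := ν) n
    have hFm : Measurable F := hf.comp hT.measurable
    have hFC : ∀ p, |F p| ≤ C := fun p => hC _
    have hFi : Integrable F (ν.prod (Measure.pi fun _ => ν)) :=
      Integrable.of_bound hFm.aestronglyMeasurable C (Filter.Eventually.of_forall hFC)
    have hFwm : ∀ w, Measurable fun y => F (w, y) := fun w => hFm.comp measurable_prodMk_left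
    have hFw : ∀ w, Integrable (fun y => F (w, y)) (Measure.pi fun _ => ν) := fun w =>
      Integrable.of_bound (hFwm w).aestronglyMeasurable C
        (Filter.Eventually.of_forall fun y => hFC (w, y))
    set g : 𝓦 → ℝ := fun w => ∫ y, F (w, y) ∂(Measure.pi fun _ => ν) with hg
    have hgm : Measurable g :=
      (hFm.stronglyMeasurable.integral_prod_right (ν := Measure.pi fun _ : Fin n => ν)).measurable
    set M := ∫ y, f y ∂(Measure.pi fun _ => ν) with hM
    have hMg : M = ∫ w, g w ∂ν := by
      rw [hM, ← integral_comp_of_measurePreserving hT hf.aestronglyMeasurable]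
      exact integral_prod _ hFi
    have hgC : ∀ w, |g w| ≤ C := fun w => by
      have := norm_integral_le_of_norm_le_const (μ := Measure.pi fun _ : Fin n => ν)
        (f := fun y => F (w, y)) (C := C) (Filter.Eventually.of_forall fun y => hFC (w, y))
      simpa using this
    have hgd : ∀ w w', |g w - g w'| ≤ 1 := fun w w' => by
      rw [hg, ← integral_sub (hFw w) (hFw w')]
      have := norm_integral_le_of_norm_le_const (μ := Measure.pi fun _ : Fin n => ν)
        (f := fun y => F (w, y) - F (w', y)) (C := 1) (Filter.Eventually.of_forall fun y => by
          have := hd (Fin.cons w' y) 0 w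
          rwa [Fin.update_cons_zero] at this)
      simpa using this
    have hexp_m : Measurable fun p => Real.exp (t * (F p - M)) :=
      Real.measurable_exp.comp ((hFm.sub_const M).const_mul t)
    have hexp_le : ∀ x : ℝ, |x| ≤ C → Real.exp (t * (x - M)) ≤ Real.exp (|t| * (C + |M|)) :=
      fun x hx => Real.exp_le_exp.2 <| (le_abs_self _).trans <| by
        rw [abs_mul]
        exact mul_le_mul_of_nonneg_left ((abs_sub _ _).trans (by linarith)) (abs_nonneg t)
    have hexp_i : Integrable (fun p => Real.exp (t * (F p - M)))
        (ν.prod (Measure.pi fun _ => ν)) :=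
      Integrable.of_bound hexp_m.aestronglyMeasurable (Real.exp (|t| * (C + |M|)))
        (Filter.Eventually.of_forall fun p => by
          rw [Real.norm_eq_abs, abs_of_pos (Real.exp_pos _)]
          exact hexp_le _ (hFC p))
    have hexp_g : Integrable (fun w => Real.exp (t * (g w - M))) ν :=
      Integrable.of_bound
        (Real.measurable_exp.comp ((hgm.sub_const M).const_mul t)).aestronglyMeasurable
        (Real.exp (|t| * (C + |M|)))
        (Filter.Eventually.of_forall fun w => by
          rw [Real.norm_eq_abs, abs_of_pos (Real.exp_pos _)]
          exact hexp_le _ (hgC w))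
    have hfm : Measurable fun x => Real.exp (t * (f x - M)) :=
      Real.measurable_exp.comp ((hf.sub_const M).const_mul t)
    rw [← integral_comp_of_measurePreserving hT hfm.aestronglyMeasurable]
    refine (integral_prod _ hexp_i).trans_le ?_
    -- With the first coordinate fixed, F - M splits into F - g, handled by the induction
    -- hypothesis, and g - M, a function of one variable handled afterwards by Hoeffding's lemma.
    have hinner : ∀ w, ∫ y, Real.exp (t * (F (w, y) - M)) ∂(Measure.pi fun _ => ν) ≤
        Real.exp (t * (g w - M)) * Real.exp (n * t ^ 2 / 8) := fun w => by
      have h1 : ∀ y, Real.exp (t * (F (w, y) - M)) =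
          Real.exp (t * (g w - M)) * Real.exp (t * (F (w, y) - g w)) := fun y => by
        rw [← Real.exp_add]; congr 1; ring
      simp_rw [h1]
      rw [integral_const_mul]
      refine mul_le_mul_of_nonneg_left ?_ (Real.exp_nonneg _)
      refine ih (hFwm w) (fun y => hFC (w, y)) fun y i v => ?_
      have := hd (Fin.cons w y) i.succ v
      rwa [← Fin.cons_update] at this
    refine (integral_mono hexp_i.integral_prod_left (hexp_g.mul_const _) hinner).trans ?_
    rw [integral_mul_const, hMg]
    refine (mul_le_mul_of_nonneg_right (integral_exp_sub_le_of_oscillation_le_one hgm hgd t)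
      (Real.exp_nonneg _)).trans (le_of_eq ?_)
    rw [← Real.exp_add]
    congr 1
    push_cast
    ring

/-- **McDiarmid's inequality**, with all differences bounded by `1`. -/
theorem measure_ge_le_of_bounded_differences {n : ℕ} (hn : 0 < n) {f : (Fin n → 𝓦) → ℝ}
    (hf : Measurable f) {C : ℝ} (hC : ∀ x, |f x| ≤ C)
    (hd : ∀ x i w, |f (Function.update x i w) - f x| ≤ 1) {s : ℝ} (hs : 0 ≤ s) :
    (Measure.pi fun _ => ν).real {x | (∫ y, f y ∂(Measure.pi fun _ => ν)) + s ≤ f x} ≤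
      Real.exp (-(2 * s ^ 2 / n)) := by
  set M := ∫ y, f y ∂(Measure.pi fun _ => ν) with hM
  have hn' : (0 : ℝ) < n := by exact_mod_cast hn
  have hi : Integrable (fun x => Real.exp (4 * s / n * (f x - M))) (Measure.pi fun _ => ν) := by
    refine Integrable.of_bound (Real.measurable_exp.comp
      ((hf.sub_const M).const_mul _)).aestronglyMeasurable (Real.exp (4 * s / n * (C + |M|)))
      (Filter.Eventually.of_forall fun x => ?_)
    rw [Real.norm_eq_abs, abs_of_pos (Real.exp_pos _)]
    refine Real.exp_le_exp.2 (mul_le_mul_of_nonneg_left ?_ (by positivity))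
    linarith [le_abs_self (f x), neg_abs_le M, hC x]
  -- Chernoff's bound; t = 4s/n minimizes -ts + nt²/8, with value -2s²/n.
  have h1 := measure_ge_le_exp_mul_mgf (μ := Measure.pi fun _ : Fin n => ν)
    (X := fun x => f x - M) s (t := 4 * s / n) (by positivity) hi
  have h2 := integral_exp_sub_le_of_bounded_differences (ν := ν) hf hC hd (4 * s / n)
  have hset : {x | M + s ≤ f x} = {x | s ≤ f x - M} := by
    ext x
    change M + s ≤ f x ↔ s ≤ f x - M
    constructor <;> intro h <;> linarith
  rw [hset]
  refine h1.trans ((mul_le_mul_of_nonneg_left h2 (Real.exp_nonneg _)).trans (le_of_eq ?_))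
  rw [← Real.exp_add]
  congr 1
  field_simp
  ring

end BoundedDifferences

/-! ### Uniform deviation of block means -/

section Blocks

variable {𝓩 : Type*} [MeasurableSpace 𝓩] {P : Measure 𝓩}

lemma measurePreserving_curry [IsProbabilityMeasure P] {I J : Type*} [Fintype I] [Fintype J] :
    MeasurePreserving (fun (w : I × J → 𝓩) i j => w (i, j))
      (Measure.pi fun _ => P) (Measure.pi fun _ => Measure.pi fun _ => P) := by
  have hu : MeasurePreserving (fun (w : I → J → 𝓩) (p : I × J) => w p.1 p.2)
      (Measure.pi fun _ => Measure.pi fun _ => P) (Measure.pi fun _ => P) := by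
    have hm : Measurable (fun (w : I → J → 𝓩) (p : I × J) => w p.1 p.2) := by fun_prop
    refine ⟨hm, (Measure.pi_eq fun s hs => ?_).symm⟩
    rw [Measure.map_apply hm (MeasurableSet.univ_pi hs)]
    have : (fun (w : I → J → 𝓩) (p : I × J) => w p.1 p.2) ⁻¹' Set.univ.pi s =
        Set.univ.pi fun i => Set.univ.pi fun j => s (i, j) := by
      ext w; simp [Set.mem_pi]
    rw [this, Measure.pi_pi, Fintype.prod_prod_type]
    simp_rw [Measure.pi_pi]
  have hm : Measurable (fun (w : I × J → 𝓩) i j => w (i, j)) := by fun_prop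
  refine ⟨hm, ?_⟩
  rw [← hu.map_eq, Measure.map_map hm hu.measurable]
  exact Measure.map_id

variable {K : Type*}

/-- The centred sum of `ψ` over a sample `B`. -/
noncomputable def centredSum (P : Measure 𝓩) {m : ℕ} (ψ : 𝓩 → ℝ) (B : Fin m → 𝓩) : ℝ :=
  ∑ i, (ψ (B i) - ∫ z, ψ z ∂P)

lemma measurable_centredSum {m : ℕ} {ψ : 𝓩 → ℝ} (hψ : Measurable ψ) :
    Measurable (centredSum P ψ : (Fin m → 𝓩) → ℝ) := by
  unfold centredSum; fun_prop

lemma integrable_centredSum [IsProbabilityMeasure P] {m : ℕ} {ψ : 𝓩 → ℝ} (hψ : Integrable ψ P) :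
    Integrable (centredSum P ψ : (Fin m → 𝓩) → ℝ) (Measure.pi fun _ => P) :=
  integrable_finsetSum _ fun i _ =>
    integrable_pi_eval (hψ.sub (integrable_const (∫ z, ψ z ∂P))) i

lemma sq_integral_abs_le {Ω : Type*} [MeasurableSpace Ω] {μ : Measure Ω} [IsProbabilityMeasure μ]
    {f : Ω → ℝ} (hf : MemLp f 2 μ) : (∫ x, |f x| ∂μ) ^ 2 ≤ ∫ x, f x ^ 2 ∂μ := by
  have h := variance_eq_sub hf.abs
  have h0 := variance_nonneg (|f|) μ
  rw [h] at h0
  simpa using h0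

/-- The L₁ norm is at most the L₂ norm, and variances of independent summands add. The growth √m,
against the threshold mγ used later, is what long blocks gain. -/
lemma integral_abs_centredSum_le [IsProbabilityMeasure P]
    {m : ℕ} {ψ : 𝓩 → ℝ} (hψ : MemLp ψ 2 P) {s : ℝ} (hs : 0 ≤ s)
    (hψs : ∫ z, ψ z ^ 2 ∂P ≤ s ^ 2) :
    ∫ B : Fin m → 𝓩, |centredSum P ψ B| ∂(Measure.pi fun _ => P) ≤ s * √m := by
  have hi : Integrable ψ P := hψ.integrable one_le_two
  have hX1 : Integrable (fun z => ψ z - ∫ z, ψ z ∂P) P := hi.sub (integrable_const _)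
  have hX : MemLp (fun z => ψ z - ∫ z, ψ z ∂P) 2 P := hψ.sub (memLp_const _)
  have hL : MemLp (centredSum P ψ : (Fin m → 𝓩) → ℝ) 2 (Measure.pi fun _ => P) :=
    memLp_finsetSum _ fun i _ => hX.comp_measurePreserving
      (measurePreserving_eval (fun _ : Fin m => P) i)
  have h0 : ∫ B : Fin m → 𝓩, centredSum P ψ B ∂(Measure.pi fun _ => P) = 0 := by
    unfold centredSum
    rw [integral_finsetSum _ fun i _ => integrable_pi_eval hX1 i]
    refine Finset.sum_eq_zero fun i _ => ?_
    rw [integral_pi_eval hX1 i]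
    simp [integral_sub hi (integrable_const _)]
  have hv : ∫ B : Fin m → 𝓩, centredSum P ψ B ^ 2 ∂(Measure.pi fun _ => P) ≤ m * s ^ 2 := by
    rw [← variance_of_integral_eq_zero hL.aemeasurable h0]
    have h1 := variance_sum_pi (μ := fun _ : Fin m => P)
      (X := fun _ => fun z => ψ z - ∫ z, ψ z ∂P) fun _ => hX
    have h2 : (∑ i : Fin m, fun B : Fin m → 𝓩 => ψ (B i) - ∫ z, ψ z ∂P) = centredSum P ψ := by
      ext B; simp [centredSum]
    rw [h2] at h1
    rw [h1, Finset.sum_const, Finset.card_univ, Fintype.card_fin, nsmul_eq_mul]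
    refine mul_le_mul_of_nonneg_left ?_ (by positivity)
    rw [variance_sub_const hψ.aestronglyMeasurable]
    exact (variance_le_expectation_sq hψ.aestronglyMeasurable).trans hψs
  refine le_of_sq_le_sq ?_ (by positivity)
  rw [mul_pow, Real.sq_sqrt (by positivity), mul_comm]
  exact (sq_integral_abs_le hL).trans hv

/-- The expected supremum of the sums of absolute centred block sums. -/
lemma integral_iSup_sum_abs_centredSum_le [IsProbabilityMeasure P]
    [Finite K] [Nonempty K] {n m : ℕ} {ψ : K → 𝓩 → ℝ}
    (hψ : ∀ k, MemLp (ψ k) 2 P) {s : ℝ} (hs : 0 ≤ s) (hψs : ∀ k, ∫ z, ψ k z ^ 2 ∂P ≤ s ^ 2) :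
    ∫ B : Fin n → Fin m → 𝓩, ⨆ k, ∑ j, |centredSum P (ψ k) (B j)|
      ∂(Measure.pi fun _ => Measure.pi fun _ => P) ≤
      n * (s * √m) + 4 * rademacherAvg (Fin n × Fin m) P ψ := by
  set Q : Measure (Fin m → 𝓩) := Measure.pi fun _ => P with hQ
  have hi : ∀ k, Integrable (ψ k) P := fun k => (hψ k).integrable one_le_two
  have hZ : ∀ k, Integrable (centredSum P (ψ k)) Q := fun k => integrable_centredSum (hi k)
  have hA : ∀ k, Integrable (fun B => |centredSum P (ψ k) B|) Q := fun k => (hZ k).abs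
  have h1 := weightedSup_sub_integral_le_rademacherAvg (J := Fin n) hA 1
  have h2 := rademacherAvg_abs_le (J := Fin n) hZ
  -- For fixed block signs, the signed sum of centred block sums is a centred process over single
  -- observations whose signs are constant on blocks. Symmetrization holds for arbitrary fixed
  -- signs, so it applies again; the two rounds make the factor 4.
  have h3 : rademacherAvg (Fin n) Q (fun k => centredSum P (ψ k)) ≤
      2 * rademacherAvg (Fin n × Fin m) P ψ := by
    rw [rademacherAvg, ← signAvg_const (J := Fin n) (2 * rademacherAvg (Fin n × Fin m) P ψ)]
    refine signAvg_mono fun ε => ?_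
    refine le_trans (le_of_eq ?_)
      (weightedSup_sub_integral_le_rademacherAvg (J := Fin n × Fin m) hi fun p => ε p.1)
    unfold weightedSup
    rw [hQ, ← integral_comp_of_measurePreserving (measurePreserving_curry (P := P))
      (integrable_iSup_sum_pi hZ _).aestronglyMeasurable]
    congr 1
    ext w
    congr 1
    ext k
    rw [Fintype.sum_prod_type]
    exact Finset.sum_congr rfl fun j _ => Finset.mul_sum _ _ _
  have hint : Integrable (fun B : Fin n → Fin m → 𝓩 => ⨆ k, ∑ j, sgn ((1 : Fin n → ℤˣ) j) *
      (|centredSum P (ψ k) (B j)| - ∫ B, |centredSum P (ψ k) B| ∂Q)) (Measure.pi fun _ => Q) :=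
    integrable_iSup_sum_pi (fun k => (hA k).sub (integrable_const _)) _
  have hint' : Integrable (fun B : Fin n → Fin m → 𝓩 => ⨆ k, ∑ j, |centredSum P (ψ k) (B j)|)
      (Measure.pi fun _ => Q) :=
    integrable_iSup_fintype fun k => integrable_finsetSum _ fun j _ => integrable_pi_eval (hA k) j
  have h4 : ∫ B : Fin n → Fin m → 𝓩, ⨆ k, ∑ j, |centredSum P (ψ k) (B j)| ∂(Measure.pi fun _ => Q)
      ≤ weightedSup Q (fun k B => |centredSum P (ψ k) B| - ∫ B, |centredSum P (ψ k) B| ∂Q)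
        (fun j : Fin n => sgn ((1 : Fin n → ℤˣ) j)) + n * (s * √m) := by
    unfold weightedSup
    have hc : ∫ _ : Fin n → Fin m → 𝓩, (n * (s * √m) : ℝ) ∂(Measure.pi fun _ => Q) =
        n * (s * √m) := by simp
    rw [← hc, ← integral_add hint (integrable_const _)]
    refine integral_mono hint' (hint.add (integrable_const _)) fun B => ciSup_le fun k => ?_
    have h5 := le_iSup_fintype (fun k => ∑ j, sgn ((1 : Fin n → ℤˣ) j) *
      (|centredSum P (ψ k) (B j)| - ∫ B, |centredSum P (ψ k) B| ∂Q)) k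
    have h6 : ∑ j, sgn ((1 : Fin n → ℤˣ) j) *
        (|centredSum P (ψ k) (B j)| - ∫ B, |centredSum P (ψ k) B| ∂Q) =
        (∑ j, |centredSum P (ψ k) (B j)|) - n * ∫ B, |centredSum P (ψ k) B| ∂Q := by
      simp
    have h7 := mul_le_mul_of_nonneg_left (integral_abs_centredSum_le (m := m) (hψ k) hs (hψs k))
      (Nat.cast_nonneg (α := ℝ) n)
    simp only [← hQ] at h7
    dsimp only at h5 ⊢
    linarith
  linarith

/-- The number of blocks whose centred sum exceeds `t` in absolute value. -/
noncomputable def largeBlocks (P : Measure 𝓩) {n m : ℕ} (ψ : 𝓩 → ℝ) (t : ℝ)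
    (B : Fin n → Fin m → 𝓩) : ℕ :=
  (Finset.univ.filter fun j => t < |centredSum P ψ (B j)|).card

lemma measurable_largeBlocks {n m : ℕ} {ψ : 𝓩 → ℝ} (hψ : Measurable ψ) (t : ℝ) :
    Measurable fun B : Fin n → Fin m → 𝓩 => (largeBlocks P ψ t B : ℝ) := by
  have h : (fun B : Fin n → Fin m → 𝓩 => (largeBlocks P ψ t B : ℝ)) =
      fun B => ∑ j, if t < |centredSum P ψ (B j)| then (1 : ℝ) else 0 := by
    ext B; simp [largeBlocks]
  rw [h]
  refine Finset.measurable_sum _ fun j _ => ?_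
  have hm : Measurable fun B : Fin n → Fin m → 𝓩 => |centredSum P ψ (B j)| :=
    ((measurable_centredSum hψ).comp (measurable_pi_apply j)).abs
  exact Measurable.ite (measurableSet_lt measurable_const hm) measurable_const measurable_const

lemma largeBlocks_le {n m : ℕ} (ψ : 𝓩 → ℝ) (t : ℝ) (B : Fin n → Fin m → 𝓩) :
    largeBlocks P ψ t B ≤ n := by
  simpa [largeBlocks] using Finset.card_filter_le (Finset.univ : Finset (Fin n))
    fun j => t < |centredSum P ψ (B j)|

lemma largeBlocks_update_le {n m : ℕ} (ψ : 𝓩 → ℝ) (t : ℝ) (B : Fin n → Fin m → 𝓩) (i : Fin n)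
    (w : Fin m → 𝓩) :
    largeBlocks P ψ t (Function.update B i w) ≤ largeBlocks P ψ t B + 1 := by
  refine (Finset.card_le_card (t := insert i
    (Finset.univ.filter fun j => t < |centredSum P ψ (B j)|)) fun j hj => ?_).trans
      (Finset.card_insert_le _ _)
  rcases eq_or_ne j i with rfl | hji
  · simp
  · simpa [hji] using hj

/-- With exponentially high probability, for every member of a finite family all but a tenth of the
block sums are close to their expectation. -/
theorem measure_exists_largeBlocks_le_of_fintype [IsProbabilityMeasure P]
    [Finite K] [Nonempty K] {n m : ℕ} (hn : 0 < n)
    (hm : 0 < m) {ψ : K → 𝓩 → ℝ} (hψm : ∀ k, Measurable (ψ k)) (hψ : ∀ k, MemLp (ψ k) 2 P)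
    {s b γ : ℝ} (hs : 0 ≤ s) (hγ : 0 < γ) (hψs : ∀ k, ∫ z, ψ k z ^ 2 ∂P ≤ s ^ 2)
    (hb : rademacherAvg (Fin n × Fin m) P ψ ≤ n * m * b) (hsb : s / √m + 4 * b ≤ γ / 20) :
    (Measure.pi fun _ => Measure.pi fun _ => P).real
      {B : Fin n → Fin m → 𝓩 | ∃ k, (n : ℝ) / 10 < largeBlocks P (ψ k) (m * γ) B} ≤
      Real.exp (-(n / 200)) := by
  set f : (Fin n → Fin m → 𝓩) → ℝ := fun B => ⨆ k, (largeBlocks P (ψ k) (m * γ) B : ℝ) with hf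
  have hn' : (0 : ℝ) < n := by exact_mod_cast hn
  have hm' : (0 : ℝ) < m := by exact_mod_cast hm
  have hfm : Measurable f := Measurable.iSup fun k => measurable_largeBlocks (hψm k) _
  have hf0 : ∀ B, 0 ≤ f B := fun B => Real.iSup_nonneg fun k => Nat.cast_nonneg _
  have hfn : ∀ B, f B ≤ n := fun B =>
    ciSup_le fun k => by exact_mod_cast largeBlocks_le (ψ k) _ B
  have hupd : ∀ B i w, f (Function.update B i w) ≤ f B + 1 := fun B i w => by
    refine ciSup_le fun k => ?_
    have h1 := le_iSup_fintype (fun k => (largeBlocks P (ψ k) (m * γ) B : ℝ)) k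
    have h2 : (largeBlocks P (ψ k) (m * γ) (Function.update B i w) : ℝ) ≤
        largeBlocks P (ψ k) (m * γ) B + 1 := by
      exact_mod_cast largeBlocks_update_le (ψ k) (m * γ) B i w
    linarith
  have hd : ∀ B i w, |f (Function.update B i w) - f B| ≤ 1 := fun B i w => by
    have h1 := hupd B i w
    have h2 := hupd (Function.update B i w) i (B i)
    rw [Function.update_idem, Function.update_eq_self] at h2
    rw [abs_le]
    constructor <;> linarith
  have hA : ∀ k, Integrable (fun B : Fin m → 𝓩 => |centredSum P (ψ k) B|)
      (Measure.pi fun _ => P) := fun k =>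
    (integrable_centredSum ((hψ k).integrable one_le_two)).abs
  -- Markov in the form: each counted block contributes at least mγ to the sum of absolute centred
  -- block sums. The hypothesis `hsb` makes the resulting bound n/20.
  have hE : ∫ B, f B ∂(Measure.pi fun _ => Measure.pi fun _ => P) ≤ n / 20 := by
    have h1 := integral_iSup_sum_abs_centredSum_le (n := n) (m := m) hψ hs hψs
    have h2 : (m * γ) * ∫ B, f B ∂(Measure.pi fun _ => Measure.pi fun _ => P) ≤
        ∫ B : Fin n → Fin m → 𝓩, ⨆ k, ∑ j, |centredSum P (ψ k) (B j)|
          ∂(Measure.pi fun _ => Measure.pi fun _ => P) := by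
      rw [← integral_const_mul]
      refine integral_mono ((Integrable.of_bound hfm.aestronglyMeasurable (n : ℝ)
        (Filter.Eventually.of_forall fun B => by
          rw [Real.norm_eq_abs, abs_of_nonneg (hf0 B)]; exact hfn B)).const_mul _)
        (integrable_iSup_fintype fun k => integrable_finsetSum _ fun j _ =>
          integrable_pi_eval (hA k) j) fun B => ?_
      dsimp only [f]
      rw [Real.mul_iSup_of_nonneg (by positivity)]
      refine iSup_mono_fintype fun k => ?_
      rw [largeBlocks, mul_comm, ← nsmul_eq_mul]
      refine (Finset.card_nsmul_le_sum _ (fun j => |centredSum P (ψ k) (B j)|) _ fun j hj =>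
        (Finset.mem_filter.1 hj).2.le).trans ?_
      exact Finset.sum_le_sum_of_subset_of_nonneg (Finset.filter_subset _ _)
        fun _ _ _ => abs_nonneg _
    have h3 : n * (s * √m) + 4 * rademacherAvg (Fin n × Fin m) P ψ ≤ n * m * (γ / 20) := by
      have h4 : n * (s * √m) = n * m * (s / √m) := by
        rw [mul_assoc (n : ℝ), mul_div_assoc', mul_comm (m : ℝ) s, mul_div_assoc, Real.div_sqrt]
      have h5 := mul_le_mul_of_nonneg_left hsb (by positivity : (0 : ℝ) ≤ n * m)
      rw [h4]
      linarith
    have h6 : (m * γ) * ∫ B, f B ∂(Measure.pi fun _ => Measure.pi fun _ => P) ≤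
        (m * γ) * (n / 20) := by linarith
    exact le_of_mul_le_mul_left h6 (by positivity)
  -- An excess of n/20 over a mean of at most n/20 reaches n/10, and 2(n/20)²/n = n/200.
  have hmc := measure_ge_le_of_bounded_differences (ν := Measure.pi fun _ : Fin m => P) hn hfm
    (C := n) (fun B => by rw [abs_of_nonneg (hf0 B)]; exact hfn B) hd (s := n / 20)
    (by positivity)
  refine (measureReal_mono (fun B hB => ?_) (by finiteness)).trans (hmc.trans ?_)
  · obtain ⟨k, hk⟩ := hB
    have h1 := le_iSup_fintype (fun k => (largeBlocks P (ψ k) (m * γ) B : ℝ)) k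
    change _ + _ ≤ ⨆ k, (largeBlocks P (ψ k) (m * γ) B : ℝ)
    linarith
  · refine Real.exp_le_exp.2 (le_of_eq ?_)
    field_simp
    norm_num

/-- The version of `measure_exists_largeBlocks_le_of_fintype` for countable families. -/
theorem measure_exists_largeBlocks_le [IsProbabilityMeasure P]
    {n m : ℕ} (hn : 0 < n) (hm : 0 < m) {ψ : ℕ → 𝓩 → ℝ}
    (hψm : ∀ k, Measurable (ψ k)) (hψ : ∀ k, MemLp (ψ k) 2 P) {s b γ : ℝ} (hs : 0 ≤ s)
    (hγ : 0 < γ) (hψs : ∀ k, ∫ z, ψ k z ^ 2 ∂P ≤ s ^ 2)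
    (hb : ∀ M : ℕ, rademacherAvg (Fin n × Fin m) P (fun k : Fin (M + 1) => ψ k) ≤ n * m * b)
    (hsb : s / √m + 4 * b ≤ γ / 20) :
    (Measure.pi fun _ => Measure.pi fun _ => P)
      {B : Fin n → Fin m → 𝓩 | ∃ k, (n : ℝ) / 10 < largeBlocks P (ψ k) (m * γ) B} ≤
      ENNReal.ofReal (Real.exp (-(n / 200))) := by
  have hset : {B : Fin n → Fin m → 𝓩 | ∃ k, (n : ℝ) / 10 < largeBlocks P (ψ k) (m * γ) B} =
      ⋃ k, {B : Fin n → Fin m → 𝓩 | (n : ℝ) / 10 < largeBlocks P (ψ k) (m * γ) B} := by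
    ext B; simp
  -- The bound for finite subfamilies does not depend on their size, so continuity from below gives
  -- the countable case.
  rw [hset, measure_iUnion_eq_iSup_accumulate]
  refine iSup_le fun M => ?_
  have h := measure_exists_largeBlocks_le_of_fintype hn hm (ψ := fun k : Fin (M + 1) => ψ k)
    (fun k => hψm k) (fun k => hψ k) hs hγ (fun k => hψs k) (hb M) hsb
  rw [Measure.real, ← ENNReal.le_ofReal_iff_toReal_le (by finiteness) (Real.exp_nonneg _)] at h
  refine (measure_mono fun B hB => ?_).trans h
  obtain ⟨k, hk, hB⟩ := Set.mem_accumulate.1 hB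
  exact ⟨⟨k, Nat.lt_succ_of_le hk⟩, hB⟩

lemma block_lt {N n m : ℕ} (h : n * m ≤ N) (p : Fin n × Fin m) : p.1.val * m + p.2.val < N := by
  have h1 := p.1.isLt
  have h2 := p.2.isLt
  calc p.1.val * m + p.2.val < p.1.val * m + m := by omega
    _ = (p.1.val + 1) * m := by ring
    _ ≤ n * m := Nat.mul_le_mul_right _ h1
    _ ≤ N := h

/-- The position in the sample of the `i`-th member of the `j`-th block. -/
def blockIndex {N n m : ℕ} (h : n * m ≤ N) (p : Fin n × Fin m) : Fin N :=
  ⟨p.1.val * m + p.2.val, block_lt h p⟩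

lemma blockIndex_injective {N n m : ℕ} (h : n * m ≤ N) : Function.Injective (blockIndex h) := by
  rintro ⟨j, i⟩ ⟨j', i'⟩ hp
  have hv : j.val * m + i.val = j'.val * m + i'.val := congrArg Fin.val hp
  have hm : 0 < m := (Nat.zero_le _).trans_lt i.isLt
  have hi : i.val = i'.val := by
    have := congrArg (· % m) hv
    simpa [Nat.mul_add_mod_of_lt, mul_comm _ m, Nat.mod_eq_of_lt i.isLt,
      Nat.mod_eq_of_lt i'.isLt] using this
  have hj : j.val = j'.val := Nat.eq_of_mul_eq_mul_right hm (by omega)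
  exact Prod.ext (Fin.ext hj) (Fin.ext hi)

lemma blockMean_eq {N n m : ℕ} (h : n * m ≤ N) (v : Fin N → ℝ) (j : Fin n) :
    blockMean m v j = (m : ℝ)⁻¹ * ∑ i : Fin m, v (blockIndex h (j, i)) := by
  unfold blockMean
  congr 1
  symm
  refine Finset.sum_bij (fun i _ => blockIndex h (j, i)) (fun i _ => ?_) (fun i _ i' _ hi => ?_)
    (fun x hx => ?_) fun _ _ => rfl
  · simp only [Finset.mem_filter, Finset.mem_univ, true_and, blockIndex, add_mul, one_mul]
    omega
  · exact (Prod.ext_iff.1 (blockIndex_injective h hi)).2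
  · simp only [Finset.mem_filter, Finset.mem_univ, true_and, add_mul, one_mul] at hx
    exact ⟨⟨x.val - j * m, by omega⟩, Finset.mem_univ _, Fin.ext (by simp [blockIndex]; omega)⟩

/-- The blocks of a sample. -/
def toBlocks {N n m : ℕ} (h : n * m ≤ N) (D : Fin N → 𝓩) : Fin n → Fin m → 𝓩 :=
  fun j i => D (blockIndex h (j, i))

lemma measurePreserving_toBlocks [IsProbabilityMeasure P] {N n m : ℕ} (h : n * m ≤ N) :
    MeasurePreserving (toBlocks h : (Fin N → 𝓩) → _) (Measure.pi fun _ => P)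
      (Measure.pi fun _ => Measure.pi fun _ => P) :=
  measurePreserving_curry.comp (measurePreserving_comp_injective (blockIndex_injective h))

/-- The number of blocks on which the mean of `ψ` is not within `γ` of its expectation. -/
noncomputable def deviatingBlocks (P : Measure 𝓩) {N : ℕ} (n m : ℕ) (ψ : 𝓩 → ℝ) (γ : ℝ)
    (D : Fin N → 𝓩) : ℕ :=
  (Finset.univ.filter fun j : Fin n =>
    γ < |blockMean m (fun i => ψ (D i)) j - ∫ z, ψ z ∂P|).card

lemma deviatingBlocks_eq {N n m : ℕ} (h : n * m ≤ N) (hm : 0 < m) (ψ : 𝓩 → ℝ) (γ : ℝ)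
    (D : Fin N → 𝓩) :
    deviatingBlocks P n m ψ γ D = largeBlocks P ψ (m * γ) (toBlocks h D) := by
  unfold deviatingBlocks largeBlocks
  congr 1
  refine Finset.filter_congr fun j _ => ?_
  have hm' : (0 : ℝ) < m := by exact_mod_cast hm
  have h1 : centredSum P ψ (toBlocks h D j) =
      m * (blockMean m (fun i => ψ (D i)) j - ∫ z, ψ z ∂P) := by
    rw [blockMean_eq h, centredSum, Finset.sum_sub_distrib]
    simp [toBlocks, mul_sub, mul_inv_cancel_left₀ hm'.ne']
  rw [h1, abs_mul, abs_of_pos hm', mul_lt_mul_iff_right₀ hm']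

lemma measurableSet_deviatingBlocks [IsProbabilityMeasure P]
    {N n m : ℕ} (h : n * m ≤ N) (hm : 0 < m) {ψ : ℕ → 𝓩 → ℝ}
    (hψm : ∀ k, Measurable (ψ k)) (γ : ℝ) :
    MeasurableSet {D : Fin N → 𝓩 | ∃ k, (n : ℝ) / 10 < deviatingBlocks P n m (ψ k) γ D} := by
  simp_rw [deviatingBlocks_eq h hm]
  rw [show {D : Fin N → 𝓩 | ∃ k, (n : ℝ) / 10 < largeBlocks P (ψ k) (m * γ) (toBlocks h D)} =
    ⋃ k, {D : Fin N → 𝓩 | (n : ℝ) / 10 < largeBlocks P (ψ k) (m * γ) (toBlocks h D)} by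
      ext D; simp]
  exact MeasurableSet.iUnion fun k => measurableSet_lt measurable_const
    ((measurable_largeBlocks (hψm k) _).comp (measurePreserving_toBlocks (P := P) h).measurable)

theorem measure_exists_deviatingBlocks_le [IsProbabilityMeasure P]
    {N n m : ℕ} (h : n * m ≤ N) (hn : 0 < n) (hm : 0 < m)
    {ψ : ℕ → 𝓩 → ℝ} (hψm : ∀ k, Measurable (ψ k)) (hψ : ∀ k, MemLp (ψ k) 2 P) {s b γ : ℝ}
    (hs : 0 ≤ s) (hγ : 0 < γ) (hψs : ∀ k, ∫ z, ψ k z ^ 2 ∂P ≤ s ^ 2)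
    (hb : ∀ M : ℕ, rademacherAvg (Fin n × Fin m) P (fun k : Fin (M + 1) => ψ k) ≤ n * m * b)
    (hsb : s / √m + 4 * b ≤ γ / 20) :
    (Measure.pi fun _ => P)
      {D : Fin N → 𝓩 | ∃ k, (n : ℝ) / 10 < deviatingBlocks P n m (ψ k) γ D} ≤
      ENNReal.ofReal (Real.exp (-(n / 200))) := by
  refine le_trans ?_ (measure_exists_largeBlocks_le hn hm hψm hψ hs hγ hψs hb hsb)
  rw [← (measurePreserving_toBlocks (P := P) h).map_eq]
  refine le_trans (le_of_eq ?_)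
    (Measure.le_map_apply (measurePreserving_toBlocks (P := P) h).aemeasurable _)
  congr 1
  ext D
  simp only [deviatingBlocks_eq h hm]
  rfl

end Blocks

/-! ### Medians and limits of counts -/

section Median

/-- The witness is the least z j with at least half of the values at or below it. Were fewer than
half at or above it, the largest strictly smaller value would qualify too. Without a median, `sInf`
would take its default value on the empty set. -/
lemma exists_median {k : ℕ} (hk : 0 < k) (z : Fin k → ℝ) :
    ∃ t : ℝ, k ≤ 2 * (Finset.univ.filter fun j => z j ≤ t).card ∧
      k ≤ 2 * (Finset.univ.filter fun j => t ≤ z j).card := by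
  have : Nonempty (Fin k) := ⟨⟨0, hk⟩⟩
  set S := Finset.univ.filter fun j => k ≤ 2 * (Finset.univ.filter fun i => z i ≤ z j).card with hS
  have hne : S.Nonempty := by
    obtain ⟨j, hj⟩ := Finite.exists_max z
    refine ⟨j, Finset.mem_filter.2 ⟨Finset.mem_univ _, ?_⟩⟩
    rw [Finset.filter_true_of_mem fun i _ => hj i]
    simp
    omega
  obtain ⟨j, hjS, hj⟩ := S.exists_min_image z hne
  refine ⟨z j, (Finset.mem_filter.1 hjS).2, ?_⟩
  by_contra! hlt
  set T := Finset.univ.filter fun i => z i < z j with hT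
  have hsplit : (Finset.univ.filter fun i => z j ≤ z i).card + T.card = k := by
    have := Finset.card_filter_add_card_filter_not (s := (Finset.univ : Finset (Fin k)))
      (fun i => z j ≤ z i)
    simpa [hT, not_le] using this
  have hTne : T.Nonempty := by
    rw [← Finset.card_pos]; omega
  obtain ⟨i, hiT, hi⟩ := T.exists_max_image z hTne
  have hsub : T ⊆ Finset.univ.filter fun l => z l ≤ z i := fun l hl =>
    Finset.mem_filter.2 ⟨Finset.mem_univ _, hi l hl⟩
  have hiS : i ∈ S := by
    refine Finset.mem_filter.2 ⟨Finset.mem_univ _, ?_⟩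
    have := Finset.card_le_card hsub
    omega
  exact absurd (hj i hiS) (not_le.2 (Finset.mem_filter.1 hiT).2)

lemma smallestMedian_le {k : ℕ} (z : Fin k → ℝ) {c : ℝ}
    (hc : 2 * (Finset.univ.filter fun j => c < z j).card < k) : smallestMedian z ≤ c := by
  obtain ⟨t, ht⟩ := exists_median (Nat.zero_lt_of_lt hc) z
  have htc : t ≤ c := by
    by_contra! h
    have : (Finset.univ.filter fun j => t ≤ z j).card ≤
        (Finset.univ.filter fun j => c < z j).card :=
      Finset.card_le_card (Finset.monotone_filter_right _ fun j _ hj => h.trans_le hj)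
    omega
  refine le_trans (b := t) (csInf_le ?_ ht) htc
  -- `csInf_le` needs the set of medians to be bounded below; no number below the minimum of `z` is
  -- a median.
  have : Nonempty (Fin k) := ⟨⟨0, Nat.zero_lt_of_lt hc⟩⟩
  obtain ⟨j, hj⟩ := Finite.exists_min z
  refine ⟨z j, fun s hs => ?_⟩
  by_contra! h
  have : (Finset.univ.filter fun j => z j ≤ s) = ∅ :=
    Finset.filter_false_of_mem fun i _ => not_le.2 (h.trans_le (hj i))
  have h1 := hs.1
  rw [this, Finset.card_empty] at h1
  omega

lemma le_smallestMedian {k : ℕ} (z : Fin k → ℝ) {c : ℝ}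
    (hc : 2 * (Finset.univ.filter fun j => z j ≤ c).card < k) : c ≤ smallestMedian z := by
  refine le_csInf (exists_median (Nat.zero_lt_of_lt hc) z) fun t ht => ?_
  by_contra! h
  have : (Finset.univ.filter fun j => z j ≤ t).card ≤
      (Finset.univ.filter fun j => z j ≤ c).card :=
    Finset.card_le_card (Finset.monotone_filter_right _ fun j _ hj => hj.trans h.le)
  have := ht.1
  omega

/-- Counting bounds for exceedances pass to the limit, at the cost of raising the level. -/
lemma card_filter_le_of_tendsto {ι : Type*} [Fintype ι] {y : ℕ → ι → ℝ} {y₀ : ι → ℝ}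
    (hy : ∀ j, Filter.Tendsto (fun k => y k j) Filter.atTop (nhds (y₀ j))) {c c' C : ℝ}
    (hc : c < c')
    (h : ∀ᶠ k in Filter.atTop, ((Finset.univ.filter fun j => c < y k j).card : ℝ) ≤ C) :
    ((Finset.univ.filter fun j => c' ≤ y₀ j).card : ℝ) ≤ C := by
  -- There are finitely many indices, so one large k turns every limit value that is at least c'
  -- into a value above c.
  have h1 : ∀ᶠ k in Filter.atTop, ∀ j, c' ≤ y₀ j → c < y k j := by
    rw [Filter.eventually_all]
    intro j
    by_cases hj : c' ≤ y₀ j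
    · filter_upwards [(hy j).eventually (lt_mem_nhds (hc.trans_le hj))] with k hk _ using hk
    · exact Filter.Eventually.of_forall fun k hk => absurd hk hj
  obtain ⟨k, hk1, hk2⟩ := (h1.and h).exists
  refine le_trans ?_ hk2
  exact_mod_cast Finset.card_le_card (Finset.monotone_filter_right _ fun j _ hj => hk1 j hj)

end Median

/-! ### Comparison of L₁ and L₂ norms, and scaling -/

section Norms

variable {𝓩 : Type*} [MeasurableSpace 𝓩] {P : Measure 𝓩}

/-- The `L₂(P)` norm of `w` as a real number. -/
noncomputable def l2norm (P : Measure 𝓩) (w : 𝓩 → ℝ) : ℝ := √(∫ z, w z ^ 2 ∂P)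

lemma l2norm_nonneg (w : 𝓩 → ℝ) : 0 ≤ l2norm P w := Real.sqrt_nonneg _

lemma l2norm_sq (w : 𝓩 → ℝ) : l2norm P w ^ 2 = ∫ z, w z ^ 2 ∂P :=
  Real.sq_sqrt (integral_nonneg fun _ => sq_nonneg _)

lemma l2norm_const_mul {t : ℝ} (ht : 0 ≤ t) (w : 𝓩 → ℝ) :
    l2norm P (fun z => t * w z) = t * l2norm P w := by
  simp only [l2norm, mul_pow]
  rw [integral_const_mul, Real.sqrt_mul (sq_nonneg t), Real.sqrt_sq ht]

lemma eLpNorm_two_eq {w : 𝓩 → ℝ} (hw : MemLp w 2 P) :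
    eLpNorm w 2 P = ENNReal.ofReal (l2norm P w) := by
  rw [hw.eLpNorm_eq_integral_rpow_norm two_ne_zero ENNReal.ofNat_ne_top, l2norm,
    Real.sqrt_eq_rpow]
  simp

lemma l2norm_add_le {w w' : 𝓩 → ℝ} (hw : MemLp w 2 P) (hw' : MemLp w' 2 P) :
    l2norm P (fun z => w z + w' z) ≤ l2norm P w + l2norm P w' := by
  have h := eLpNorm_add_le hw.aestronglyMeasurable hw'.aestronglyMeasurable one_le_two (p := 2)
  rw [eLpNorm_two_eq (hw.add hw'), eLpNorm_two_eq hw, eLpNorm_two_eq hw',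
    ← ENNReal.ofReal_add (l2norm_nonneg _) (l2norm_nonneg _)] at h
  exact (ENNReal.ofReal_le_ofReal_iff (add_nonneg (l2norm_nonneg _) (l2norm_nonneg _))).1 h

lemma integral_abs_le_l2norm [IsProbabilityMeasure P] {w : 𝓩 → ℝ} (hw : MemLp w 2 P) :
    ∫ z, |w z| ∂P ≤ l2norm P w :=
  Real.le_sqrt_of_sq_le (sq_integral_abs_le hw)

/-- The ratio between the `L₁` and `L₂` norms guaranteed by an `L_q`-`L₂` norm equivalence with
constant `L`. -/
noncomputable def l1Ratio (q L : ℝ) : ℝ := (2 * (2 * L ^ q) ^ (q - 2)⁻¹)⁻¹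

lemma l1Ratio_pos {q L : ℝ} (hL : 1 ≤ L) : 0 < l1Ratio q L := by
  unfold l1Ratio; positivity

lemma l1Ratio_le_one {q L : ℝ} (hq : 2 < q) (hL : 1 ≤ L) : l1Ratio q L ≤ 1 := by
  unfold l1Ratio
  refine inv_le_one_of_one_le₀ ?_
  have h1 : 1 ≤ L ^ q := Real.one_le_rpow hL (by linarith)
  have h2 : 1 ≤ (2 * L ^ q) ^ (q - 2)⁻¹ :=
    Real.one_le_rpow (by linarith) (inv_nonneg.2 (by linarith))
  linarith

/-- Truncation at level t: below it x² ≤ tx, above it (x/t)^(q-2) ≥ 1. Integrated, it bounds the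
second moment by the first and the q-th. -/
lemma sq_le_mul_add_rpow {q x t : ℝ} (hq : 2 < q) (hx : 0 ≤ x) (ht : 0 < t) :
    x ^ 2 ≤ t * x + t ^ (2 - q) * x ^ q := by
  rcases le_total x t with h | h
  · have : 0 ≤ t ^ (2 - q) * x ^ q := by positivity
    nlinarith
  · have hx0 : 0 < x := ht.trans_le h
    have h1 : x ^ q = x ^ 2 * x ^ (q - 2) := by
      rw [← Real.rpow_natCast, ← Real.rpow_add hx0]; congr 1; push_cast; ring
    have h2 : t ^ (2 - q) * t ^ (q - 2) = 1 := by
      rw [← Real.rpow_add ht]; simp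
    have h3 : t ^ (q - 2) ≤ x ^ (q - 2) := Real.rpow_le_rpow ht.le h (by linarith)
    have h4 : 1 ≤ t ^ (2 - q) * x ^ (q - 2) := by
      rw [← h2]; exact mul_le_mul_of_nonneg_left h3 (by positivity)
    have h5 : 0 ≤ t * x := by positivity
    rw [h1]
    nlinarith [mul_le_mul_of_nonneg_left h4 (sq_nonneg x)]

/-- Norm equivalence bounds the `L₁` norm from below by the `L₂` norm. -/
lemma l1Ratio_mul_l2norm_le [IsProbabilityMeasure P] {q L : ℝ} (hq : 2 < q) (hL : 1 ≤ L)
    {w : 𝓩 → ℝ} (hw : MemLp w 2 P)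
    (h : eLpNorm w (ENNReal.ofReal q) P ≤ ENNReal.ofReal L * eLpNorm w 2 P) :
    l1Ratio q L * l2norm P w ≤ ∫ z, |w z| ∂P := by
  have hq0 : 0 < q := by linarith
  rcases (l2norm_nonneg (P := P) w).eq_or_lt with h0 | hρ
  · rw [← h0, mul_zero]; exact integral_nonneg fun _ => abs_nonneg _
  set ρ := l2norm P w with hρdef
  -- With truncation level Kρ, this K makes the bound on the q-th moment term exactly ρ²/2; it is
  -- absorbed on the left and leaves ρ ≤ 2K E|w|.
  set K := (2 * L ^ q) ^ (q - 2)⁻¹ with hK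
  have hK0 : 0 < K := by positivity
  have hwq : MemLp w (ENNReal.ofReal q) P := ⟨hw.aestronglyMeasurable, h.trans_lt
    (ENNReal.mul_lt_top ENNReal.ofReal_lt_top hw.eLpNorm_lt_top)⟩
  have hq1 : ENNReal.ofReal q ≠ 0 := by simpa using hq0
  have hI : ∫ z, |w z| ^ q ∂P ≤ (L * ρ) ^ q := by
    rw [hwq.eLpNorm_eq_integral_rpow_norm hq1 ENNReal.ofReal_ne_top, eLpNorm_two_eq hw,
      ENNReal.toReal_ofReal hq0.le, ← ENNReal.ofReal_mul (by linarith),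
      ENNReal.ofReal_le_ofReal_iff (by positivity)] at h
    have hnn : 0 ≤ ∫ z, ‖w z‖ ^ q ∂P := integral_nonneg fun _ => by positivity
    have := Real.rpow_le_rpow (by positivity) h hq0.le
    rwa [← Real.rpow_mul hnn, inv_mul_cancel₀ hq0.ne', Real.rpow_one] at this
  have hwi : Integrable (fun z => |w z|) P := (hw.integrable one_le_two).abs
  have hwqi : Integrable (fun z => |w z| ^ q) P := by
    have := hwq.integrable_norm_rpow hq1 ENNReal.ofReal_ne_top
    simpa [ENNReal.toReal_ofReal hq0.le] using this
  have h1 : ρ ^ 2 ≤ K * ρ * ∫ z, |w z| ∂P + (K * ρ) ^ (2 - q) * ∫ z, |w z| ^ q ∂P := by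
    rw [hρdef, l2norm_sq, ← integral_const_mul, ← integral_const_mul,
      ← integral_add (hwi.const_mul _) (hwqi.const_mul _)]
    refine integral_mono hw.integrable_sq ((hwi.const_mul _).add (hwqi.const_mul _)) fun z => ?_
    have := sq_le_mul_add_rpow hq (abs_nonneg (w z)) (mul_pos hK0 hρ)
    rwa [sq_abs] at this
  have h2 : (K * ρ) ^ (2 - q) * (L * ρ) ^ q = ρ ^ 2 / 2 := by
    have hKq : K ^ (2 - q) = (2 * L ^ q)⁻¹ := by
      have hq2 : (q - 2)⁻¹ * (2 - q) = -1 := by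
        rw [← neg_sub q 2, mul_neg, inv_mul_cancel₀ (by linarith)]
      rw [hK, ← Real.rpow_mul (by positivity), hq2, Real.rpow_neg_one]
    have hρ2 : ρ ^ (2 - q) * ρ ^ q = ρ ^ 2 := by
      rw [← Real.rpow_add hρ, ← Real.rpow_natCast]; congr 1; push_cast; ring
    rw [Real.mul_rpow hK0.le hρ.le, Real.mul_rpow (by linarith) hρ.le, hKq,
      show (2 * L ^ q)⁻¹ * ρ ^ (2 - q) * (L ^ q * ρ ^ q) =
        (2 * L ^ q)⁻¹ * L ^ q * (ρ ^ (2 - q) * ρ ^ q) by ring, hρ2]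
    have : L ^ q ≠ 0 := (Real.rpow_pos_of_pos (by linarith) q).ne'
    field_simp
  have h3 := mul_le_mul_of_nonneg_left hI (by positivity : 0 ≤ (K * ρ) ^ (2 - q))
  have h4 : ρ * ρ ≤ ρ * (2 * K * ∫ z, |w z| ∂P) := by nlinarith
  have h5 := le_of_mul_le_mul_left h4 hρ
  rw [l1Ratio, ← hK, inv_mul_le_iff₀ (by positivity)]
  exact h5

/-- A small-ball estimate from the comparison of the `L₁` and `L₂` norms. -/
lemma le_measureReal_abs_gt [IsProbabilityMeasure P] {w : 𝓩 → ℝ} (hwm : Measurable w)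
    (hw : MemLp w 2 P) {a : ℝ} (ha : 0 < a) (h : a * l2norm P w ≤ ∫ z, |w z| ∂P)
    (hρ : 0 < l2norm P w) :
    a ^ 2 / 4 ≤ P.real {z | a * l2norm P w / 2 < |w z|} := by
  set ρ := l2norm P w with hρdef
  set A := {z | a * ρ / 2 < |w z|} with hA
  have hAm : MeasurableSet A := measurableSet_lt measurable_const hwm.abs
  have hwi : Integrable (fun z => |w z|) P := (hw.integrable one_le_two).abs
  have hind : Integrable (A.indicator fun _ => (1 : ℝ)) P := (integrable_const _).indicator hAm
  have hi : Integrable (fun z => a / (4 * ρ) * w z ^ 2 +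
      ρ / a * A.indicator (fun _ => (1 : ℝ)) z) P :=
    (hw.integrable_sq.const_mul _).add (hind.const_mul _)
  -- A pointwise form of Paley–Zygmund: on A, the arithmetic-geometric mean inequality gives |w| ≤
  -- a/(4ρ) w² + ρ/a; off A, |w| ≤ aρ/2. The first two terms integrate to 3aρ/4, so the set A
  -- accounts for the remaining aρ/4.
  have h1 : ∫ z, |w z| ∂P ≤ ∫ z, (a * ρ / 2 + (a / (4 * ρ) * w z ^ 2 +
      ρ / a * A.indicator (fun _ => (1 : ℝ)) z)) ∂P := by
    refine integral_mono hwi ((integrable_const _).add hi) fun z => ?_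
    by_cases hz : z ∈ A
    · rw [Set.indicator_of_mem hz]
      have : |w z| ≤ a / (4 * ρ) * w z ^ 2 + ρ / a := by
        have h2 : a / (4 * ρ) * w z ^ 2 + ρ / a - |w z| =
            (a * |w z| - 2 * ρ) ^ 2 / (4 * ρ * a) := by
          rw [← sq_abs (w z)]; field_simp; ring
        have h3 : 0 ≤ (a * |w z| - 2 * ρ) ^ 2 / (4 * ρ * a) := by positivity
        linarith
      have : 0 < a * ρ / 2 := by positivity
      linarith
    · rw [Set.indicator_of_notMem hz]
      have h2 : |w z| ≤ a * ρ / 2 := not_lt.1 hz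
      have : 0 ≤ a / (4 * ρ) * w z ^ 2 := by positivity
      linarith
  rw [integral_add (integrable_const _) hi,
    integral_add (hw.integrable_sq.const_mul _) (hind.const_mul _), integral_const_mul,
    integral_const_mul, integral_indicator_const _ hAm, ← l2norm_sq, ← hρdef] at h1
  simp only [integral_const, probReal_univ, smul_eq_mul, one_mul, mul_one] at h1
  have h2 : a / (4 * ρ) * ρ ^ 2 = a * ρ / 4 := by field_simp
  have h3 : a * ρ / 4 ≤ ρ / a * P.real A := by linarith
  have h4 : ρ / a * (a ^ 2 / 4) ≤ ρ / a * P.real A := by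
    refine le_trans (le_of_eq ?_) h3; field_simp
  exact le_of_mul_le_mul_left h4 (by positivity)

/-- Under the comparison of the `L₁` and `L₂` norms, pointwise convergence implies convergence
in `L₂`. -/
lemma tendsto_l2norm_of_tendsto [IsProbabilityMeasure P] {v : ℕ → 𝓩 → ℝ}
    (hvm : ∀ k, Measurable (v k)) (hv : ∀ k, MemLp (v k) 2 P) {a : ℝ} (ha : 0 < a)
    (h : ∀ k, a * l2norm P (v k) ≤ ∫ z, |v k z| ∂P)
    (hlim : ∀ z, Filter.Tendsto (fun k => v k z) Filter.atTop (nhds 0)) :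
    Filter.Tendsto (fun k => l2norm P (v k)) Filter.atTop (nhds 0) := by
  have hmeas : TendstoInMeasure P v Filter.atTop fun _ => 0 :=
    tendstoInMeasure_of_tendsto_ae (fun k => (hvm k).aestronglyMeasurable)
      (Filter.Eventually.of_forall hlim)
  rw [tendstoInMeasure_iff_norm] at hmeas
  rw [Metric.tendsto_atTop']
  intro δ hδ
  -- If the norm is at least δ, the small-ball estimate gives mass a²/4 to the set where |v k|
  -- exceeds aδ/2; convergence in measure excludes this for large k.
  have h1 := (hmeas (a * δ / 2) (by positivity)).eventually
    (gt_mem_nhds (show (0 : ℝ≥0∞) < ENNReal.ofReal (a ^ 2 / 4) by simpa using by positivity))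
  obtain ⟨k₀, hk₀⟩ := Filter.eventually_atTop.1 h1
  refine ⟨k₀, fun k hk => ?_⟩
  rw [Real.dist_eq, sub_zero, abs_of_nonneg (l2norm_nonneg _)]
  by_contra! hδk
  have h2 := le_measureReal_abs_gt (hvm k) (hv k) ha (h k) (hδ.trans_le hδk)
  have h3 : P.real {z | a * l2norm P (v k) / 2 < |v k z|} ≤
      P.real {z | a * δ / 2 ≤ ‖v k z - 0‖} := by
    refine measureReal_mono (fun z hz => ?_) (by finiteness)
    have hz' : a * l2norm P (v k) / 2 < |v k z| := hz
    change a * δ / 2 ≤ ‖v k z - 0‖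
    rw [sub_zero, Real.norm_eq_abs]
    have := mul_le_mul_of_nonneg_left hδk ha.le
    linarith
  have h4 := hk₀ k hk.le
  rw [← ENNReal.ofReal_toReal (measure_ne_top P {z | a * δ / 2 ≤ ‖v k z - 0‖})] at h4
  have h5 := (ENNReal.ofReal_lt_ofReal_iff (by positivity)).1 h4
  change P.real _ < _ at h5
  linarith

/-- The factor that scales `w` down to `L₂` norm at most `r`. -/
noncomputable def scaleFactor (P : Measure 𝓩) (r : ℝ) (w : 𝓩 → ℝ) : ℝ :=
  if l2norm P w ≤ r then 1 else r / l2norm P w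

lemma scaleFactor_pos {r : ℝ} (hr : 0 < r) (w : 𝓩 → ℝ) : 0 < scaleFactor P r w := by
  unfold scaleFactor
  split_ifs with h
  · exact one_pos
  · exact div_pos hr (hr.trans (not_le.1 h))

lemma scaleFactor_le_one {r : ℝ} (hr : 0 < r) (w : 𝓩 → ℝ) : scaleFactor P r w ≤ 1 := by
  unfold scaleFactor
  split_ifs with h
  · exact le_rfl
  · exact (div_le_one (hr.trans (not_le.1 h))).2 (not_le.1 h).le

lemma scaleFactor_mul_l2norm {r : ℝ} (hr : 0 < r) (w : 𝓩 → ℝ) :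
    scaleFactor P r w * l2norm P w = min (l2norm P w) r := by
  unfold scaleFactor
  split_ifs with h
  · rw [one_mul, min_eq_left h]
  · rw [div_mul_cancel₀ _ (hr.trans (not_le.1 h)).ne', min_eq_right (not_le.1 h).le]

end Norms

/-! ### From the fixed points to Rademacher bounds -/

section Complexity

variable {𝓧 : Type u} {K : Type*}

lemma sum_piFinset_sign {N : ℕ} {M : Type*} [AddCommMonoid M] (G : (Fin N → ℝ) → M) :
    ∑ ε ∈ Fintype.piFinset (fun _ : Fin N => ({-1, 1} : Finset ℝ)), G ε =
      ∑ ε : Fin N → ℤˣ, G fun i => sgn (ε i) := by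
  symm
  refine Finset.sum_bij (fun ε _ => fun i => sgn (ε i)) (fun ε _ => ?_) (fun ε _ ε' _ h => ?_)
    (fun b hb => ?_) fun _ _ => rfl
  · rw [Fintype.mem_piFinset]
    intro i
    rcases sgn_eq (ε i) with h | h <;> simp [h]
  · ext i
    have := congrFun h i
    simp only [sgn] at this
    exact_mod_cast this
  · rw [Fintype.mem_piFinset] at hb
    refine ⟨fun i => if b i = 1 then 1 else -1, Finset.mem_univ _, ?_⟩
    ext i
    have h := hb i
    rw [Finset.mem_insert, Finset.mem_singleton] at h
    rcases h with h | h
    · simp [h]; norm_num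
    · simp [h]

/-- The factor 2 in the condition on r serves to make the inequality strict, so that the infimum
defining a fixed point yields an admissible ρ < r. -/
lemma lt_ofReal_of_two_mul_le {x : ℝ≥0∞} {r : ℝ} (hr : 0 < r)
    (h : 2 * x ≤ ENNReal.ofReal r) : x < ENNReal.ofReal r := by
  have hx : x ≠ ⊤ := by
    rintro rfl
    simp at h
  lift x to NNReal using hx
  rw [ENNReal.ofReal, ← ENNReal.coe_ofNat, ← ENNReal.coe_mul, ENNReal.coe_le_coe] at h
  rw [ENNReal.ofReal, ENNReal.coe_lt_coe]
  have h1 : (2 : ℝ) * x ≤ r := by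
    have := NNReal.coe_le_coe.2 h
    rwa [Real.coe_toNNReal r hr.le] at this
  rw [← NNReal.coe_lt_coe, Real.coe_toNNReal r hr.le]
  have : (0 : ℝ) ≤ x := x.2
  linarith

lemma smul_mem_starZero {A : Set (𝓧 → ℝ)} {u : 𝓧 → ℝ} (hu : u ∈ starZero A) {c : ℝ}
    (hc : 0 ≤ c) (hc1 : c ≤ 1) : c • u ∈ starZero A := by
  obtain ⟨a, ha, t, ht, ht1, rfl⟩ := hu
  exact ⟨a, ha, c * t, mul_nonneg hc ht, mul_le_one₀ hc1 ht ht1, smul_smul c t a⟩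

variable [MeasurableSpace 𝓧]

/-- Since the hull is star-shaped, a supremum at radius r is at most r/ρ times the one at radius ρ.
This carries the inequality from an admissible ρ to any larger r. -/
lemma smul_mem_localization {F : Set (𝓧 → ℝ)} {h u : 𝓧 → ℝ} {μ : Measure 𝓧} {r ρ : ℝ}
    (hρ : 0 < ρ) (hr : ρ ≤ r) (hu : u ∈ localization μ F h r) :
    (ρ / r) • u ∈ localization μ F h ρ := by
  have hr0 : 0 < r := hρ.trans_le hr
  refine ⟨smul_mem_starZero hu.1 (by positivity) ((div_le_one hr0).2 hr), ?_⟩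
  rw [eLpNorm_const_smul, Real.enorm_eq_ofReal (by positivity)]
  refine (mul_le_mul' le_rfl hu.2).trans (le_of_eq ?_)
  rw [← ENNReal.ofReal_mul (by positivity), div_mul_cancel₀ _ hr0.ne']

variable {P : Measure (𝓧 × ℝ)} [IsProbabilityMeasure P]

/-- Passage from the lower integral of a supremum over the whole class, which need not be
measurable, to a real integral over a finite family. Only monotonicity of the lower integral is
used. The factor `c` admits families that belong to `A` after shrinking. -/
lemma signAvg_integral_iSup_le_of_rademacherSup_le [Finite K] [Nonempty K] {N : ℕ}
    {A : Set (𝓧 → ℝ)} {ξ : 𝓧 × ℝ → ℝ} {u : K → 𝓧 → ℝ} {c B : ℝ} (hc : 0 < c) (hB : 0 ≤ B)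
    (hu : ∀ k, c • u k ∈ A) (hi : ∀ k, Integrable (fun z => ξ z * u k z.1) P)
    (h : rademacherSup P N A ξ ≤ ENNReal.ofReal B) :
    (√(N : ℝ))⁻¹ * c * signAvg (fun ε : Fin N → ℤˣ => ∫ D : Fin N → 𝓧 × ℝ,
      ⨆ k, |∑ i, sgn (ε i) * (ξ (D i) * u k (D i).1)| ∂(Measure.pi fun _ => P)) ≤ B := by
  have hint : ∀ ε : Fin N → ℤˣ, Integrable (fun D : Fin N → 𝓧 × ℝ =>
      ⨆ k, |∑ i, sgn (ε i) * (ξ (D i) * u k (D i).1)|) (Measure.pi fun _ => P) := fun ε =>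
    integrable_iSup_fintype fun k => (integrable_sum_pi hi (fun i => sgn (ε i)) k).abs
  have h0 : ∀ ε : Fin N → ℤˣ, ∀ D : Fin N → 𝓧 × ℝ,
      0 ≤ ⨆ k, |∑ i, sgn (ε i) * (ξ (D i) * u k (D i).1)| := fun ε D =>
    Real.iSup_nonneg fun k => abs_nonneg _
  have hterm : ∀ ε : Fin N → ℤˣ, ENNReal.ofReal ((√(N : ℝ))⁻¹ * c * ∫ D : Fin N → 𝓧 × ℝ,
      ⨆ k, |∑ i, sgn (ε i) * (ξ (D i) * u k (D i).1)| ∂(Measure.pi fun _ => P)) ≤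
      ∫⁻ D, ⨆ v ∈ A, ENNReal.ofReal |(√(N : ℝ))⁻¹ * ∑ i, sgn (ε i) * (ξ (D i) * v (D i).1)|
        ∂(Measure.pi fun _ : Fin N => P) := fun ε => by
    rw [← integral_const_mul, ofReal_integral_eq_lintegral_ofReal ((hint ε).const_mul _)
      (Filter.Eventually.of_forall fun D => mul_nonneg (by positivity) (h0 ε D))]
    refine lintegral_mono fun D => ?_
    obtain ⟨k, hk⟩ := exists_eq_ciSup_of_finite
      (f := fun k => |∑ i, sgn (ε i) * (ξ (D i) * u k (D i).1)|)
    rw [← hk]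
    refine le_trans (le_of_eq ?_) (le_iSup₂ (f := fun (v : 𝓧 → ℝ) (_ : v ∈ A) =>
      ENNReal.ofReal |(√(N : ℝ))⁻¹ * ∑ i, sgn (ε i) * (ξ (D i) * v (D i).1)|) (c • u k) (hu k))
    congr 1
    rw [abs_mul, abs_of_nonneg (by positivity : (0 : ℝ) ≤ (√(N : ℝ))⁻¹), mul_assoc]
    congr 1
    rw [← abs_of_pos hc, ← abs_mul, Finset.mul_sum, abs_of_pos hc]
    congr 1
    refine Finset.sum_congr rfl fun i _ => ?_
    simp only [Pi.smul_apply, smul_eq_mul]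
    ring
  have h2 : ENNReal.ofReal ((√(N : ℝ))⁻¹ * c * signAvg (fun ε : Fin N → ℤˣ =>
      ∫ D : Fin N → 𝓧 × ℝ, ⨆ k, |∑ i, sgn (ε i) * (ξ (D i) * u k (D i).1)|
        ∂(Measure.pi fun _ => P))) ≤ ENNReal.ofReal B := by
    refine le_trans ?_ h
    rw [← signAvg_const_mul, signAvg, rademacherSup, sum_piFinset_sign,
      ENNReal.ofReal_mul (by positivity), ENNReal.ofReal_sum_of_nonneg fun ε _ =>
        mul_nonneg (by positivity) (integral_nonneg (h0 ε))]
    refine mul_le_mul' (le_of_eq ?_) (Finset.sum_le_sum fun ε _ => hterm ε)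
    rw [ENNReal.ofReal_inv_of_pos (by positivity), Fintype.card_fin,
      ENNReal.ofReal_pow (by norm_num)]
    norm_num
  exact (ENNReal.ofReal_le_ofReal_iff hB).1 h2

variable {F : Set (𝓧 → ℝ)} {h : 𝓧 → ℝ} {N : ℕ} {κ r : ℝ}

/-- Above the fixed point `r_E` the Rademacher averages of the localized class are controlled. -/
lemma signAvg_integral_iSup_le_of_rE_lt [Finite K] [Nonempty K] (hN : 0 < N) (hκ : 0 ≤ κ)
    (hr : rE P N F h κ < ENNReal.ofReal r) {u : K → 𝓧 → ℝ}
    (hu : ∀ k, u k ∈ localization (P.map Prod.fst) F h r)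
    (hi : ∀ k, Integrable (fun z : 𝓧 × ℝ => u k z.1) P) :
    signAvg (fun ε : Fin N → ℤˣ => ∫ D : Fin N → 𝓧 × ℝ,
      ⨆ k, |∑ i, sgn (ε i) * u k (D i).1| ∂(Measure.pi fun _ => P)) ≤ κ * N * r := by
  simp only [rE, iInf_lt_iff] at hr
  obtain ⟨ρ, hρ, hle, hlt⟩ := hr
  have hρr : ρ < r := (ENNReal.ofReal_lt_ofReal_iff' .. |>.1 hlt).1
  have hr0 := hρ.trans hρr
  have h1 := signAvg_integral_iSup_le_of_rademacherSup_le (div_pos hρ hr0)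
    (by positivity) (fun k => smul_mem_localization hρ hρr.le (hu k)) (by simpa using hi) hle
  simp only [one_mul] at h1
  have hN' : (0 : ℝ) < √N := Real.sqrt_pos.2 (by exact_mod_cast hN)
  have hNN : √(N : ℝ) * √N = N := Real.mul_self_sqrt (Nat.cast_nonneg N)
  rw [mul_assoc, inv_mul_le_iff₀ hN', div_mul_eq_mul_div, div_le_iff₀ hr0] at h1
  refine le_of_mul_le_mul_left (h1.trans (le_of_eq ?_)) hρ
  calc √(N : ℝ) * (κ * √N * ρ) * r = ρ * (κ * (√(N : ℝ) * √N) * r) := by ring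
    _ = ρ * (κ * N * r) := by rw [hNN]

/-- Above the fixed point `r̄_M` the multiplier Rademacher averages of the localized class are
controlled. -/
lemma signAvg_integral_iSup_le_of_rM_lt [Finite K] [Nonempty K] (hN : 0 < N) (hκ : 0 ≤ κ)
    (hr : rM P N F h κ < ENNReal.ofReal r) {u : K → 𝓧 → ℝ}
    (hu : ∀ k, u k ∈ localization (P.map Prod.fst) F h r)
    (hi : ∀ k, Integrable (fun z : 𝓧 × ℝ => (h z.1 - z.2) * u k z.1) P) :
    signAvg (fun ε : Fin N → ℤˣ => ∫ D : Fin N → 𝓧 × ℝ,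
      ⨆ k, |∑ i, sgn (ε i) * ((h (D i).1 - (D i).2) * u k (D i).1)| ∂(Measure.pi fun _ => P)) ≤
      κ * N * r ^ 2 := by
  simp only [rM, iInf_lt_iff] at hr
  obtain ⟨ρ, hρ, hle, hlt⟩ := hr
  have hρr : ρ < r := (ENNReal.ofReal_lt_ofReal_iff' .. |>.1 hlt).1
  have hr0 := hρ.trans hρr
  have h1 := signAvg_integral_iSup_le_of_rademacherSup_le (div_pos hρ hr0)
    (by positivity) (fun k => smul_mem_localization hρ hρr.le (hu k)) hi hle
  have hN' : (0 : ℝ) < √N := Real.sqrt_pos.2 (by exact_mod_cast hN)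
  have hNN : √(N : ℝ) * √N = N := Real.mul_self_sqrt (Nat.cast_nonneg N)
  rw [mul_assoc, inv_mul_le_iff₀ hN', div_mul_eq_mul_div, div_le_iff₀ hr0] at h1
  refine le_of_mul_le_mul_left (h1.trans ?_) hρ
  calc √(N : ℝ) * (κ * √N * ρ ^ 2) * r = ρ * (κ * (√(N : ℝ) * √N) * (ρ * r)) := by ring
    _ = ρ * (κ * N * (ρ * r)) := by rw [hNN]
    -- Rescaling turns ρ² into ρr rather than r²; ρ ≤ r closes the gap.
    _ ≤ ρ * (κ * N * r ^ 2) := by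
      refine mul_le_mul_of_nonneg_left (mul_le_mul_of_nonneg_left ?_ (by positivity)) hρ.le
      nlinarith

end Complexity

/-! ### Algebra of block means -/

section BlockMeans

variable {N : ℕ}

lemma blockMean_const_mul (m : ℕ) (c : ℝ) (v : Fin N → ℝ) (j : ℕ) :
    blockMean m (fun i => c * v i) j = c * blockMean m v j := by
  simp only [blockMean, ← Finset.mul_sum]; ring

lemma blockMean_add (m : ℕ) (v v' : Fin N → ℝ) (j : ℕ) :
    blockMean m (fun i => v i + v' i) j = blockMean m v j + blockMean m v' j := by
  simp only [blockMean, Finset.sum_add_distrib, mul_add]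

lemma tendsto_blockMean {v : ℕ → Fin N → ℝ} {v₀ : Fin N → ℝ} (m j : ℕ)
    (h : ∀ i, Filter.Tendsto (fun k => v k i) Filter.atTop (nhds (v₀ i))) :
    Filter.Tendsto (fun k => blockMean m (v k) j) Filter.atTop (nhds (blockMean m v₀ j)) :=
  (tendsto_finsetSum _ fun i _ => h i).const_mul _

lemma sq_blockMean_le {n m : ℕ} (h : n * m ≤ N) (hm : 0 < m) (v : Fin N → ℝ) (j : Fin n) :
    blockMean m v j ^ 2 ≤ blockMean m (fun i => v i ^ 2) j := by
  rw [blockMean_eq h, blockMean_eq h, mul_pow]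
  have h1 := sq_sum_le_card_mul_sum_sq (s := (Finset.univ : Finset (Fin m)))
    (f := fun i => v (blockIndex h (j, i)))
  rw [Finset.card_univ, Fintype.card_fin] at h1
  have hm' : (0 : ℝ) < m := by exact_mod_cast hm
  refine (mul_le_mul_of_nonneg_left h1 (by positivity)).trans (le_of_eq ?_)
  field_simp

end BlockMeans

/-! ### The tournament on the good event -/

section Tournament

variable {𝓧 : Type u} [MeasurableSpace 𝓧]

/-- What the analysis of the tournament uses of the class: the `L₁` and `L₂` norms of differences
are comparable, and the products of the noise with `f - fs` have a nonnegative mean and a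
controlled second moment. -/
structure TournamentSetup (a S σ : ℝ) (P : Measure (𝓧 × ℝ)) (F : Set (𝓧 → ℝ)) (fs : 𝓧 → ℝ) :
    Prop where
  measurable : ∀ f ∈ F, Measurable f
  pointwiseMeasurable : IsPointwiseMeasurableClass F
  memLp : ∀ f ∈ F, MemLp f 2 (P.map Prod.fst)
  mem : fs ∈ F
  l1_lower : ∀ f ∈ F, ∀ h ∈ F, a * l2norm P (fun z => f z.1 - h z.1) ≤ ∫ z, |f z.1 - h z.1| ∂P
  memLp_mul : ∀ f ∈ F, MemLp (fun z => (fs z.1 - z.2) * (f z.1 - fs z.1)) 2 P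
  sq_mul_le : ∀ f ∈ F, ∫ z, ((fs z.1 - z.2) * (f z.1 - fs z.1)) ^ 2 ∂P ≤
    (S * σ * l2norm P (fun z => f z.1 - fs z.1)) ^ 2
  integral_mul_nonneg : ∀ f ∈ F, 0 ≤ ∫ z, (fs z.1 - z.2) * (f z.1 - fs z.1) ∂P

/-- The function `g - fs`, scaled down to norm at most `r`. -/
noncomputable def scaledDiff (P : Measure (𝓧 × ℝ)) (r : ℝ) (fs g : 𝓧 → ℝ) : 𝓧 → ℝ :=
  fun x => scaleFactor P r (fun z => g z.1 - fs z.1) * (g x - fs x)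

section ScaledDiff

variable {P : Measure (𝓧 × ℝ)} {r : ℝ}

lemma l2norm_scaledDiff (hr : 0 < r) (fs g : 𝓧 → ℝ) :
    l2norm P (fun z => scaledDiff P r fs g z.1) =
      min (l2norm P fun z => g z.1 - fs z.1) r := by
  rw [← scaleFactor_mul_l2norm hr]
  exact l2norm_const_mul (scaleFactor_pos hr _).le _

lemma mul_scaledDiff (fs g : 𝓧 → ℝ) : (fun z : 𝓧 × ℝ => (fs z.1 - z.2) * scaledDiff P r fs g z.1) =
    fun z => scaleFactor P r (fun z => g z.1 - fs z.1) *
      ((fs z.1 - z.2) * (g z.1 - fs z.1)) := by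
  ext z; simp only [scaledDiff]; ring

lemma blockMean_abs_scaledDiff {N : ℕ} (hr : 0 < r) (fs g : 𝓧 → ℝ) (D : Fin N → 𝓧 × ℝ) (m j : ℕ) :
    blockMean m (fun i => |scaledDiff P r fs g (D i).1|) j =
      scaleFactor P r (fun z => g z.1 - fs z.1) *
        blockMean m (fun i => |fs (D i).1 - g (D i).1|) j := by
  rw [← blockMean_const_mul]
  congr 1
  ext i
  rw [scaledDiff, abs_mul, abs_of_pos (scaleFactor_pos hr _), abs_sub_comm]

/-- Expansion of (fs - Y)² - (g - Y)² around `fs`. With the factor t², t the scale factor, both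
terms are in the scaled difference u, the one linear in u keeping a spare factor t. -/
lemma blockLossDiff_eq {N : ℕ} (fs g : 𝓧 → ℝ) (D : Fin N → 𝓧 × ℝ) (n j : ℕ) :
    scaleFactor P r (fun z => g z.1 - fs z.1) ^ 2 * blockLossDiff n D fs g j =
      -(blockMean (N / n) (fun i => |scaledDiff P r fs g (D i).1| ^ 2) j +
        2 * scaleFactor P r (fun z => g z.1 - fs z.1) *
        blockMean (N / n) (fun i => (fs (D i).1 - (D i).2) * scaledDiff P r fs g (D i).1) j) := by
  rw [blockLossDiff, ← blockMean_const_mul, ← blockMean_const_mul, ← blockMean_add,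
    neg_eq_neg_one_mul,
    ← blockMean_const_mul]
  congr 1
  ext i
  rw [sq_abs, scaledDiff]
  ring

end ScaledDiff

namespace TournamentSetup

variable {a S σ r : ℝ} {P : Measure (𝓧 × ℝ)} {F : Set (𝓧 → ℝ)} {fs : 𝓧 → ℝ}
  (H : TournamentSetup a S σ P F fs)
include H

lemma memLp_sub {f h : 𝓧 → ℝ} (hf : f ∈ F) (hh : h ∈ F) :
    MemLp (fun z : 𝓧 × ℝ => f z.1 - h z.1) 2 P :=
  ((H.memLp f hf).sub (H.memLp h hh)).comp_measurePreserving (measurable_fst.measurePreserving P)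

lemma measurable_sub {f h : 𝓧 → ℝ} (hf : f ∈ F) (hh : h ∈ F) :
    Measurable (fun z : 𝓧 × ℝ => f z.1 - h z.1) :=
  ((H.measurable f hf).comp measurable_fst).sub ((H.measurable h hh).comp measurable_fst)

lemma eLpNorm_sub {f h : 𝓧 → ℝ} (hf : f ∈ F) (hh : h ∈ F) :
    eLpNorm (f - h) 2 (P.map Prod.fst) =
      ENNReal.ofReal (l2norm P fun z => f z.1 - h z.1) := by
  rw [← eLpNorm_two_eq (H.memLp_sub hf hh), eLpNorm_map_measure
    ((H.memLp f hf).sub (H.memLp h hh)).aestronglyMeasurable measurable_fst.aemeasurable]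
  rfl

lemma scaledDiff_mem_localization (hr : 0 < r) {g : 𝓧 → ℝ} (hg : g ∈ F) :
    scaledDiff P r fs g ∈ localization (P.map Prod.fst) F fs r := by
  have hs : scaledDiff P r fs g = scaleFactor P r (fun z => g z.1 - fs z.1) • (g - fs) := rfl
  refine ⟨⟨g - fs, ⟨g, hg, rfl⟩, _, (scaleFactor_pos hr _).le, scaleFactor_le_one hr _, hs⟩, ?_⟩
  rw [hs, eLpNorm_const_smul, Real.enorm_eq_ofReal (scaleFactor_pos hr _).le,
    H.eLpNorm_sub hg H.mem,
    ← ENNReal.ofReal_mul (scaleFactor_pos hr _).le, scaleFactor_mul_l2norm hr]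
  exact ENNReal.ofReal_le_ofReal (min_le_right _ _)

lemma memLp_scaledDiff {g : 𝓧 → ℝ} (hg : g ∈ F) :
    MemLp (fun z : 𝓧 × ℝ => scaledDiff P r fs g z.1) 2 P :=
  (H.memLp_sub hg H.mem).const_mul _

lemma measurable_scaledDiff {g : 𝓧 → ℝ} (hg : g ∈ F) :
    Measurable (fun z : 𝓧 × ℝ => scaledDiff P r fs g z.1) :=
  (H.measurable_sub hg H.mem).const_mul _

lemma le_integral_abs_scaledDiff (hr : 0 < r) {g : 𝓧 → ℝ} (hg : g ∈ F) :
    a * min (l2norm P fun z => g z.1 - fs z.1) r ≤ ∫ z, |scaledDiff P r fs g z.1| ∂P := by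
  simp only [scaledDiff, abs_mul]
  rw [integral_const_mul, abs_of_pos (scaleFactor_pos hr _), ← scaleFactor_mul_l2norm hr,
    mul_left_comm]
  exact mul_le_mul_of_nonneg_left (H.l1_lower g hg fs H.mem) (scaleFactor_pos hr _).le

lemma memLp_mul_scaledDiff {g : 𝓧 → ℝ} (hg : g ∈ F) :
    MemLp (fun z : 𝓧 × ℝ => (fs z.1 - z.2) * scaledDiff P r fs g z.1) 2 P := by
  rw [mul_scaledDiff]; exact (H.memLp_mul g hg).const_mul _

lemma measurable_mul_scaledDiff {g : 𝓧 → ℝ} (hg : g ∈ F) :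
    Measurable (fun z : 𝓧 × ℝ => (fs z.1 - z.2) * scaledDiff P r fs g z.1) :=
  (((H.measurable fs H.mem).comp measurable_fst).sub measurable_snd).mul
    (H.measurable_scaledDiff hg)

lemma integral_mul_scaledDiff_nonneg (hr : 0 < r) {g : 𝓧 → ℝ} (hg : g ∈ F) :
    0 ≤ ∫ z, (fs z.1 - z.2) * scaledDiff P r fs g z.1 ∂P := by
  rw [mul_scaledDiff, integral_const_mul]
  exact mul_nonneg (scaleFactor_pos hr _).le (H.integral_mul_nonneg g hg)

lemma integral_sq_mul_scaledDiff_le (hr : 0 < r) (hS : 0 ≤ S) (hσ : 0 ≤ σ) {g : 𝓧 → ℝ}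
    (hg : g ∈ F) :
    ∫ z, ((fs z.1 - z.2) * scaledDiff P r fs g z.1) ^ 2 ∂P ≤ (S * σ * r) ^ 2 := by
  have h1 : ∀ z : 𝓧 × ℝ, ((fs z.1 - z.2) * scaledDiff P r fs g z.1) ^ 2 =
      scaleFactor P r (fun z => g z.1 - fs z.1) ^ 2 *
      ((fs z.1 - z.2) * (g z.1 - fs z.1)) ^ 2 := fun z => by simp only [scaledDiff]; ring
  simp_rw [h1]
  rw [integral_const_mul]
  refine (mul_le_mul_of_nonneg_left (H.sq_mul_le g hg) (sq_nonneg _)).trans ?_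
  rw [← mul_pow, mul_left_comm, scaleFactor_mul_l2norm hr]
  exact pow_le_pow_left₀ (mul_nonneg (by positivity) (le_min (l2norm_nonneg _) hr.le))
    (mul_le_mul_of_nonneg_left (min_le_right _ _) (by positivity)) 2

lemma integral_abs_scaledDiff_le [IsProbabilityMeasure P] (hr : 0 < r) {g : 𝓧 → ℝ} (hg : g ∈ F) :
    ∫ z, |scaledDiff P r fs g z.1| ∂P ≤ r :=
  (integral_abs_le_l2norm (H.memLp_scaledDiff hg)).trans
    ((l2norm_scaledDiff hr fs g).trans_le (min_le_right _ _))

/-- Members of `F` are limits, pointwise and in `L₂` distance to `fs`, along the countable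
subclass. -/
lemma exists_approximation [IsProbabilityMeasure P]
    (ha : 0 < a) {gs : ℕ → 𝓧 → ℝ} (hgs : ∀ k, gs k ∈ F) {f : 𝓧 → ℝ}
    (hf : f ∈ F) (happ : ∃ g : ℕ → 𝓧 → ℝ, (∀ k, g k ∈ Set.range gs) ∧
      ∀ x, Filter.Tendsto (fun k => g k x) Filter.atTop (nhds (f x))) :
    ∃ φ : ℕ → ℕ, (∀ x, Filter.Tendsto (fun k => gs (φ k) x) Filter.atTop (nhds (f x))) ∧
      Filter.Tendsto (fun k => l2norm P fun z => gs (φ k) z.1 - fs z.1) Filter.atTop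
        (nhds (l2norm P fun z => f z.1 - fs z.1)) := by
  obtain ⟨g, hg, hlim⟩ := happ
  choose φ hφ using hg
  obtain rfl : (fun k => gs (φ k)) = g := funext hφ
  refine ⟨φ, hlim, ?_⟩
  -- The L₁-L₂ comparison takes the place of a dominating function here.
  have h0 : Filter.Tendsto (fun k => l2norm P fun z => gs (φ k) z.1 - f z.1) Filter.atTop
      (nhds 0) :=
    tendsto_l2norm_of_tendsto (fun k => H.measurable_sub (hgs _) hf)
      (fun k => H.memLp_sub (hgs _) hf) ha (fun k => H.l1_lower _ (hgs _) _ hf) fun z => by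
        simpa using (hlim z.1).sub_const (f z.1)
  rw [tendsto_iff_dist_tendsto_zero]
  refine squeeze_zero (fun _ => dist_nonneg) (fun k => ?_) h0
  rw [Real.dist_eq, abs_le]
  have h1 := l2norm_add_le (H.memLp_sub (hgs (φ k)) hf) (H.memLp_sub hf H.mem)
  have h2 := l2norm_add_le (H.memLp_sub hf (hgs (φ k))) (H.memLp_sub (hgs (φ k)) H.mem)
  have h3 : l2norm P (fun z => f z.1 - gs (φ k) z.1) =
      l2norm P fun z => gs (φ k) z.1 - f z.1 := by
    simp only [l2norm]; congr 2; ext z; ring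
  simp only [sub_add_sub_cancel] at h1 h2
  constructor <;> linarith

/-- The deviation bound for the block means of `|u|`. -/
lemma measure_abs_deviation_le [IsProbabilityMeasure P]
    {N n m : ℕ} {c₁ γ : ℝ} (h : n * m ≤ N) (h2 : N ≤ 2 * (n * m))
    (hn : 0 < n) (hm : 0 < m) (hr : 0 < r) (hc₁ : 0 ≤ c₁) (hγ : 0 < γ)
    (hrE : rE P N F fs c₁ < ENNReal.ofReal r) {gs : ℕ → 𝓧 → ℝ} (hgs : ∀ k, gs k ∈ F)
    (hsb : r / √m + 8 * c₁ * r ≤ γ / 20) :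
    (Measure.pi fun _ => P) {D : Fin N → 𝓧 × ℝ | ∃ k, (n : ℝ) / 10 <
      deviatingBlocks P n m (fun z => |scaledDiff P r fs (gs k) z.1|) γ D} ≤
      ENNReal.ofReal (Real.exp (-(n / 200))) := by
  have hN : 0 < N := (Nat.mul_pos hn hm).trans_le h
  have hi : ∀ k, Integrable (fun z : 𝓧 × ℝ => scaledDiff P r fs (gs k) z.1) P := fun k =>
    (H.memLp_scaledDiff (hgs k)).integrable one_le_two
  refine measure_exists_deviatingBlocks_le h hn hm
    (fun k => (H.measurable_scaledDiff (hgs k)).abs) (fun k => (H.memLp_scaledDiff (hgs k)).abs)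
    hr.le hγ (b := 2 * c₁ * r) (fun k => ?_) (fun M => ?_) (by linarith)
  · simp only [sq_abs]
    rw [← l2norm_sq, l2norm_scaledDiff hr]
    exact pow_le_pow_left₀ (le_min (l2norm_nonneg _) hr.le) (min_le_right _ _) 2
  · refine (rademacherAvg_abs_le fun k : Fin (M + 1) => hi k).trans
      ((rademacherAvg_le_of_injective (blockIndex_injective h) fun k : Fin (M + 1) => hi k).trans
      ((signAvg_integral_iSup_le_of_rE_lt hN hc₁ hrE (u := fun k : Fin (M + 1) =>
        scaledDiff P r fs (gs k)) (fun k => H.scaledDiff_mem_localization hr (hgs k))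
        fun k => hi k).trans ?_))
    -- The fixed point controls a sum over all N observations, the blocks cover at least half of
    -- them; hence b = 2c₁r.
    have h2' : (N : ℝ) ≤ 2 * (n * m) := by exact_mod_cast h2
    calc c₁ * N * r ≤ c₁ * (2 * (n * m)) * r := by gcongr
      _ = n * m * (2 * c₁ * r) := by ring

/-- The deviation bound for the block means of the multiplier process. -/
lemma measure_mul_deviation_le [IsProbabilityMeasure P]
    {N n m : ℕ} {c₁ γ : ℝ} (h : n * m ≤ N) (h2 : N ≤ 2 * (n * m))
    (hn : 0 < n) (hm : 0 < m) (hr : 0 < r) (hc₁ : 0 ≤ c₁) (hγ : 0 < γ) (hS : 0 ≤ S) (hσ : 0 ≤ σ)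
    (hrM : rM P N F fs c₁ < ENNReal.ofReal r) {gs : ℕ → 𝓧 → ℝ} (hgs : ∀ k, gs k ∈ F)
    (hsb : S * σ * r / √m + 8 * c₁ * r ^ 2 ≤ γ / 20) :
    (Measure.pi fun _ => P) {D : Fin N → 𝓧 × ℝ | ∃ k, (n : ℝ) / 10 <
      deviatingBlocks P n m (fun z => (fs z.1 - z.2) * scaledDiff P r fs (gs k) z.1) γ D} ≤
      ENNReal.ofReal (Real.exp (-(n / 200))) := by
  have hN : 0 < N := (Nat.mul_pos hn hm).trans_le h
  have hi : ∀ k, Integrable (fun z : 𝓧 × ℝ => (fs z.1 - z.2) * scaledDiff P r fs (gs k) z.1) P :=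
    fun k => (H.memLp_mul_scaledDiff (hgs k)).integrable one_le_two
  refine measure_exists_deviatingBlocks_le h hn hm
    (fun k => H.measurable_mul_scaledDiff (hgs k)) (fun k => H.memLp_mul_scaledDiff (hgs k))
    (s := S * σ * r) (by positivity) hγ (b := 2 * c₁ * r ^ 2)
    (fun k => H.integral_sq_mul_scaledDiff_le hr hS hσ (hgs k)) (fun M => ?_) (by linarith)
  refine (rademacherAvg_le_of_injective (blockIndex_injective h)
    fun k : Fin (M + 1) => hi k).trans
    ((signAvg_integral_iSup_le_of_rM_lt hN hc₁ hrM (u := fun k : Fin (M + 1) =>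
      scaledDiff P r fs (gs k)) (fun k => H.scaledDiff_mem_localization hr (hgs k))
      fun k => hi k).trans ?_)
  have h2' : (N : ℝ) ≤ 2 * (n * m) := by exact_mod_cast h2
  calc c₁ * N * r ^ 2 ≤ c₁ * (2 * (n * m)) * r ^ 2 := by gcongr
    _ = n * m * (2 * c₁ * r ^ 2) := by ring

/-- No scaling occurs at norm at most r, so E|u| ≤ r, and a deviation of ar/4 ≤ r/4 leads to 5r/4.
-/
lemma card_blockMean_gt_le [IsProbabilityMeasure P] {N k ℓ : ℕ} (ha1 : a ≤ 1) (hr : 0 < r)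
    {g : 𝓧 → ℝ} (hg : g ∈ F) (hgr : l2norm P (fun z => g z.1 - fs z.1) ≤ r) {D : Fin N → 𝓧 × ℝ}
    (hD : (deviatingBlocks P k ℓ (fun z => |scaledDiff P r fs g z.1|) (a * r / 4) D : ℝ) ≤ k / 10) :
    ((Finset.univ.filter fun j : Fin k =>
      5 / 4 * r < blockMean ℓ (fun i => |fs (D i).1 - g (D i).1|) j).card : ℝ) ≤ k / 10 := by
  refine le_trans ?_ hD
  refine Nat.cast_le.2 (Finset.card_le_card (Finset.monotone_filter_right _ fun j _ hj => ?_))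
  have h1 := blockMean_abs_scaledDiff (P := P) hr fs g D ℓ j
  rw [scaleFactor, if_pos hgr, one_mul] at h1
  rw [h1]
  have h2 := H.integral_abs_scaledDiff_le hr hg
  refine lt_of_lt_of_le ?_ (le_abs_self _)
  nlinarith

/-- Here E|u| ≥ ar, so a good block has mean of |u| at least 3ar/4. The scale factor is at most a/4,
and undoing it gives 3r. The negated form lets `card_filter_le_of_tendsto`, which counts
exceedances, serve for lower bounds. -/
lemma card_blockMean_lt_le {N k ℓ : ℕ} (ha : 0 < a) (ha1 : a ≤ 1) (hr : 0 < r) {g : 𝓧 → ℝ}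
    (hg : g ∈ F) (hgr : 4 / a * r ≤ l2norm P (fun z => g z.1 - fs z.1)) {D : Fin N → 𝓧 × ℝ}
    (hD : (deviatingBlocks P k ℓ (fun z => |scaledDiff P r fs g z.1|) (a * r / 4) D : ℝ) ≤ k / 10) :
    ((Finset.univ.filter fun j : Fin k =>
      -(3 * r) < -blockMean ℓ (fun i => |fs (D i).1 - g (D i).1|) j).card : ℝ) ≤ k / 10 := by
  refine le_trans ?_ hD
  refine Nat.cast_le.2 (Finset.card_le_card (Finset.monotone_filter_right _ fun j _ hj => ?_))
  have h1 := blockMean_abs_scaledDiff (P := P) hr fs g D ℓ j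
  set ρ := l2norm P (fun z => g z.1 - fs z.1) with hρ
  have h4a : 4 ≤ 4 / a := by rw [le_div_iff₀ ha]; linarith
  have hρr : r ≤ ρ := le_trans (by nlinarith) hgr
  have h2 := H.le_integral_abs_scaledDiff hr hg
  rw [← hρ, min_eq_right hρr] at h2
  have h3 := scaleFactor_mul_l2norm (P := P) hr (fun z => g z.1 - fs z.1)
  rw [← hρ, min_eq_right hρr] at h3
  have ht := scaleFactor_pos (P := P) hr (fun z => g z.1 - fs z.1)
  set t := scaleFactor P r (fun z => g z.1 - fs z.1)
  rw [h1]
  have h5 : t * (4 / a * r) ≤ r := (mul_le_mul_of_nonneg_left hgr ht.le).trans h3.le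
  have h6 : t * (4 / a) ≤ 1 := by
    rw [← mul_assoc] at h5
    exact le_of_mul_le_mul_right (by linarith) hr
  have h7 : t * 4 ≤ a := by
    rw [mul_div_assoc', div_le_one ha] at h6; exact h6
  have h8 : blockMean ℓ (fun i => |fs (D i).1 - g (D i).1|) j < 3 * r := neg_lt_neg_iff.1 hj
  have h9 := mul_lt_mul_of_pos_left h8 ht
  refine lt_of_lt_of_le ?_ (neg_le_abs _)
  nlinarith

/-- On a block good for both processes, the mean of |u| is at least ar/2 - ar/4, hence that of u² is
at least a²r²/16. The multiplier term costs at most 2t·a²r²/64 ≤ a²r²/32, where t ≤ 1 is the scale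
factor. Half of the quadratic gain remains, and dividing by t² only improves it. -/
lemma card_blockLossDiff_gt_le {N n : ℕ} (hn : 0 < n) (hnN : n ≤ N) (ha : 0 < a) (hr : 0 < r)
    {g : 𝓧 → ℝ} (hg : g ∈ F) (hgr : r / 2 ≤ l2norm P (fun z => g z.1 - fs z.1))
    {D : Fin N → 𝓧 × ℝ}
    (hD : (deviatingBlocks P n (N / n) (fun z => |scaledDiff P r fs g z.1|) (a * r / 4) D : ℝ)
      ≤ n / 10)
    (hD' : (deviatingBlocks P n (N / n) (fun z => (fs z.1 - z.2) * scaledDiff P r fs g z.1)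
      (a ^ 2 * r ^ 2 / 64) D : ℝ) ≤ n / 10) :
    ((Finset.univ.filter fun j : Fin n =>
      -(a ^ 2 * r ^ 2 / 32) < blockLossDiff n D fs g j).card : ℝ) ≤ n / 5 := by
  have hcard : ((Finset.univ.filter fun j : Fin n =>
      -(a ^ 2 * r ^ 2 / 32) < blockLossDiff n D fs g j).card : ℝ) ≤
      deviatingBlocks P n (N / n) (fun z => |scaledDiff P r fs g z.1|) (a * r / 4) D +
      deviatingBlocks P n (N / n) (fun z => (fs z.1 - z.2) * scaledDiff P r fs g z.1)
        (a ^ 2 * r ^ 2 / 64) D := by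
    unfold deviatingBlocks
    rw [← Nat.cast_add]
    refine Nat.cast_le.2 ((Finset.card_le_card fun j hj => ?_).trans (Finset.card_union_le _ _))
    rw [← Finset.filter_or, Finset.mem_filter]
    refine ⟨Finset.mem_univ _, ?_⟩
    by_contra! hcon
    have hj' := (Finset.mem_filter.1 hj).2
    have hE := H.le_integral_abs_scaledDiff hr hg
    have hmin : r / 2 ≤ min (l2norm P fun z => g z.1 - fs z.1) r := le_min hgr (by linarith)
    have hE' := (mul_le_mul_of_nonneg_left hmin ha.le).trans hE
    have hM := H.integral_mul_scaledDiff_nonneg hr hg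
    have h1 := (abs_le.1 hcon.1).1
    have h2 := (abs_le.1 hcon.2).1
    have h3 := sq_blockMean_le (Nat.mul_div_le N n) (Nat.div_pos hnN hn)
      (fun i => |scaledDiff P r fs g (D i).1|) j
    have h4 := blockLossDiff_eq (P := P) (r := r) fs g D n j
    have ht := scaleFactor_pos (P := P) hr (fun z => g z.1 - fs z.1)
    have ht1 := scaleFactor_le_one (P := P) hr (fun z => g z.1 - fs z.1)
    set t := scaleFactor P r (fun z => g z.1 - fs z.1)
    set A := blockMean (N / n) (fun i => |scaledDiff P r fs g (D i).1|) j
    set B := blockMean (N / n) (fun i => |scaledDiff P r fs g (D i).1| ^ 2) j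
    set C := blockMean (N / n) (fun i => (fs (D i).1 - (D i).2) * scaledDiff P r fs g (D i).1) j
    set V := blockLossDiff n D fs g j
    have hA : a * r / 4 ≤ A := by linarith
    have hB : a ^ 2 * r ^ 2 / 16 ≤ B := by
      refine le_trans ?_ h3
      calc a ^ 2 * r ^ 2 / 16 = (a * r / 4) ^ 2 := by ring
        _ ≤ A ^ 2 := pow_le_pow_left₀ (by positivity) hA 2
    have hC : -(a ^ 2 * r ^ 2 / 64) ≤ C := by linarith
    have h5 : t ^ 2 * -(a ^ 2 * r ^ 2 / 32) < t ^ 2 * V :=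
      mul_lt_mul_of_pos_left hj' (by positivity)
    have h6 : 2 * t * -(a ^ 2 * r ^ 2 / 64) ≤ 2 * t * C :=
      mul_le_mul_of_nonneg_left hC (by positivity)
    have h7 : 0 ≤ a ^ 2 * r ^ 2 / 32 := by positivity
    have h8 : t ^ 2 * (a ^ 2 * r ^ 2 / 32) ≤ 1 * (a ^ 2 * r ^ 2 / 32) :=
      mul_le_mul_of_nonneg_right (pow_le_one₀ ht.le ht1) h7
    have h9 : t * (a ^ 2 * r ^ 2 / 32) ≤ 1 * (a ^ 2 * r ^ 2 / 32) :=
      mul_le_mul_of_nonneg_right ht1 h7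
    linarith
  linarith

/-- On the event where the block means of the countable subclass deviate on few blocks, the
tournament behaves as claimed. -/
lemma mem_preliminaryRoundEvent [IsProbabilityMeasure P]
    {N ℓ n : ℕ} (hk : 0 < N / ℓ) (hn : 0 < n) (hnN : n ≤ N)
    (ha : 0 < a) (ha1 : a ≤ 1) (hr : 0 < r) {gs : ℕ → 𝓧 → ℝ} (hgs : ∀ k, gs k ∈ F)
    (happ : ∀ f ∈ F, ∃ g : ℕ → 𝓧 → ℝ, (∀ k, g k ∈ Set.range gs) ∧
      ∀ x, Filter.Tendsto (fun k => g k x) Filter.atTop (nhds (f x)))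
    {D : (Fin N → 𝓧 × ℝ) × (Fin N → 𝓧 × ℝ)}
    (hD₁ : ∀ k, (deviatingBlocks P (N / ℓ) ℓ (fun z => |scaledDiff P r fs (gs k) z.1|)
      (a * r / 4) D.1 : ℝ) ≤ (N / ℓ : ℕ) / 10)
    (hD₂ : ∀ k, (deviatingBlocks P n (N / n) (fun z => |scaledDiff P r fs (gs k) z.1|)
      (a * r / 4) D.2 : ℝ) ≤ n / 10)
    (hD₃ : ∀ k, (deviatingBlocks P n (N / n)
      (fun z => (fs z.1 - z.2) * scaledDiff P r fs (gs k) z.1)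
      (a ^ 2 * r ^ 2 / 64) D.2 : ℝ) ≤ n / 10) :
    D ∈ preliminaryRoundEvent P F fs N ℓ n (a / 2) 2 r := by
  have hk' : (0 : ℝ) < (N / ℓ : ℕ) := by exact_mod_cast hk
  have hn' : (0 : ℝ) < n := by exact_mod_cast hn
  -- Functions closer than r play no match: 5r/4 for the approximants becomes 3r/2 in the limit,
  -- still below 2r.
  have hfar : ∀ f ∈ F, MatchAllowed ℓ 2 r D.1 fs f →
      r ≤ l2norm P fun z => f z.1 - fs z.1 := fun f hf hmatch => by
    by_contra! hlt
    obtain ⟨φ, hφ, hφn⟩ := H.exists_approximation ha hgs hf (happ f hf)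
    have hev : ∀ᶠ k in Filter.atTop, ((Finset.univ.filter fun j : Fin (N / ℓ) =>
        5 / 4 * r < blockMean ℓ (fun i => |fs (D.1 i).1 - gs (φ k) (D.1 i).1|) j).card : ℝ) ≤
        (N / ℓ : ℕ) / 10 := by
      filter_upwards [hφn.eventually (gt_mem_nhds hlt)] with k hk
      exact H.card_blockMean_gt_le ha1 hr (hgs _) hk.le (hD₁ _)
    have hlim := card_filter_le_of_tendsto (c' := 3 / 2 * r)
      (fun j : Fin (N / ℓ) => tendsto_blockMean ℓ j fun i =>
        ((hφ (D.1 i).1).const_sub (fs (D.1 i).1)).abs) (by linarith) hev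
    have hmed : distFunctional ℓ D.1 fs f ≤ 3 / 2 * r := by
      refine smallestMedian_le _ ?_
      have h1 := (Nat.cast_le (α := ℝ)).2 (Finset.card_le_card (Finset.monotone_filter_right
        (Finset.univ : Finset (Fin (N / ℓ))) fun j _
          (hj : 3 / 2 * r < blockMean ℓ (fun i => |fs (D.1 i).1 - f (D.1 i).1|) j) => hj.le))
      have h2 := h1.trans hlim
      rw [← Nat.cast_lt (α := ℝ)]
      push_cast at h2 ⊢
      linarith
    have : 2 * r ≤ distFunctional ℓ D.1 fs f := hmatch
    linarith
  -- Functions beyond 4r/a do play: the level 3r for the approximants leaves room to conclude 2r in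
  -- the limit.
  have hnear : ∀ f ∈ F, ¬ MatchAllowed ℓ 2 r D.1 fs f →
      l2norm P (fun z => f z.1 - fs z.1) ≤ 4 / a * r := fun f hf hmatch => by
    by_contra! hlt
    apply hmatch
    obtain ⟨φ, hφ, hφn⟩ := H.exists_approximation ha hgs hf (happ f hf)
    have hev : ∀ᶠ k in Filter.atTop, ((Finset.univ.filter fun j : Fin (N / ℓ) =>
        -(3 * r) < -blockMean ℓ (fun i => |fs (D.1 i).1 - gs (φ k) (D.1 i).1|) j).card : ℝ) ≤
        (N / ℓ : ℕ) / 10 := by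
      filter_upwards [hφn.eventually (lt_mem_nhds hlt)] with k hk
      exact H.card_blockMean_lt_le ha ha1 hr (hgs _) hk.le (hD₁ _)
    have hlim := card_filter_le_of_tendsto (c' := -(2 * r))
      (fun j : Fin (N / ℓ) => (tendsto_blockMean ℓ j fun i =>
        ((hφ (D.1 i).1).const_sub (fs (D.1 i).1)).abs).neg) (by linarith) hev
    refine le_smallestMedian _ ?_
    simp only [neg_le_neg_iff] at hlim
    rw [← Nat.cast_lt (α := ℝ)]
    push_cast
    linarith
  have hwin : ∀ f ∈ F, MatchAllowed ℓ 2 r D.1 fs f → Defeats ℓ n 2 r D.1 D.2 fs f :=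
    fun f hf hmatch => by
      refine ⟨hmatch, ?_⟩
      have hf_far := hfar f hf hmatch
      obtain ⟨φ, hφ, hφn⟩ := H.exists_approximation ha hgs hf (happ f hf)
      -- The approximants may be slightly closer than r; the counting lemma asks only for r/2. Its
      -- margin a²r²/32 is then spent to obtain level 0 in the limit.
      have hev : ∀ᶠ k in Filter.atTop, ((Finset.univ.filter fun j : Fin n =>
          -(a ^ 2 * r ^ 2 / 32) < blockLossDiff n D.2 fs (gs (φ k)) j).card : ℝ) ≤ n / 5 := by
        filter_upwards [hφn.eventually
          (lt_mem_nhds (lt_of_lt_of_le (show r / 2 < r by linarith) hf_far))] with k hk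
        exact H.card_blockLossDiff_gt_le hn hnN ha hr (hgs _) hk.le (hD₂ _) (hD₃ _)
      have hpos : 0 < a ^ 2 * r ^ 2 / 32 := by positivity
      have hlim := card_filter_le_of_tendsto (c' := 0) (y₀ := fun j : Fin n =>
          blockLossDiff n D.2 fs f j)
        (fun j : Fin n => tendsto_blockMean (N / n) j fun i =>
          (((hφ (D.2 i).1).sub_const (D.2 i).2).pow 2).const_sub _) (by linarith) hev
      have hsplit := Finset.card_filter_add_card_filter_not (s := (Finset.univ : Finset (Fin n)))
        (fun j => blockLossDiff n D.2 fs f j < 0)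
      simp only [not_lt, Finset.card_univ, Fintype.card_fin] at hsplit
      have hsplit' : ((Finset.univ.filter fun j : Fin n => blockLossDiff n D.2 fs f j < 0).card : ℝ)
        + ((Finset.univ.filter fun j : Fin n => 0 ≤ blockLossDiff n D.2 fs f j).card : ℝ) = n := by
        exact_mod_cast hsplit
      rw [← Nat.cast_lt (α := ℝ)]
      push_cast
      linarith
  have hsymm : ∀ f, MatchAllowed ℓ 2 r D.1 f fs → MatchAllowed ℓ 2 r D.1 fs f := fun f h => by
    unfold MatchAllowed distFunctional at h ⊢
    simpa only [abs_sub_comm] using h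
  refine ⟨hwin, ⟨H.mem, fun f hf hdef => ?_⟩, fun f hf => ?_⟩
  · have h1 := (hwin f hf (hsymm f hdef.1)).2
    have h2 := hdef.2
    have hneg : ∀ j : ℕ, blockLossDiff n D.2 f fs j = -blockLossDiff n D.2 fs f j := fun j => by
      rw [blockLossDiff, blockLossDiff, neg_eq_neg_one_mul, ← blockMean_const_mul]
      congr 1
      ext i
      ring
    -- Swapping the players negates the loss difference, so both cannot win more than half of the
    -- blocks.
    have hdisj : Disjoint (Finset.univ.filter fun j : Fin n => blockLossDiff n D.2 fs f j < 0)
        (Finset.univ.filter fun j : Fin n => blockLossDiff n D.2 f fs j < 0) := by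
      rw [Finset.disjoint_filter]
      intro j _ hj hj'
      rw [hneg] at hj'
      linarith
    have h3 := Finset.card_le_univ (Finset.disjUnion _ _ hdisj)
    rw [Finset.card_disjUnion, Fintype.card_fin] at h3
    omega
  · have hno : ¬ MatchAllowed ℓ 2 r D.1 fs f := fun hm => hf.2 fs H.mem (hwin f hf.1 hm)
    refine ⟨hno, ?_⟩
    rw [H.eLpNorm_sub hf.1 H.mem]
    refine ENNReal.ofReal_le_ofReal ((hnear f hf.1 hno).trans (le_of_eq ?_))
    field_simp
    norm_num

end TournamentSetup

end Tournament

/-! ### Convex classes and independent noise -/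

section Settings

variable {𝓧 : Type u} [MeasurableSpace 𝓧] {P : Measure (𝓧 × ℝ)}
  {F : Set (𝓧 → ℝ)} {fs : 𝓧 → ℝ}

namespace LearningProblem

variable (H : LearningProblem P F fs)
include H

lemma memLp_sub {f h : 𝓧 → ℝ} (hf : f ∈ F) (hh : h ∈ F) :
    MemLp (fun z : 𝓧 × ℝ => f z.1 - h z.1) 2 P :=
  ((H.memLp f hf).sub (H.memLp h hh)).comp_measurePreserving (measurable_fst.measurePreserving P)

lemma memLp_noise {f : 𝓧 → ℝ} (hf : f ∈ F) : MemLp (fun z : 𝓧 × ℝ => f z.1 - z.2) 2 P :=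
  ((H.memLp f hf).comp_measurePreserving (measurable_fst.measurePreserving P)).sub H.memLp_target

lemma eLpNorm_sub_comp {f h : 𝓧 → ℝ} (hf : f ∈ F) (hh : h ∈ F) (p : ℝ≥0∞) :
    eLpNorm (fun z : 𝓧 × ℝ => f z.1 - h z.1) p P = eLpNorm (f - h) p (P.map Prod.fst) := by
  rw [eLpNorm_map_measure ((H.memLp f hf).sub (H.memLp h hh)).aestronglyMeasurable
    measurable_fst.aemeasurable]
  rfl

lemma l1_lower [IsProbabilityMeasure P]
    {q L : ℝ} (hq : 2 < q) (hL : 1 ≤ L) {f h : 𝓧 → ℝ} (hf : f ∈ F) (hh : h ∈ F)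
    (hfh : eLpNorm (f - h) (ENNReal.ofReal q) (P.map Prod.fst) ≤
      ENNReal.ofReal L * eLpNorm (f - h) 2 (P.map Prod.fst)) :
    l1Ratio q L * l2norm P (fun z => f z.1 - h z.1) ≤ ∫ z, |f z.1 - h z.1| ∂P := by
  refine l1Ratio_mul_l2norm_le hq hL (H.memLp_sub hf hh) ?_
  rwa [H.eLpNorm_sub_comp hf hh, H.eLpNorm_sub_comp hf hh]

/-- The first-order condition for the minimizer over a convex class. -/
lemma integral_mul_nonneg_of_convex [IsProbabilityMeasure P]
    (hF : Convex ℝ F) {f : 𝓧 → ℝ} (hf : f ∈ F) :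
    0 ≤ ∫ z, (fs z.1 - z.2) * (f z.1 - fs z.1) ∂P := by
  have hfs := H.minimizer.1
  have hξ := H.memLp_noise hfs
  have hw := H.memLp_sub hf hfs
  have hm : Integrable (fun z : 𝓧 × ℝ => (fs z.1 - z.2) * (f z.1 - fs z.1)) P :=
    hξ.integrable_mul hw
  set B := ∫ z, (fs z.1 - z.2) * (f z.1 - fs z.1) ∂P with hB
  set C := ∫ z, (f z.1 - fs z.1) ^ 2 ∂P with hC
  have hC0 : 0 ≤ C := integral_nonneg fun _ => sq_nonneg _
  -- The risk at (1-t)fs + tf exceeds the minimal risk by t(2B + tC).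
  have key : ∀ t : ℝ, 0 < t → t ≤ 1 → 0 ≤ 2 * B + t * C := fun t ht ht1 => by
    have hmem : (1 - t) • fs + t • f ∈ F :=
      hF hfs hf (by linarith) ht.le (by ring)
    have h1 := H.minimizer.2 _ hmem
    have h2 : ∀ z : 𝓧 × ℝ, (((1 - t) • fs + t • f) z.1 - z.2) ^ 2 = (fs z.1 - z.2) ^ 2 +
        (2 * t * ((fs z.1 - z.2) * (f z.1 - fs z.1)) + t ^ 2 * (f z.1 - fs z.1) ^ 2) :=
      fun z => by
        simp only [Pi.add_apply, Pi.smul_apply, smul_eq_mul]; ring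
    have hi : Integrable (fun z : 𝓧 × ℝ => 2 * t * ((fs z.1 - z.2) * (f z.1 - fs z.1)) +
        t ^ 2 * (f z.1 - fs z.1) ^ 2) P :=
      (hm.const_mul _).add (hw.integrable_sq.const_mul _)
    simp_rw [h2] at h1
    rw [integral_add hξ.integrable_sq hi, integral_add (hm.const_mul _)
      (hw.integrable_sq.const_mul _), integral_const_mul, integral_const_mul] at h1
    have h3 : 0 ≤ t * (2 * B + t * C) := by nlinarith
    exact nonneg_of_mul_nonneg_right h3 ht
  by_contra! hneg
  -- For this t, tC ≤ -B, so B < 0 would give 2B + tC ≤ B < 0. The added 1 avoids division by zero.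
  have h1 := key (min 1 (-B / (C + 1))) (lt_min one_pos (div_pos (by linarith) (by linarith)))
    (min_le_left _ _)
  have h2 : min 1 (-B / (C + 1)) * C ≤ -B / (C + 1) * C :=
    mul_le_mul_of_nonneg_right (min_le_right _ _) hC0
  have h3 : -B / (C + 1) * C ≤ -B := by
    rw [div_mul_eq_mul_div, div_le_iff₀ (by linarith)]
    nlinarith
  linarith

end LearningProblem

/-- Hölder with exponents 4 and 4 and both norm equivalences give ‖ξw‖₂ ≤ L²σ‖w‖₂, whence S = L².
The sign of the linear term is the first-order condition. -/
lemma ConvexSetting.tournamentSetup [IsProbabilityMeasure P] {L σ : ℝ} (hL : 1 ≤ L) (hσ : 0 ≤ σ)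
    (H : ConvexSetting L σ P F fs) : TournamentSetup (l1Ratio 4 L) (L ^ 2) σ P F fs := by
  have HL := H.toLearningProblem
  have hfs := HL.minimizer.1
  have h4 : ENNReal.ofReal 4 = 4 := by norm_num
  have hbound : ∀ f ∈ F, eLpNorm (fun z : 𝓧 × ℝ => (fs z.1 - z.2) * (f z.1 - fs z.1)) 2 P ≤
      ENNReal.ofReal (L ^ 2 * σ * l2norm P fun z => f z.1 - fs z.1) := fun f hf => by
    have hw := HL.memLp_sub hf hfs
    have hξ := HL.memLp_noise hfs
    have h1 := eLpNorm_smul_le_mul_eLpNorm (p := 4) (q := 4) (r := 2)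
      hw.aestronglyMeasurable hξ.aestronglyMeasurable
      (hpqr := ⟨by
        rw [← ENNReal.toReal_eq_toReal_iff' (by finiteness) (by finiteness)]
        rw [ENNReal.toReal_add (by finiteness) (by finiteness)]
        norm_num⟩)
    have h2 : eLpNorm (fun z : 𝓧 × ℝ => f z.1 - fs z.1) 4 P ≤
        ENNReal.ofReal L * ENNReal.ofReal (l2norm P fun z => f z.1 - fs z.1) := by
      rw [← eLpNorm_two_eq hw, HL.eLpNorm_sub_comp hf hfs, HL.eLpNorm_sub_comp hf hfs]
      exact H.norm_sub f hf fs hfs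
    have h3 := (H.norm_noise fs hfs).trans (mul_le_mul' le_rfl H.noise_le)
    refine (h1.trans (mul_le_mul' h3 h2)).trans (le_of_eq ?_)
    have hL0 : 0 ≤ L := by linarith
    rw [← ENNReal.ofReal_mul hL0, ← ENNReal.ofReal_mul hL0, ← ENNReal.ofReal_mul (by positivity)]
    congr 1
    ring
  have hmem : ∀ f ∈ F, MemLp (fun z : 𝓧 × ℝ => (fs z.1 - z.2) * (f z.1 - fs z.1)) 2 P :=
    fun f hf => ⟨(HL.memLp_noise hfs).aestronglyMeasurable.mul
      (HL.memLp_sub hf hfs).aestronglyMeasurable, (hbound f hf).trans_lt ENNReal.ofReal_lt_top⟩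
  refine ⟨HL.measurable, HL.pointwiseMeasurable, HL.memLp, hfs, fun f hf h hh => ?_, hmem,
    fun f hf => ?_, fun f hf => HL.integral_mul_nonneg_of_convex H.convex hf⟩
  · refine HL.l1_lower (by norm_num) hL hf hh ?_
    rw [h4]
    exact H.norm_sub f hf h hh
  · have h1 := hbound f hf
    have h0 : 0 ≤ L ^ 2 * σ * l2norm P fun z => f z.1 - fs z.1 :=
      mul_nonneg (by positivity) (l2norm_nonneg _)
    rw [eLpNorm_two_eq (hmem f hf), ENNReal.ofReal_le_ofReal_iff h0] at h1
    rw [← l2norm_sq]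
    exact pow_le_pow_left₀ (l2norm_nonneg _) h1 2

/-- The noise W is centred and independent of X, so cross terms vanish and the risk of `fs` is that
of f₀ plus E(fs - f₀)². Hence `fs` = f₀ almost surely and ξ = -W. Independence then factors the
second moment of the product, which gives S = 1, and makes its mean zero. -/
lemma IndependentNoiseSetting.tournamentSetup [IsProbabilityMeasure P]
    {q L σ : ℝ} (hq : 2 < q) (hL : 1 ≤ L) (hσ : 0 ≤ σ)
    (H : IndependentNoiseSetting q L σ P F fs) : TournamentSetup (l1Ratio q L) 1 σ P F fs := by
  have HL := H.toLearningProblem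
  have hfs := HL.minimizer.1
  obtain ⟨f₀, hf₀, hind, hmean, hσW⟩ := H.noise
  set W : 𝓧 × ℝ → ℝ := fun z => z.2 - f₀ z.1 with hW
  have hWL : MemLp W 2 P := by
    have := (HL.memLp_noise hf₀).neg
    convert this using 1
    ext z; simp [hW]
  have hWσ : ∫ z, W z ^ 2 ∂P ≤ σ ^ 2 := by
    rw [eLpNorm_two_eq hWL, ENNReal.ofReal_le_ofReal_iff hσ] at hσW
    rw [← l2norm_sq]
    exact pow_le_pow_left₀ (l2norm_nonneg _) hσW 2
  have hindF : ∀ f ∈ F, ∀ h ∈ F, IndepFun (fun z : 𝓧 × ℝ => f z.1 - h z.1) W P :=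
    fun f hf h hh => (hind.comp measurable_id
      ((HL.measurable f hf).sub (HL.measurable h hh))).symm
  have hprod0 : ∀ f ∈ F, ∀ h ∈ F, ∫ z, (f z.1 - h z.1) * W z ∂P = 0 := fun f hf h hh => by
    rw [(hindF f hf h hh).integral_fun_mul_eq_mul_integral
      (HL.memLp_sub hf hh).aestronglyMeasurable hWL.aestronglyMeasurable, hmean, mul_zero]
  have hae : ∀ᵐ z ∂P, fs z.1 - f₀ z.1 = 0 := by
    have hw := HL.memLp_sub hfs hf₀
    have hm : Integrable (fun z : 𝓧 × ℝ => (fs z.1 - f₀ z.1) * W z) P := hw.integrable_mul hWL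
    have h1 := HL.minimizer.2 f₀ hf₀
    have h2 : ∀ z : 𝓧 × ℝ, (fs z.1 - z.2) ^ 2 = (f₀ z.1 - z.2) ^ 2 +
        ((fs z.1 - f₀ z.1) ^ 2 + (-2) * ((fs z.1 - f₀ z.1) * W z)) := fun z => by
      simp only [hW]; ring
    have hi : Integrable (fun z : 𝓧 × ℝ => (fs z.1 - f₀ z.1) ^ 2 +
        (-2) * ((fs z.1 - f₀ z.1) * W z)) P := hw.integrable_sq.add (hm.const_mul _)
    simp_rw [h2] at h1
    rw [integral_add (HL.memLp_noise hf₀).integrable_sq hi, integral_add hw.integrable_sq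
      (hm.const_mul _), integral_const_mul, hprod0 fs hfs f₀ hf₀] at h1
    have h3 : ∫ z, (fs z.1 - f₀ z.1) ^ 2 ∂P = 0 :=
      le_antisymm (by linarith) (integral_nonneg fun _ => sq_nonneg _)
    rw [integral_eq_zero_iff_of_nonneg (fun _ => sq_nonneg _) hw.integrable_sq] at h3
    filter_upwards [h3] with z hz
    exact pow_eq_zero_iff two_ne_zero |>.1 hz
  have hmulae : ∀ f : 𝓧 → ℝ, (fun z : 𝓧 × ℝ => (fs z.1 - z.2) * (f z.1 - fs z.1)) =ᵐ[P]
      fun z => -((f z.1 - fs z.1) * W z) := fun f => by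
    filter_upwards [hae] with z hz
    simp only [hW]
    have : fs z.1 = f₀ z.1 := by linarith
    rw [this]; ring
  have hindsq : ∀ f ∈ F, IndepFun (fun z : 𝓧 × ℝ => (f z.1 - fs z.1) ^ 2) (fun z => W z ^ 2) P :=
    fun f hf => (hindF f hf fs hfs).comp (measurable_id.pow_const 2) (measurable_id.pow_const 2)
  have hmem : ∀ f ∈ F, MemLp (fun z : 𝓧 × ℝ => (f z.1 - fs z.1) * W z) 2 P := fun f hf => by
    have hw := HL.memLp_sub hf hfs
    refine (memLp_two_iff_integrable_sq
      (hw.aestronglyMeasurable.mul hWL.aestronglyMeasurable)).2 ?_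
    simp_rw [Pi.mul_apply]
    simp_rw [mul_pow]
    exact (hindsq f hf).integrable_mul hw.integrable_sq hWL.integrable_sq
  refine ⟨HL.measurable, HL.pointwiseMeasurable, HL.memLp, hfs, fun f hf h hh => ?_,
    fun f hf => (memLp_congr_ae (hmulae f)).2 (hmem f hf).neg, fun f hf => ?_, fun f hf => ?_⟩
  · exact HL.l1_lower hq hL hf hh
      (H.norm_span _ (Submodule.sub_mem _ (Submodule.subset_span hf) (Submodule.subset_span hh)))
  · have hw := HL.memLp_sub hf hfs
    have h1 : ∫ z, ((fs z.1 - z.2) * (f z.1 - fs z.1)) ^ 2 ∂P =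
        ∫ z, (f z.1 - fs z.1) ^ 2 * W z ^ 2 ∂P := by
      refine integral_congr_ae ?_
      filter_upwards [hmulae f] with z hz
      rw [hz]; ring
    rw [h1, (hindsq f hf).integral_fun_mul_eq_mul_integral hw.integrable_sq.aestronglyMeasurable
      hWL.integrable_sq.aestronglyMeasurable, ← l2norm_sq, one_mul, mul_pow, mul_comm]
    exact mul_le_mul_of_nonneg_right hWσ (sq_nonneg _)
  · rw [integral_congr_ae (hmulae f), integral_neg, hprod0 f hf fs hfs, neg_zero]

end Settings

/-! ### Union bound and choice of constants -/

section Constants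

variable {𝓧 : Type u} [MeasurableSpace 𝓧]

/-- The event of the tournament contains a measurable event of large probability as soon as the
block lengths are large and the fixed points are small. -/
lemma TournamentSetup.holdsWithProb {a S σ r c₁ : ℝ} {P : Measure (𝓧 × ℝ)}
    [IsProbabilityMeasure P] {F : Set (𝓧 → ℝ)} {fs : 𝓧 → ℝ} (H : TournamentSetup a S σ P F fs)
    {N ℓ n : ℕ} (hℓ : 0 < ℓ) (hk : 0 < N / ℓ) (hn : 0 < n) (hnN : n ≤ N) (ha : 0 < a) (ha1 : a ≤ 1)
    (hr : 0 < r) (hS : 0 ≤ S) (hσ : 0 ≤ σ) (hc₁ : 0 ≤ c₁)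
    (hrE : rE P N F fs c₁ < ENNReal.ofReal r) (hrM : rM P N F fs c₁ < ENNReal.ofReal r)
    (h₁ : r / √ℓ + 8 * c₁ * r ≤ a * r / 4 / 20)
    (h₂ : r / √(N / n : ℕ) + 8 * c₁ * r ≤ a * r / 4 / 20)
    (h₃ : S * σ * r / √(N / n : ℕ) + 8 * c₁ * r ^ 2 ≤ a ^ 2 * r ^ 2 / 64 / 20) {p : ℝ}
    (hp : Real.exp (-((N / ℓ : ℕ) / 200)) + (Real.exp (-(n / 200)) + Real.exp (-(n / 200))) ≤ p) :
    HoldsWithProb (sampleLaw P N) (1 - p) (preliminaryRoundEvent P F fs N ℓ n (a / 2) 2 r) := by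
  obtain ⟨G, hGF, hGc, hG⟩ := H.pointwiseMeasurable
  have hGne : G.Nonempty := by
    obtain ⟨g, hg, -⟩ := hG fs H.mem
    exact ⟨g 0, hg 0⟩
  obtain ⟨gs, rfl⟩ := hGc.exists_eq_range hGne
  have hgs : ∀ k, gs k ∈ F := fun k => hGF ⟨k, rfl⟩
  have hm : 0 < N / n := Nat.div_pos hnN hn
  have hkN : N / ℓ * ℓ ≤ N := Nat.div_mul_le_self N ℓ
  have hkN2 : N ≤ 2 * (N / ℓ * ℓ) := by
    have h1 := Nat.div_add_mod' N ℓ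
    have h2 := Nat.mod_lt N hℓ
    have h3 : ℓ ≤ N / ℓ * ℓ := Nat.le_mul_of_pos_left ℓ hk
    omega
  have hnmN : n * (N / n) ≤ N := Nat.mul_div_le N n
  have hnmN2 : N ≤ 2 * (n * (N / n)) := by
    have h1 := Nat.div_add_mod N n
    have h2 := Nat.mod_lt N hn
    have h3 : n ≤ n * (N / n) := Nat.le_mul_of_pos_right n hm
    omega
  set B₁ : Set (Fin N → 𝓧 × ℝ) := {D | ∃ k, ((N / ℓ : ℕ) : ℝ) / 10 <
    deviatingBlocks P (N / ℓ) ℓ (fun z => |scaledDiff P r fs (gs k) z.1|) (a * r / 4) D} with hB₁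
  set B₂ : Set (Fin N → 𝓧 × ℝ) := {D | ∃ k, (n : ℝ) / 10 <
    deviatingBlocks P n (N / n) (fun z => |scaledDiff P r fs (gs k) z.1|) (a * r / 4) D} with hB₂
  set B₃ : Set (Fin N → 𝓧 × ℝ) := {D | ∃ k, (n : ℝ) / 10 <
    deviatingBlocks P n (N / n) (fun z => (fs z.1 - z.2) * scaledDiff P r fs (gs k) z.1)
      (a ^ 2 * r ^ 2 / 64) D} with hB₃
  have m₁ : MeasurableSet B₁ := measurableSet_deviatingBlocks hkN hℓ
    (fun k => (H.measurable_scaledDiff (hgs k)).abs) _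
  have m₂ : MeasurableSet B₂ := measurableSet_deviatingBlocks hnmN hm
    (fun k => (H.measurable_scaledDiff (hgs k)).abs) _
  have m₃ : MeasurableSet B₃ := measurableSet_deviatingBlocks hnmN hm
    (fun k => H.measurable_mul_scaledDiff (hgs k)) _
  have p₁ := H.measure_abs_deviation_le hkN hkN2 hk hℓ hr hc₁ (by positivity) hrE hgs h₁
  have p₂ := H.measure_abs_deviation_le hnmN hnmN2 hn hm hr hc₁ (by positivity) hrE hgs h₂
  have p₃ := H.measure_mul_deviation_le hnmN hnmN2 hn hm hr hc₁ (by positivity) hS hσ hrM hgs h₃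
  rw [← hB₁] at p₁
  rw [← hB₂] at p₂
  rw [← hB₃] at p₃
  have hQ : IsProbabilityMeasure (sampleLaw P N) := by unfold sampleLaw; infer_instance
  -- The bad events involve only the countable subclass, so they are measurable and the complement
  -- of their union is the required witness.
  set A : Set ((Fin N → 𝓧 × ℝ) × (Fin N → 𝓧 × ℝ)) :=
    B₁ ×ˢ Set.univ ∪ Set.univ ×ˢ (B₂ ∪ B₃) with hA
  have mA : MeasurableSet A :=
    (m₁.prod MeasurableSet.univ).union (MeasurableSet.univ.prod (m₂.union m₃))
  refine ⟨Aᶜ, fun D hD => ?_, mA.compl, ?_⟩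
  · have hD' : D.1 ∉ B₁ ∧ D.2 ∉ B₂ ∧ D.2 ∉ B₃ := by
      simpa [hA, not_or] using hD
    refine H.mem_preliminaryRoundEvent hk hn hnN ha ha1 hr hgs hG (fun k => ?_) (fun k => ?_)
      fun k => ?_
    · exact not_lt.1 fun h => hD'.1 ⟨k, h⟩
    · exact not_lt.1 fun h => hD'.2.1 ⟨k, h⟩
    · exact not_lt.1 fun h => hD'.2.2 ⟨k, h⟩
  · rw [prob_compl_eq_one_sub mA]
    have hp0 : 0 ≤ p := le_trans (by positivity) hp
    rw [ENNReal.ofReal_sub _ hp0, ENNReal.ofReal_one]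
    refine tsub_le_tsub_left ?_ 1
    have hAle : sampleLaw P N A ≤ (Measure.pi fun _ => P) B₁ +
        ((Measure.pi fun _ => P) B₂ + (Measure.pi fun _ => P) B₃) := by
      refine (measure_union_le _ _).trans ?_
      rw [sampleLaw, Measure.prod_prod, Measure.prod_prod, measure_univ, mul_one, one_mul]
      exact add_le_add le_rfl (measure_union_le _ _)
    refine (hAle.trans (add_le_add p₁ (add_le_add p₂ p₃))).trans ?_
    rw [← ENNReal.ofReal_add (Real.exp_nonneg _) (Real.exp_nonneg _),
      ← ENNReal.ofReal_add (Real.exp_nonneg _) (by positivity)]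
    exact ENNReal.ofReal_le_ofReal hp

lemma rE_lt_of_rStar_le {P : Measure (𝓧 × ℝ)} {F : Set (𝓧 → ℝ)} {fs : 𝓧 → ℝ} {N : ℕ}
    {σ c₁ c₂ r : ℝ} (hr : 0 < r) (h : 2 * rStar P N F fs σ c₁ c₂ ≤ ENNReal.ofReal r) :
    rE P N F fs c₁ < ENNReal.ofReal r :=
  ((le_max_left _ _).trans (le_max_right _ _)).trans_lt (lt_ofReal_of_two_mul_le hr h)

lemma rM_lt_of_rStar_le {P : Measure (𝓧 × ℝ)} {F : Set (𝓧 → ℝ)} {fs : 𝓧 → ℝ} {N : ℕ}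
    {σ c₁ c₂ r : ℝ} (hr : 0 < r) (h : 2 * rStar P N F fs σ c₁ c₂ ≤ ENNReal.ofReal r) :
    rM P N F fs c₁ < ENNReal.ofReal r :=
  ((le_max_right _ _).trans (le_max_right _ _)).trans_lt (lt_ofReal_of_two_mul_le hr h)

lemma div_sqrt_le_of_sq_le {x y m : ℝ} (hx : 0 ≤ x) (hy : 0 < y) (hm : (x / y) ^ 2 ≤ m) :
    x / √m ≤ y := by
  rcases hx.eq_or_lt with rfl | hx
  · simpa using hy.le
  have h1 : x / y ≤ √m := Real.le_sqrt_of_sq_le hm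
  rw [div_le_iff₀ ((div_pos hx hy).trans_le h1)]
  rwa [div_le_iff₀' hy] at h1

/-- Rounding N/n down loses at most a factor 2. -/
lemma le_natCast_div {N n : ℕ} {t : ℝ} (hn : 0 < n) (hnN : n ≤ N) (ht : 0 < t)
    (h : (n : ℝ) ≤ t * N) : 1 / (2 * t) ≤ (N / n : ℕ) := by
  have h1 : N ≤ 2 * n * (N / n) := by
    have h1 := Nat.div_add_mod N n
    have h2 := Nat.mod_lt N hn
    have h3 : n ≤ n * (N / n) := Nat.le_mul_of_pos_right n (Nat.div_pos hnN hn)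
    rw [mul_assoc]
    omega
  have h2 : (N : ℝ) ≤ 2 * n * (N / n : ℕ) := by exact_mod_cast h1
  have hN : (0 : ℝ) < N := by exact_mod_cast hn.trans_le hnN
  have h3 : 2 * n * ((N / n : ℕ) : ℝ) ≤ 2 * (t * N) * (N / n : ℕ) := by gcongr
  rw [div_le_iff₀ (by positivity)]
  refine le_of_mul_le_mul_right (a := (N : ℝ)) ?_ hN
  linarith

/-- The tournament theorem in terms of `TournamentSetup`, with constants depending on the norm
comparison ratio `a` and the noise ratio `S` only. -/
theorem exists_tournament_constants {a S : ℝ} (ha : 0 < a) (ha1 : a ≤ 1) (hS : 1 ≤ S) :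
    ∃ (c₀ c₁ c₂ θ α β : ℝ) (ℓ : ℕ),
      0 < c₀ ∧ 0 < c₁ ∧ 0 < c₂ ∧ c₂ < 1 ∧ 0 < θ ∧ θ < 1 / 4 ∧ 0 < α ∧ α < 1 ∧ 1 < β ∧ 1 ≤ ℓ ∧
      ∀ (𝓧 : Type u) [MeasurableSpace 𝓧] (P : Measure (𝓧 × ℝ)) [IsProbabilityMeasure P]
        (F : Set (𝓧 → ℝ)) (fs : 𝓧 → ℝ) (N : ℕ) (σ r : ℝ), 0 < σ → 0 < r →
        TournamentSetup a S σ P F fs →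
        2 * rStar P N F fs σ c₁ c₂ ≤ ENNReal.ofReal r →
        HoldsWithProb (sampleLaw P N)
          (1 - 2 * Real.exp (-(c₀ * N * min 1 (r ^ 2 / σ ^ 2))))
          (preliminaryRoundEvent P F fs N ℓ (numBlocks θ σ r N) α β r) := by
  -- Each deviation condition has a budget, ar/80 for |u| and a²r²/1280 for ξu, split equally
  -- between variance and complexity. The choice of ℓ makes r/√ℓ ≤ ar/160; θ makes the tournament
  -- blocks at least 1/(2θ) long, and longer by σ²/r² when r < σ; c₁ = a²/20480 gives 8c₁r² =
  -- a²r²/2560.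
  set ℓ : ℕ := ⌈(160 / a) ^ 2⌉₊ with hℓ
  set θ : ℝ := (a ^ 2 / (2560 * S)) ^ 2 / 2 with hθ
  have hS0 : 0 < S := by linarith
  have hθ0 : 0 < θ := by positivity
  have haS : a ^ 2 / (2560 * S) ≤ 1 / 2560 := by
    rw [div_le_div_iff₀ (by positivity) (by norm_num)]
    nlinarith
  have hθ1 : θ < 1 / 4 := by
    have := pow_le_pow_left₀ (by positivity) haS 2
    rw [hθ]
    linarith
  have hℓ0 : 0 < ℓ := Nat.ceil_pos.2 (by positivity)
  have hℓ' : (0 : ℝ) < ℓ := by exact_mod_cast hℓ0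
  set c₀ : ℝ := min (θ / 800) (1 / (800 * ℓ)) with hc₀
  have hc₀0 : 0 < c₀ := lt_min (by positivity) (by positivity)
  refine ⟨c₀, a ^ 2 / 20480, 1 / 2, θ, a / 2, 2, ℓ, hc₀0, by positivity, by norm_num,
    by norm_num, hθ0, hθ1, by positivity, by linarith, by norm_num, hℓ0, ?_⟩
  intro 𝓧 _ P _ F fs N σ r hσ hr H hrS
  set M : ℝ := min 1 (r ^ 2 / σ ^ 2) with hM
  have hM0 : 0 < M := lt_min one_pos (by positivity)
  have hM1 : M ≤ 1 := min_le_left _ _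
  set n := numBlocks θ σ r N with hn
  have hn_def : n = ⌊θ * N * M⌋₊ := by rw [hn, numBlocks, div_pow]
  -- If the claimed probability is not positive, the empty set suffices. Otherwise c₀NM > 1/2, which
  -- forces n ≥ 1 and N ≥ ℓ.
  rcases le_or_gt 1 (2 * Real.exp (-(c₀ * N * M))) with htriv | hE
  · exact ⟨∅, Set.empty_subset _, MeasurableSet.empty, by
      rw [ENNReal.ofReal_of_nonpos (by linarith)]; exact zero_le⟩
  have hx : 1 / 2 < c₀ * N * M := by
    have := Real.add_one_le_exp (-(c₀ * N * M))
    linarith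
  have hNM0 : 0 ≤ (N : ℝ) * M := by positivity
  have hθNM : 1 < θ * N * M := by
    have h1 : c₀ * (N * M) ≤ θ / 800 * (N * M) :=
      mul_le_mul_of_nonneg_right (min_le_left _ _) hNM0
    linarith
  have hn0 : 0 < n := by rw [hn_def]; exact Nat.floor_pos.2 hθNM.le
  have hn1 : (1 : ℝ) ≤ n := by exact_mod_cast hn0
  have hnle : (n : ℝ) ≤ θ * M * N := by
    rw [hn_def]
    exact (Nat.floor_le (by positivity)).trans (le_of_eq (by ring))
  have hnlt : θ * N * M < n + 1 := by rw [hn_def]; exact Nat.lt_floor_add_one _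
  have hnN : n ≤ N := by
    have h1 : θ * M * N ≤ 1 * N := by
      refine mul_le_mul_of_nonneg_right ?_ (Nat.cast_nonneg N)
      nlinarith
    have : (n : ℝ) ≤ N := by linarith
    exact_mod_cast this
  have hNℓ : (N : ℝ) * M / (800 * ℓ) ≥ c₀ * N * M := by
    have h1 : c₀ * (N * M) ≤ 1 / (800 * ℓ) * (N * M) :=
      mul_le_mul_of_nonneg_right (min_le_right _ _) hNM0
    rw [mul_assoc, div_eq_inv_mul, ← one_div]
    exact h1
  have hNMN : (N : ℝ) * M ≤ N := mul_le_of_le_one_right (Nat.cast_nonneg N) hM1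
  have hNgt : (ℓ : ℝ) ≤ N := by
    have h1 : 1 / 2 < (N : ℝ) * M / (800 * ℓ) := hx.trans_le hNℓ
    rw [lt_div_iff₀ (by positivity)] at h1
    linarith
  have hk0 : 0 < N / ℓ := Nat.div_pos (by exact_mod_cast hNgt) hℓ0
  have hk1 : (1 : ℝ) ≤ (N / ℓ : ℕ) := by exact_mod_cast hk0
  have hklt : (N : ℝ) / ℓ < (N / ℓ : ℕ) + 1 := by
    rw [div_lt_iff₀ hℓ']
    have h1 := Nat.div_add_mod' N ℓ
    have h2 := Nat.mod_lt N hℓ0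
    have h3 : N < (N / ℓ + 1) * ℓ := by rw [add_mul, one_mul]; omega
    exact_mod_cast h3
  have hm1 : (2560 * S / a ^ 2) ^ 2 ≤ (N / n : ℕ) := by
    have h1 := le_natCast_div hn0 hnN hθ0 (hnle.trans (by
      rw [mul_right_comm]
      exact mul_le_of_le_one_right (by positivity) hM1))
    refine le_trans (le_of_eq ?_) h1
    rw [hθ]
    field_simp
  -- The same length bound with the other term of the minimum in n; the multiplier process needs the
  -- factor σ/r.
  have hm2 : (2560 * S * σ / (a ^ 2 * r)) ^ 2 ≤ (N / n : ℕ) := by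
    have h1 := le_natCast_div (t := θ * (r ^ 2 / σ ^ 2)) hn0 hnN (by positivity) (hnle.trans (by
      gcongr
      exact min_le_right _ _))
    refine le_trans (le_of_eq ?_) h1
    rw [hθ]
    field_simp
  have hc1r : 8 * (a ^ 2 / 20480) * r ≤ a * r / 160 := by
    have : a ^ 2 * r ≤ a * r := mul_le_mul_of_nonneg_right (by nlinarith) hr.le
    have : 0 < a * r := by positivity
    linarith
  have hlen : ∀ m : ℕ, (160 / a) ^ 2 ≤ (m : ℝ) →
      r / √m + 8 * (a ^ 2 / 20480) * r ≤ a * r / 4 / 20 := fun m hm => by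
    have h1 : r / √m ≤ a * r / 160 := by
      refine div_sqrt_le_of_sq_le hr.le (by positivity) (le_trans (le_of_eq ?_) hm)
      field_simp
    linarith
  refine H.holdsWithProb hℓ0 hk0 hn0 hnN ha ha1 hr hS0.le hσ.le (by positivity)
    (rE_lt_of_rStar_le hr hrS) (rM_lt_of_rStar_le hr hrS) (hlen ℓ (Nat.le_ceil _))
    (hlen _ (le_trans ?_ hm1)) ?_ ?_
  · refine pow_le_pow_left₀ (by positivity) ?_ 2
    rw [div_le_div_iff₀ ha (by positivity)]
    nlinarith
  · have h1 : S * σ * r / √(N / n : ℕ) ≤ a ^ 2 * r ^ 2 / 2560 := by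
      refine div_sqrt_le_of_sq_le (by positivity) (by positivity) (le_trans (le_of_eq ?_) hm2)
      field_simp
    linarith
  -- The 800 in c₀ is 200 times 2 for rounding n and N/ℓ down, times 2 to reach E². Since E < 1/2,
  -- the three failure probabilities sum to at most 3E² ≤ 2E.
  · set E := Real.exp (-(c₀ * N * M)) with hEdef
    have hE0 : 0 < E := Real.exp_pos _
    have hEE : Real.exp (-(2 * (c₀ * N * M))) = E ^ 2 := by
      rw [hEdef, ← Real.exp_nat_mul]; congr 1; push_cast; ring
    have e₁ : Real.exp (-((N / ℓ : ℕ) / 200)) ≤ E ^ 2 := by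
      rw [← hEE, Real.exp_le_exp, neg_le_neg_iff]
      have h1 : (N : ℝ) * M / (800 * ℓ) ≤ N / ℓ / 800 := by
        rw [div_div, mul_comm (ℓ : ℝ)]
        gcongr
      linarith
    have e₂ : Real.exp (-(n / 200)) ≤ E ^ 2 := by
      rw [← hEE, Real.exp_le_exp, neg_le_neg_iff]
      have h1 : c₀ * (N * M) ≤ θ / 800 * (N * M) :=
        mul_le_mul_of_nonneg_right (min_le_left _ _) hNM0
      linarith
    have e₃ : E ^ 2 ≤ E * (1 / 2) := by
      rw [sq]; exact mul_le_mul_of_nonneg_left (by linarith) hE0.le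
    linarith

end Constants

end MoMTournament

theorem proposition3p4 :
    (∀ L : ℝ, 1 ≤ L →
      ∃ (c₀ c₁ c₂ θ α β : ℝ) (ℓ : ℕ),
        0 < c₀ ∧ 0 < c₁ ∧ 0 < c₂ ∧ c₂ < 1 ∧ 0 < θ ∧ θ < 1 / 4 ∧ 0 < α ∧ α < 1 ∧ 1 < β ∧ 1 ≤ ℓ ∧
        ∀ (𝓧 : Type u) [MeasurableSpace 𝓧] (P : Measure (𝓧 × ℝ)) [IsProbabilityMeasure P]
          (F : Set (𝓧 → ℝ)) (fs : 𝓧 → ℝ) (N : ℕ) (σ r : ℝ), 0 < σ → 0 < r →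
          MoMTournament.ConvexSetting L σ P F fs →
          2 * MoMTournament.rStar P N F fs σ c₁ c₂ ≤ ENNReal.ofReal r →
          MoMTournament.HoldsWithProb (MoMTournament.sampleLaw P N)
            (1 - 2 * Real.exp (-(c₀ * N * min 1 (r ^ 2 / σ ^ 2))))
            (MoMTournament.preliminaryRoundEvent P F fs N ℓ
              (MoMTournament.numBlocks θ σ r N) α β r)) ∧
    (∀ q L : ℝ, 2 < q → 1 < L →
      ∃ (c₀ c₁ c₂ θ α β : ℝ) (ℓ : ℕ),
        0 < c₀ ∧ 0 < c₁ ∧ 0 < c₂ ∧ c₂ < 1 ∧ 0 < θ ∧ θ < 1 / 4 ∧ 0 < α ∧ α < 1 ∧ 1 < β ∧ 1 ≤ ℓ ∧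
        ∀ (𝓧 : Type u) [MeasurableSpace 𝓧] (P : Measure (𝓧 × ℝ)) [IsProbabilityMeasure P]
          (F : Set (𝓧 → ℝ)) (fs : 𝓧 → ℝ) (N : ℕ) (σ r : ℝ), 0 < σ → 0 < r →
          MoMTournament.IndependentNoiseSetting q L σ P F fs →
          2 * MoMTournament.rStar P N F fs σ c₁ c₂ ≤ ENNReal.ofReal r →
          MoMTournament.HoldsWithProb (MoMTournament.sampleLaw P N)
            (1 - 2 * Real.exp (-(c₀ * N * min 1 (r ^ 2 / σ ^ 2))))
            (MoMTournament.preliminaryRoundEvent P F fs N ℓ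
              (MoMTournament.numBlocks θ σ r N) α β r)) := by
  refine ⟨fun L hL => ?_, fun q L hq hL => ?_⟩
  · obtain ⟨c₀, c₁, c₂, θ, α, β, ℓ, h₁, h₂, h₃, h₄, h₅, h₆, h₇, h₈, h₉, h₁₀, h⟩ :=
      MoMTournament.exists_tournament_constants (MoMTournament.l1Ratio_pos (q := 4) hL)
        (MoMTournament.l1Ratio_le_one (by norm_num) hL) (one_le_pow₀ hL (n := 2))
    exact ⟨c₀, c₁, c₂, θ, α, β, ℓ, h₁, h₂, h₃, h₄, h₅, h₆, h₇, h₈, h₉, h₁₀,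
      fun 𝓧 _ P _ F fs N σ r hσ hr H hrS =>
        h 𝓧 P F fs N σ r hσ hr (H.tournamentSetup hL hσ.le) hrS⟩
  · obtain ⟨c₀, c₁, c₂, θ, α, β, ℓ, h₁, h₂, h₃, h₄, h₅, h₆, h₇, h₈, h₉, h₁₀, h⟩ :=
      MoMTournament.exists_tournament_constants (MoMTournament.l1Ratio_pos (q := q) hL.le)
        (MoMTournament.l1Ratio_le_one hq hL.le) le_rfl
    exact ⟨c₀, c₁, c₂, θ, α, β, ℓ, h₁, h₂, h₃, h₄, h₅, h₆, h₇, h₈, h₉, h₁₀,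
      fun 𝓧 _ P _ F fs N σ r hσ hr H hrS =>
        h 𝓧 P F fs N σ r hσ hr (H.tournamentSetup hq hL.le hσ.le) hrS⟩
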